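/- Let $n\ge 3$ and let $$M=\mathbb{S}^n_+=\{(x_1,\dots,x_{n+1})\in\mathbb{R}^{n+1} : x_1^2+\cdots+x_{n+1}^2=1,\ x_{n+1}\ge 0\}$$ be the closed upper hemisphere, with boundary $\partial M=\{x_{n+1}=0\}\cap M$, equipped with the standard metric $g_c$ induced by the Euclidean metric of $\mathbb{R}^{n+1}$. For a smooth Riemannian metric $g$ on $M$ with induced boundary metric $\gamma=g|_{\partial M}$, let $R_g$ be the scalar curvature of $g$ and let $H_\gamma=\mathrm{tr}_\gamma II_\gamma$ be the mean curvature of $\partial M$, where $II_\gamma(X,Y)=g(\nabla_X\nu,Y)$ and $\nu$ is the outward unit normal. Put $\Psi(g)=(R_g,2H_\gamma)$, and for a smooth symmetric $2$-tensor $h$ on $M$ let $$\mathcal{S}_g(h)=\left.\tfrac{d}{dt}\right|_{t=0}\Psi(g+th)=(\delta R_g h,\,2\,\delta H_\gamma h).$$ Let $\mathcal{S}_g^*$ be the $L^2$-formal adjoint of $\mathcal{S}_g$: $\mathcal{S}^*_g(f_1,f_2)=(A,B)$, with $A$ a smooth symmetric $2$-tensor on $M$ and $B$ a smooth symmetric $2$-tensor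 on $\partial M$, means that for all smooth symmetric $2$-tensors $h$ on $M$ $$\int_M(\delta R_g h)f_1\,dV_g+\int_{\partial M}(2\,\delta H_\gamma h)f_2\,dA_\gamma=\int_M\langle h,A\rangle_g\,dV_g+\int_{\partial M}\langle h,B\rangle_\gamma\,dA_\gamma .$$ Write $\mathcal{S}^*_g(f)=\mathcal{S}^*_g(f,f)$ for $f\in C^\infty(M)$. The metric $g$ is called singular if $\ker\mathcal{S}^*_g=\{f\in C^\infty(M):\mathcal{S}^*_g(f)=0\}\ne\{0\}$. Then $g_c$ is singular, and moreover $$\ker\mathcal{S}^*_{g_c}=\mathrm{span}_{\mathbb{R}}\{x_1,\dots,x_n\},$$ where $x_1,\dots,x_n$ are the restrictions to $\mathbb{S}^n_+$ of the coordinate functions of $\mathbb{R}^{n+1}$ other than $x_{n+1}$. -/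

import Mathlib

open Metric MeasureTheory
open scoped ContDiff

noncomputable section

namespace Hemisphere

/-- The closed upper hemisphere `{x ∈ ℝ^{n+1} : |x| = 1, x_{n+1} ≥ 0}`. -/
def upper (n : ℕ) : Set (EuclideanSpace ℝ (Fin (n + 1))) :=
  {x | ‖x‖ = 1 ∧ 0 ≤ x (Fin.last n)}

/-- The closed unit ball of `ℝⁿ`, the image of the (global) stereographic chart of the upper
hemisphere, projecting from the south pole.  The unit sphere corresponds to the equator. -/
abbrev disc (n : ℕ) : Set (EuclideanSpace ℝ (Fin n)) := closedBall 0 1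

/-- The inverse `y ↦ (2 y, 1 - |y|²) / (1 + |y|²)` of the stereographic chart. -/
def param (n : ℕ) (y : EuclideanSpace ℝ (Fin n)) : EuclideanSpace ℝ (Fin (n + 1)) :=
  WithLp.toLp 2 (Fin.snoc (α := fun _ => ℝ) (fun i => 2 * y i / (1 + ‖y‖ ^ 2))
    ((1 - ‖y‖ ^ 2) / (1 + ‖y‖ ^ 2)))

lemma param_castSucc {n : ℕ} (y : EuclideanSpace ℝ (Fin n)) (i : Fin n) :
    param n y i.castSucc = 2 * y i / (1 + ‖y‖ ^ 2) := by
  simp [param]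

lemma param_last {n : ℕ} (y : EuclideanSpace ℝ (Fin n)) :
    param n y (Fin.last n) = (1 - ‖y‖ ^ 2) / (1 + ‖y‖ ^ 2) := by
  simp [param]

lemma param_mem {n : ℕ} {y : EuclideanSpace ℝ (Fin n)} (hy : y ∈ disc n) :
    param n y ∈ upper n := by
  have hy1 : ‖y‖ ≤ 1 := by simpa using hy
  have hpos : 0 < 1 + ‖y‖ ^ 2 := by positivity
  refine ⟨?_, ?_⟩
  · have hs : ∑ i, (y i) ^ 2 = ‖y‖ ^ 2 := (EuclideanSpace.real_norm_sq_eq y).symm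
    have h : ‖param n y‖ ^ 2 = 1 := by
      rw [EuclideanSpace.real_norm_sq_eq, Fin.sum_univ_castSucc]
      simp only [param_castSucc, param_last, div_pow, mul_pow]
      rw [← Finset.sum_div, ← Finset.mul_sum, hs]
      field_simp
      ring
    nlinarith [norm_nonneg (param n y)]
  · rw [param_last]
    exact div_nonneg (by nlinarith [norm_nonneg y]) hpos.le

/-- The closed unit ball parametrizes the whole upper hemisphere. -/
lemma param_bijOn (n : ℕ) : Set.BijOn (param n) (disc n) (upper n) := by
  refine ⟨fun y hy => param_mem hy, ?_, ?_⟩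
  · intro y _ z _ h
    have hy : 0 < 1 + ‖y‖ ^ 2 := by positivity
    have hz : 0 < 1 + ‖z‖ ^ 2 := by positivity
    have hl := congrArg (fun x : EuclideanSpace ℝ (Fin (n + 1)) => x (Fin.last n)) h
    simp only [param_last] at hl
    rw [div_eq_div_iff hy.ne' hz.ne'] at hl
    have hn : ‖y‖ ^ 2 = ‖z‖ ^ 2 := by nlinarith
    ext i
    have hi := congrArg (fun x : EuclideanSpace ℝ (Fin (n + 1)) => x i.castSucc) h
    simp only [param_castSucc, hn] at hi
    field_simp at hi
    linarith
  · rintro x ⟨hx, hx0⟩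
    set c := x (Fin.last n) with hc
    have hc1 : 0 < 1 + c := by linarith
    have hsum : ∑ i : Fin n, (x i.castSucc) ^ 2 = 1 - c ^ 2 := by
      have := EuclideanSpace.real_norm_sq_eq x
      rw [hx, Fin.sum_univ_castSucc] at this
      linarith
    let y : EuclideanSpace ℝ (Fin n) := WithLp.toLp 2 fun i => x i.castSucc / (1 + c)
    have hy : ‖y‖ ^ 2 = (1 - c) / (1 + c) := by
      rw [EuclideanSpace.real_norm_sq_eq]
      simp only [y, div_pow]
      rw [← Finset.sum_div, hsum]
      field_simp
      ring
    have hs : 1 + ‖y‖ ^ 2 = 2 / (1 + c) := by rw [hy]; field_simp; ring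
    refine ⟨y, ?_, ?_⟩
    · have : ‖y‖ ^ 2 ≤ 1 := by rw [hy, div_le_one hc1]; linarith
      simpa using (sq_le_one_iff₀ (norm_nonneg y)).mp this
    · ext j
      refine Fin.lastCases ?_ (fun i => ?_) j
      · rw [param_last, hs, hy]
        field_simp
        linarith
      · rw [param_castSucc, hs]
        simp only [y]
        field_simp

/-- A function on the hemisphere read in the stereographic chart (`0` outside the chart image). -/
def inChart {n : ℕ} (f : upper n → ℝ) (y : EuclideanSpace ℝ (Fin n)) : ℝ :=
  open Classical in if hy : y ∈ disc n then f ⟨param n y, param_mem hy⟩ else 0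

/-- Membership in `C^∞` of the hemisphere, as a manifold with boundary. -/
def IsSmooth {n : ℕ} (f : upper n → ℝ) : Prop :=
  ContDiffOn ℝ ∞ (inChart f) (disc n)

/-- A 2-tensor field on the hemisphere, through its components `h_{ij}` in the stereographic
chart; only the values on `disc n` matter. -/
abbrev Tensor (n : ℕ) : Type := EuclideanSpace ℝ (Fin n) → Matrix (Fin n) (Fin n) ℝ

/-- Smooth (up to the boundary) symmetric 2-tensor fields. -/
def IsSmoothSymm {n : ℕ} (h : Tensor n) : Prop :=
  (∀ i j, ContDiffOn ℝ ∞ (fun y => h y i j) (disc n)) ∧ ∀ y ∈ disc n, (h y).IsSymm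

/-- Partial derivative `∂_i F`, one-sided at the boundary. -/
def pd {n : ℕ} (i : Fin n) (F : EuclideanSpace ℝ (Fin n) → ℝ) (y : EuclideanSpace ℝ (Fin n)) : ℝ :=
  fderivWithin ℝ F (disc n) y (EuclideanSpace.single i 1)

/-- Christoffel symbols `Γ^k_{ij} = ½ g^{kl} (∂_i g_{lj} + ∂_j g_{li} - ∂_l g_{ij})`. -/
def christoffel {n : ℕ} (g : Tensor n) (k i j : Fin n) (y : EuclideanSpace ℝ (Fin n)) : ℝ :=
  1 / 2 * ∑ l, (g y)⁻¹ k l *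
    (pd i (fun z => g z l j) y + pd j (fun z => g z l i) y - pd l (fun z => g z i j) y)

/-- Ricci tensor
`R_{ij} = ∂_k Γ^k_{ij} - ∂_j Γ^k_{ik} + Γ^k_{kl} Γ^l_{ij} - Γ^k_{jl} Γ^l_{ik}`. -/
def ricci {n : ℕ} (g : Tensor n) (i j : Fin n) (y : EuclideanSpace ℝ (Fin n)) : ℝ :=
  ∑ k, (pd k (christoffel g k i j) y - pd j (christoffel g k i k) y) +
    ∑ k, ∑ l, (christoffel g k k l y * christoffel g l i j y -
      christoffel g k j l y * christoffel g l i k y)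

/-- Scalar curvature `R_g = g^{ij} R_{ij}`. -/
def scalarCurvature {n : ℕ} (g : Tensor n) (y : EuclideanSpace ℝ (Fin n)) : ℝ :=
  ∑ i, ∑ j, (g y)⁻¹ i j * ricci g i j y

/-- Outward unit normal `ν^k = g^{kl} y_l / (g^{ab} y_a y_b)^{1/2}` along the boundary `|y| = 1`,
whose outward conormal is `y`, extended to the punctured ball by the same formula. -/
def normal {n : ℕ} (g : Tensor n) (k : Fin n) (y : EuclideanSpace ℝ (Fin n)) : ℝ :=
  (∑ l, (g y)⁻¹ k l * y l) / √(∑ a, ∑ b, (g y)⁻¹ a b * y a * y b)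

/-- `II_{ij} = g(∇_{∂_i} ν, ∂_j)`.  The second fundamental form of the boundary with respect to
`ν` is the restriction of this bilinear form to vectors tangent to the boundary. -/
def secondForm {n : ℕ} (g : Tensor n) (i j : Fin n) (y : EuclideanSpace ℝ (Fin n)) : ℝ :=
  ∑ k, g y k j * (pd i (normal g k) y + ∑ l, christoffel g k i l y * normal g l y)

/-- Inverse `γ^{ij} = g^{ij} - ν^i ν^j` of the metric induced on the boundary. -/
def boundaryInv {n : ℕ} (g : Tensor n) (i j : Fin n) (y : EuclideanSpace ℝ (Fin n)) : ℝ :=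
  (g y)⁻¹ i j - normal g i y * normal g j y

/-- Mean curvature `H_γ = γ^{ij} II_{ij}` of the boundary. -/
def meanCurvature {n : ℕ} (g : Tensor n) (y : EuclideanSpace ℝ (Fin n)) : ℝ :=
  ∑ i, ∑ j, boundaryInv g i j y * secondForm g i j y

/-- First component of the linearization at `g` of `Ψ(g) = (R_g, 2 H_γ)`, in direction `h`. -/
def linScalar {n : ℕ} (g h : Tensor n) (y : EuclideanSpace ℝ (Fin n)) : ℝ :=
  deriv (fun t : ℝ => scalarCurvature (g + t • h) y) 0

/-- Second component of the linearization at `g` of `Ψ(g) = (R_g, 2 H_γ)`, in direction `h`. -/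
def linMean {n : ℕ} (g h : Tensor n) (y : EuclideanSpace ℝ (Fin n)) : ℝ :=
  deriv (fun t : ℝ => 2 * meanCurvature (g + t • h) y) 0

/-- `∫_M u dV_g`, with `dV_g = (det g)^{1/2} dy`. -/
def integralM {n : ℕ} (g : Tensor n) (u : EuclideanSpace ℝ (Fin n) → ℝ) : ℝ :=
  ∫ y in disc n, u y * √(g y).det

/-- `∫_{∂M} u dA_γ`.  The area form is the contraction of `dV_g` with `ν`, i.e.
`(det g)^{1/2} (ν · y)` times the Euclidean surface measure of the unit sphere. -/
def integralBoundary {n : ℕ} (g : Tensor n) (u : EuclideanSpace ℝ (Fin n) → ℝ) : ℝ :=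
  ∫ y : sphere (0 : EuclideanSpace ℝ (Fin n)) 1,
    u y * (√(g y).det * ∑ l, normal g l y * (y : EuclideanSpace ℝ (Fin n)) l)
    ∂(volume : Measure (EuclideanSpace ℝ (Fin n))).toSphere

/-- `⟨h, A⟩_g = g^{ik} g^{jl} h_{ij} A_{kl}`. -/
def innerM {n : ℕ} (g h A : Tensor n) (y : EuclideanSpace ℝ (Fin n)) : ℝ :=
  ∑ i, ∑ j, ∑ k, ∑ l, (g y)⁻¹ i k * (g y)⁻¹ j l * h y i j * A y k l

/-- `⟨h, B⟩_γ = γ^{ik} γ^{jl} h_{ij} B_{kl}`; it sees only the tangential parts. -/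
def innerBoundary {n : ℕ} (g h B : Tensor n) (y : EuclideanSpace ℝ (Fin n)) : ℝ :=
  ∑ i, ∑ j, ∑ k, ∑ l, boundaryInv g i k y * boundaryInv g j l y * h y i j * B y k l

/-- `S_g^*(f₁, f₂) = (A, B)`, where `S_g^*` is the `L²`-formal adjoint of the linearization
`S_g(h) = (δR_g h, 2 δH_γ h)`: for all smooth symmetric `h`,
`∫_M (δR_g h) f₁ dV_g + ∫_{∂M} (2 δH_γ h) f₂ dA_γ = ∫_M ⟨h, A⟩_g dV_g + ∫_{∂M} ⟨h, B⟩_γ dA_γ`. -/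
def AdjointEq {n : ℕ} (g : Tensor n) (f₁ f₂ : upper n → ℝ) (A B : Tensor n) : Prop :=
  IsSmoothSymm A ∧ IsSmoothSymm B ∧ ∀ h : Tensor n, IsSmoothSymm h →
    integralM g (fun y => linScalar g h y * inChart f₁ y) +
        integralBoundary g (fun y => linMean g h y * inChart f₂ y) =
      integralM g (innerM g h A) + integralBoundary g (innerBoundary g h B)

/-- The kernel of `f ↦ S_g^*(f) = S_g^*(f, f)` on smooth functions. -/
def kerAdjoint {n : ℕ} (g : Tensor n) : Set (upper n → ℝ) :=
  {f | IsSmooth f ∧ AdjointEq g f f 0 0}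

/-- The metric `g` is singular if `S_g^*` has a nonzero element in its kernel. -/
def IsSingular {n : ℕ} (g : Tensor n) : Prop :=
  ∃ f ∈ kerAdjoint g, f ≠ 0

/-- The standard metric of the hemisphere, induced by the Euclidean metric of `ℝ^{n+1}`. -/
def standardMetric (n : ℕ) : Tensor n := fun y =>
  Matrix.of fun i j => inner ℝ (fderiv ℝ (param n) y (EuclideanSpace.single i 1))
    (fderiv ℝ (param n) y (EuclideanSpace.single j 1))

/-- The coordinate functions `x_1, …, x_n` (without `x_{n+1}`) on the hemisphere. -/
def coord {n : ℕ} (i : Fin n) : upper n → ℝ := fun x => x.1 i.castSucc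

end Hemisphere

end

/-!
Integrating the linearization by parts at the standard metric `g` gives, for all `h`,
`∫ F δR(h) + ∫_∂ 2 F δH(h) = ∫ ⟨h, ∇²F - (ΔF) g - F Ric⟩ + ∫_∂ (∂_ν F) tr_γ h`,
because on the boundary everything else is a divergence along the sphere. Testing with `h = φ A`,
where `φ` vanishes on the boundary, and then with multiples of `g` shows that `F` lies in the
kernel iff `∇²F - (ΔF) g - F Ric = 0` and `∂_ν F = 0`. The trace of the tensor equation turns it
into Obata's equation `∇²F = -F g`. In the stereographic chart, where `g = ρ² |dy|²`, this says that
the Euclidean Hessian of `F / ρ` is a multiple of the identity; in dimension at least two `F / ρ`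
is then a quadratic polynomial with pure trace leading part, so that `F` is a linear combination of
`x_1, …, x_{n+1}`, and the Neumann condition removes `x_{n+1}`.
-/

noncomputable section

namespace Hemisphere

variable {n : ℕ}

local notation "δ" => (1 : Matrix (Fin _) (Fin _) ℝ)

section Calculus

variable {u v : EuclideanSpace ℝ (Fin n) → ℝ} {y : EuclideanSpace ℝ (Fin n)}

/-- Smoothness up to the boundary of a function given in the stereographic chart. -/
abbrev SmoothOnDisc (u : EuclideanSpace ℝ (Fin n) → ℝ) : Prop := ContDiffOn ℝ ∞ u (disc n)

lemma uniqueDiffOn_disc : UniqueDiffOn ℝ (disc n) :=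
  uniqueDiffOn_convex (convex_closedBall _ _) ⟨0, by simp [interior_closedBall]⟩

lemma SmoothOnDisc.differentiableWithinAt (hu : SmoothOnDisc u) (hy : y ∈ disc n) :
    DifferentiableWithinAt ℝ u (disc n) y :=
  hu.differentiableOn (by simp) y hy

lemma smoothOnDisc_coord (i : Fin n) : SmoothOnDisc fun y : EuclideanSpace ℝ (Fin n) => y i :=
  (EuclideanSpace.proj (𝕜 := ℝ) i).contDiff.contDiffOn

lemma SmoothOnDisc.pd (hu : SmoothOnDisc u) (i : Fin n) : SmoothOnDisc (pd i u) :=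
  (hu.fderivWithin uniqueDiffOn_disc (by simp)).clm_apply contDiffOn_const

lemma fderivWithin_apply_eq_sum (u : EuclideanSpace ℝ (Fin n) → ℝ)
    (y v : EuclideanSpace ℝ (Fin n)) :
    fderivWithin ℝ u (disc n) y v = ∑ i, v i * pd i u y := by
  conv_lhs => rw [← (EuclideanSpace.basisFun (Fin n) ℝ).sum_repr v]
  simp [pd]

lemma pd_eq_of_hasFDerivAt {L : EuclideanSpace ℝ (Fin n) →L[ℝ] ℝ} (h : HasFDerivAt u L y)
    (hy : y ∈ disc n) (i : Fin n) : pd i u y = L (EuclideanSpace.single i 1) := by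
  rw [pd, h.hasFDerivWithinAt.fderivWithin (uniqueDiffOn_disc y hy)]

lemma pd_congr (h : Set.EqOn u v (disc n)) (i : Fin n) (hy : y ∈ disc n) :
    pd i u y = pd i v y := by
  rw [pd, pd, fderivWithin_congr h (h hy)]

lemma pd_congr_of_eventuallyEq (h : u =ᶠ[nhdsWithin y (disc n)] v) (i : Fin n)
    (hy : y ∈ disc n) : pd i u y = pd i v y := by
  rw [pd, pd, h.fderivWithin_eq (h.self_of_nhdsWithin hy)]

@[simp]
lemma pd_const (c : ℝ) (i : Fin n) : pd i (fun _ => c) y = 0 := by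
  simp [pd]

lemma pd_coord (i j : Fin n) (hy : y ∈ disc n) :
    pd i (fun z => z j) y = δ i j := by
  have h : HasFDerivAt (fun z : EuclideanSpace ℝ (Fin n) => z j)
      (EuclideanSpace.proj (𝕜 := ℝ) j) y := (EuclideanSpace.proj (𝕜 := ℝ) j).hasFDerivAt
  simp [pd_eq_of_hasFDerivAt h hy, Matrix.one_apply, eq_comm]

lemma pd_norm_sq (i : Fin n) (hy : y ∈ disc n) : pd i (fun z => ‖z‖ ^ 2) y = 2 * y i := by
  rw [pd_eq_of_hasFDerivAt (hasStrictFDerivAt_norm_sq y).hasFDerivAt hy]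
  simp [EuclideanSpace.inner_single_right]

lemma pd_add (i : Fin n) (hu : DifferentiableWithinAt ℝ u (disc n) y)
    (hv : DifferentiableWithinAt ℝ v (disc n) y) (hy : y ∈ disc n) :
    pd i (fun z => u z + v z) y = pd i u y + pd i v y := by
  simp only [pd, fderivWithin_fun_add (uniqueDiffOn_disc y hy) hu hv, add_apply]

lemma pd_sub (i : Fin n) (hu : DifferentiableWithinAt ℝ u (disc n) y)
    (hv : DifferentiableWithinAt ℝ v (disc n) y) (hy : y ∈ disc n) :
    pd i (fun z => u z - v z) y = pd i u y - pd i v y := by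
  simp only [pd, fderivWithin_fun_sub (uniqueDiffOn_disc y hy) hu hv, sub_apply]

lemma pd_mul (i : Fin n) (hu : DifferentiableWithinAt ℝ u (disc n) y)
    (hv : DifferentiableWithinAt ℝ v (disc n) y) (hy : y ∈ disc n) :
    pd i (fun z => u z * v z) y = pd i u y * v y + u y * pd i v y := by
  simp only [pd, fderivWithin_fun_mul (uniqueDiffOn_disc y hy) hu hv, add_apply, smul_apply,
    smul_eq_mul]
  ring

lemma pd_const_mul (i : Fin n) (c : ℝ) (hu : DifferentiableWithinAt ℝ u (disc n) y)
    (hy : y ∈ disc n) : pd i (fun z => c * u z) y = c * pd i u y := by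
  rw [pd_mul i (differentiableWithinAt_const c) hu hy, pd_const, zero_mul, zero_add]

lemma pd_sum {ι : Type*} {s : Finset ι} {w : ι → EuclideanSpace ℝ (Fin n) → ℝ} (i : Fin n)
    (hw : ∀ a ∈ s, DifferentiableWithinAt ℝ (w a) (disc n) y) (hy : y ∈ disc n) :
    pd i (fun z => ∑ a ∈ s, w a z) y = ∑ a ∈ s, pd i (w a) y := by
  simp only [pd, fderivWithin_fun_sum (uniqueDiffOn_disc y hy) hw, sum_apply]

lemma pd_comp {φ : ℝ → ℝ} {φ' : ℝ} (i : Fin n) (hφ : HasDerivAt φ φ' (u y))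
    (hu : DifferentiableWithinAt ℝ u (disc n) y) (hy : y ∈ disc n) :
    pd i (fun z => φ (u z)) y = φ' * pd i u y := by
  have h := hφ.comp_hasFDerivWithinAt y hu.hasFDerivWithinAt
  simp only [pd]
  erw [h.fderivWithin (uniqueDiffOn_disc y hy)]
  rfl

lemma pd_comm (i j : Fin n) (hu : SmoothOnDisc u) (hy : y ∈ disc n) :
    pd i (pd j u) y = pd j (pd i u) y := by
  have hd : DifferentiableWithinAt ℝ (fderivWithin ℝ u (disc n)) (disc n) y :=
    (hu.fderivWithin (m := ∞) uniqueDiffOn_disc (by simp)).differentiableOn (by simp) y hy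
  have second (a b : Fin n) : pd a (pd b u) y =
      fderivWithin ℝ (fderivWithin ℝ u (disc n)) (disc n) y (EuclideanSpace.single a 1)
        (EuclideanSpace.single b 1) := by
    change fderivWithin ℝ (fun z => fderivWithin ℝ u (disc n) z _) (disc n) y _ = _
    rw [fderivWithin_clm_apply (uniqueDiffOn_disc y hy) hd (differentiableWithinAt_const _)]
    simp
  have hmem : y ∈ closure (interior (disc n)) := by
    rwa [interior_closedBall _ one_ne_zero, closure_ball _ one_ne_zero]
  rw [second, second]
  exact (hu y hy).isSymmSndFDerivWithinAt
    (by simpa using WithTop.coe_le_coe.mpr (le_top (a := (2 : ℕ∞)))) uniqueDiffOn_disc hmem hy _ _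

lemma eq_of_pd_eq_zero (hu : DifferentiableOn ℝ u (disc n)) (h0 : ∀ z ∈ disc n, ∀ i, pd i u z = 0)
    (hy : y ∈ disc n) : u y = u 0 := by
  refine (convex_closedBall (0 : EuclideanSpace ℝ (Fin n)) 1).is_const_of_fderivWithin_eq_zero
    (𝕜 := ℝ) hu (fun z hz => ?_) hy (by simp)
  ext w
  simp [fderivWithin_apply_eq_sum, h0 z hz]

lemma pd_sum_const_mul_coord (b : Fin n → ℝ) (i : Fin n) (hy : y ∈ disc n) :
    pd i (fun z => ∑ j, b j * z j) y = b i := by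
  have hc (j : Fin n) := (smoothOnDisc_coord j).differentiableWithinAt hy
  rw [pd_sum i (fun j _ => (hc j).const_mul (b j)) hy]
  simp [pd_const_mul i _ (hc _) hy, pd_coord i _ hy, Matrix.one_apply]

lemma eq_affine_of_pd_eq_const {b : Fin n → ℝ} (hu : DifferentiableOn ℝ u (disc n))
    (hb : ∀ z ∈ disc n, ∀ i, pd i u z = b i) (hy : y ∈ disc n) :
    u y = u 0 + ∑ i, b i * y i := by
  have hl : DifferentiableOn ℝ (fun z : EuclideanSpace ℝ (Fin n) => ∑ i, b i * z i) (disc n) := by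
    fun_prop
  have h := eq_of_pd_eq_zero (hu.sub hl) (fun z hz i => ?_) hy
  · simp only [Pi.sub_apply, PiLp.zero_apply, mul_zero, Finset.sum_const_zero, sub_zero] at h
    linarith
  · have := pd_sub i (hu z hz) (hl z hz) hz
    rwa [hb z hz, pd_sum_const_mul_coord b i hz, sub_self] at this

lemma pd_eq_zero_of_hessian_eq_trace (hn : 2 ≤ n) (hu : SmoothOnDisc u)
    (h : ∀ z ∈ disc n, ∀ i j, pd j (pd i u) z = δ i j * v z) (i : Fin n) (hy : y ∈ disc n) :
    pd i v y = 0 := by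
  have : Nontrivial (Fin n) := Fin.nontrivial_iff_two_le.mpr hn
  obtain ⟨j, hj⟩ := exists_ne i
  calc pd i v y = pd i (pd j (pd j u)) y := pd_congr (fun z hz => by simp [h z hz]) i hy
    _ = pd j (pd i (pd j u)) y := pd_comm i j (hu.pd j) hy
    _ = pd j (fun _ => 0) y := pd_congr (fun z hz => by simp [h z hz, hj]) j hy
    _ = 0 := pd_const 0 j

lemma eq_quadratic_of_hessian_eq_trace (hn : 2 ≤ n) (hu : SmoothOnDisc u)
    (hv : DifferentiableOn ℝ v (disc n))
    (h : ∀ z ∈ disc n, ∀ i j, pd j (pd i u) z = δ i j * v z) (hy : y ∈ disc n) :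
    u y = u 0 + ∑ i, pd i u 0 * y i + v 0 * (‖y‖ ^ 2 / 2) := by
  have hv0 {z} (hz : z ∈ disc n) : v z = v 0 :=
    eq_of_pd_eq_zero hv (fun _ hw i => pd_eq_zero_of_hessian_eq_trace hn hu h i hw) hz
  have hgrad (i : Fin n) (z) (hz : z ∈ disc n) : pd i u z = pd i u 0 + v 0 * z i := by
    rw [eq_affine_of_pd_eq_const ((hu.pd i).differentiableOn (by simp))
      (b := fun j => δ i j * v 0) (fun w hw j => by rw [h w hw, hv0 hw]) hz]
    simp [Matrix.one_apply]
  have hsq : DifferentiableOn ℝ (fun z : EuclideanSpace ℝ (Fin n) => v 0 / 2 * ‖z‖ ^ 2) (disc n) :=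
    ((contDiff_norm_sq ℝ (n := 1)).differentiable (by simp)).differentiableOn.const_mul _
  have := eq_affine_of_pd_eq_const (b := fun i => pd i u 0)
    ((hu.differentiableOn (by simp)).sub hsq) (fun z hz i => ?_) hy
  · simp only [Pi.sub_apply, norm_zero] at this
    linarith
  · have := pd_sub i (hu.differentiableWithinAt hz) (hsq z hz) hz
    rw [pd_const_mul i _ ((contDiff_norm_sq ℝ (n := 1)).differentiable (by simp) z
      |>.differentiableWithinAt) hz, pd_norm_sq i hz, hgrad i z hz] at this
    exact this.trans (by ring)

end Calculus

section Divergence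

variable {u v : EuclideanSpace ℝ (Fin n) → ℝ} {y : EuclideanSpace ℝ (Fin n)}

lemma lipschitzWith_indicator_closedBall {E F : Type*} [NormedAddCommGroup E] [NormedSpace ℝ E]
    [NormedAddCommGroup F] {f : E → F} {c : E} {r : ℝ} {K : NNReal}
    (hf : LipschitzOnWith K f (closedBall c r)) (h0 : ∀ y ∈ sphere c r, f y = 0) :
    LipschitzWith K ((closedBall c r).indicator f) := by
  have cross {y z : E} (hy : y ∈ closedBall c r) (hz : z ∉ closedBall c r) :
      dist (f y) 0 ≤ K * dist y z := by
    obtain ⟨p, hp, hpr⟩ := (convex_segment (𝕜 := ℝ) y z).isPreconnected.intermediate_value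
      (left_mem_segment ℝ y z) (right_mem_segment ℝ y z) (f := (dist · c)) (by fun_prop)
      ⟨hy, (not_le.mp hz).le⟩
    have hd := dist_add_dist_of_mem_segment hp
    calc dist (f y) 0 = dist (f y) (f p) := by rw [h0 p hpr]
      _ ≤ K * dist y p := hf.dist_le_mul y hy p hpr.le
      _ ≤ K * dist y z := by gcongr; linarith [dist_nonneg (x := p) (y := z)]
  refine LipschitzWith.of_dist_le_mul fun y z => ?_
  by_cases hy : y ∈ closedBall c r <;> by_cases hz : z ∈ closedBall c r
  · simpa [hy, hz] using hf.dist_le_mul y hy z hz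
  · simpa only [Set.indicator_of_mem hy, Set.indicator_of_notMem hz] using cross hy hz
  · simpa only [Set.indicator_of_notMem hy, Set.indicator_of_mem hz, dist_comm] using cross hz hy
  · simp only [Set.indicator_of_notMem hy, Set.indicator_of_notMem hz, dist_self]
    positivity

lemma integral_lineDeriv_eq_zero {E : Type*} [NormedAddCommGroup E]
    [NormedSpace ℝ E] [FiniteDimensional ℝ E] [MeasurableSpace E] [BorelSpace E] (μ : Measure E)
    [μ.IsAddHaarMeasure] {K : NNReal} {f : E → ℝ} (hf : LipschitzWith K f)
    (hc : HasCompactSupport f) (w : E) : ∫ x, lineDeriv ℝ f x w ∂μ = 0 := by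
  have h := (LipschitzWith.const (1 : ℝ)).integral_lineDeriv_mul_eq (μ := μ) hf hc (-w)
  simpa [lineDeriv] using h.symm

lemma lineDeriv_indicator_disc_of_norm_lt (hu : SmoothOnDisc u) (hy : ‖y‖ < 1) (i : Fin n) :
    lineDeriv ℝ ((disc n).indicator u) y (EuclideanSpace.single i 1) = pd i u y := by
  have hnhds : disc n ∈ nhds y := closedBall_mem_nhds_of_mem (by simpa using hy)
  have hd := (hu.differentiableOn (by simp)).differentiableAt hnhds
  have heq : (disc n).indicator u =ᶠ[nhds y] u := by
    filter_upwards [hnhds] with z hz using Set.indicator_of_mem hz u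
  rw [Filter.EventuallyEq.lineDeriv_eq heq, hd.lineDeriv_eq_fderiv,
    pd_eq_of_hasFDerivAt hd.hasFDerivAt (mem_of_mem_nhds hnhds)]

lemma lineDeriv_indicator_disc_of_lt_norm (hy : 1 < ‖y‖) (w : EuclideanSpace ℝ (Fin n)) :
    lineDeriv ℝ ((disc n).indicator u) y w = 0 := by
  have heq : (disc n).indicator u =ᶠ[nhds y] fun _ => 0 := by
    filter_upwards [isClosed_closedBall.isOpen_compl.mem_nhds (by simpa using hy : y ∈ (disc n)ᶜ)]
      with z hz using Set.indicator_of_notMem hz u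
  rw [heq.lineDeriv_eq, lineDeriv, deriv_const]

lemma integral_pd_eq_zero_of_eqOn_sphere (hu : SmoothOnDisc u) (h0 : ∀ y ∈ sphere 0 1, u y = 0)
    (i : Fin n) : ∫ y in disc n, pd i u y = 0 := by
  have : Nonempty (Fin n) := ⟨i⟩
  obtain ⟨K, hK⟩ := ContDiffOn.exists_lipschitzOnWith hu (by simp) (convex_closedBall _ _)
    (isCompact_closedBall _ _)
  have hsupp : HasCompactSupport ((disc n).indicator u) :=
    .intro (isCompact_closedBall 0 1) fun _ => Set.indicator_of_notMem (f := u)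
  rw [← integral_lineDeriv_eq_zero volume
      (lipschitzWith_indicator_closedBall hK h0) hsupp (EuclideanSpace.single i 1),
    ← integral_indicator measurableSet_closedBall]
  refine integral_congr_ae ?_
  filter_upwards [measure_eq_zero_iff_ae_notMem.mp (Measure.addHaar_sphere volume 0 1)] with y hy
  rcases lt_or_gt_of_ne (show ‖y‖ ≠ 1 by simpa using hy) with h | h
  · rw [Set.indicator_of_mem (by simpa using h.le), lineDeriv_indicator_disc_of_norm_lt hu h]
  · rw [Set.indicator_of_notMem (by simpa using h), lineDeriv_indicator_disc_of_lt_norm h]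

/-- The function `1 - |y|²`, which vanishes to first order on the boundary of the ball. -/
def bdf (y : EuclideanSpace ℝ (Fin n)) : ℝ := 1 - ‖y‖ ^ 2

lemma smoothOnDisc_bdf : SmoothOnDisc (bdf (n := n)) :=
  (contDiff_const.sub (contDiff_norm_sq ℝ)).contDiffOn

lemma bdf_eq_zero (hy : y ∈ sphere (0 : EuclideanSpace ℝ (Fin n)) 1) : bdf y = 0 := by
  simp [bdf, mem_sphere_zero_iff_norm.mp hy]

lemma pd_bdf (i : Fin n) (hy : y ∈ disc n) : pd i bdf y = -2 * y i := by
  change pd i (fun z => 1 - ‖z‖ ^ 2) y = _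
  rw [pd_sub i (differentiableWithinAt_const _)
    ((contDiff_norm_sq ℝ).contDiffOn.differentiableOn (n := 1) (by simp) y hy) hy,
    pd_const, pd_norm_sq i hy]
  ring

lemma SmoothOnDisc.integrableOn (hu : SmoothOnDisc u) : IntegrableOn u (disc n) :=
  hu.continuousOn.integrableOn_compact (isCompact_closedBall _ _)

-- Since `∂ᵢ bdf = -2 yᵢ`, the rotation of `u` is half the curl of `bdf • ∇u`.
lemma integral_rotation_eq_zero (hu : SmoothOnDisc u) (i k : Fin n) :
    ∫ y in disc n, (y k * pd i u y - y i * pd k u y) = 0 := by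
  have hb (j : Fin n) : SmoothOnDisc fun y => bdf y * pd j u y := smoothOnDisc_bdf.mul (hu.pd j)
  have hz (j l : Fin n) : ∫ y in disc n, pd l (fun y => bdf y * pd j u y) y = 0 :=
    integral_pd_eq_zero_of_eqOn_sphere (hb j) (fun y hy => by rw [bdf_eq_zero hy, zero_mul]) l
  have hcurl : ∫ y in disc n, (pd i (fun y => bdf y * pd k u y) y -
      pd k (fun y => bdf y * pd i u y) y) = 0 := by
    rw [integral_sub ((hb k).pd i).integrableOn ((hb i).pd k).integrableOn, hz, hz, sub_zero]
  rw [← mul_zero (1 / 2), ← hcurl, ← integral_const_mul]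
  refine setIntegral_congr_fun measurableSet_closedBall fun y hy => ?_
  have hd := smoothOnDisc_bdf.differentiableWithinAt hy
  simp only [pd_mul _ hd ((hu.pd _).differentiableWithinAt hy) hy, pd_bdf _ hy, pd_comm i k hu hy]
  ring

lemma integral_eq_integral_sphere_integral_Ioi {E : Type*} [NormedAddCommGroup E]
    [NormedSpace ℝ E] [FiniteDimensional ℝ E] [Nontrivial E] [MeasurableSpace E] [BorelSpace E]
    (μ : Measure E) [μ.IsAddHaarMeasure] {F : Type*} [NormedAddCommGroup F] [NormedSpace ℝ F]
    {f : E → F} (hf : Integrable f μ) :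
    ∫ y, f y ∂μ = ∫ θ : sphere (0 : E) 1,
      (∫ r in Set.Ioi (0 : ℝ), r ^ (Module.finrank ℝ E - 1) • f (r • (θ : E))) ∂μ.toSphere := by
  let Φ := homeomorphUnitSphereProd E
  have hΦ : MeasurableEmbedding Φ := Φ.measurableEmbedding
  have hmp := μ.measurePreserving_homeomorphUnitSphereProd
  let p : sphere (0 : E) 1 × Set.Ioi (0 : ℝ) → F := fun q => f ((q.2 : ℝ) • (q.1 : E))
  have hp : p ∘ Φ = f ∘ Subtype.val := by
    ext x
    simp [p, Φ, smul_smul, norm_ne_zero_iff.mpr x.2]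
  have hint : Integrable p (μ.toSphere.prod (.volumeIoiPow (Module.finrank ℝ E - 1))) := by
    rw [← hmp.integrable_comp_emb hΦ, hp,
      ← integrableOn_iff_comap_subtypeVal (measurableSet_singleton _).compl]
    exact hf.integrableOn
  calc ∫ y, f y ∂μ = ∫ x : ({(0)}ᶜ : Set E), (p ∘ Φ) x ∂μ.comap (↑) := by
        rw [hp]
        simp only [Function.comp_apply]
        rw [integral_subtype_comap (measurableSet_singleton _).compl f, restrict_compl_singleton]
    _ = ∫ q, p q ∂μ.toSphere.prod (.volumeIoiPow (Module.finrank ℝ E - 1)) :=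
        hmp.integral_comp hΦ p
    _ = _ := integral_prod _ hint
    _ = _ := by
      congr 1 with θ
      simp only [p, Measure.volumeIoiPow, ENNReal.ofReal]
      rw [integral_withDensity_eq_integral_smul (measurable_subtype_coe.pow_const _).real_toNNReal,
        integral_subtype_comap measurableSet_Ioi
          fun r : ℝ => Real.toNNReal (r ^ (Module.finrank ℝ E - 1)) • f (r • (θ : E))]
      refine setIntegral_congr_fun measurableSet_Ioi fun r hr => ?_
      simp only [NNReal.smul_def, Real.coe_toNNReal _ (pow_nonneg (Set.mem_Ioi.mp hr).le _)]

lemma smul_sphere_mem_disc_iff (θ : sphere (0 : EuclideanSpace ℝ (Fin n)) 1) {r : ℝ}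
    (hr : 0 ≤ r) : r • (θ : EuclideanSpace ℝ (Fin n)) ∈ disc n ↔ r ≤ 1 := by
  simp [norm_smul, abs_of_nonneg hr]

lemma integral_disc_eq_integral_sphere [NeZero n] (hu : ContinuousOn u (disc n)) :
    ∫ y in disc n, u y = ∫ θ : sphere (0 : EuclideanSpace ℝ (Fin n)) 1,
      (∫ r in (0 : ℝ)..1, r ^ (n - 1) * u (r • (θ : EuclideanSpace ℝ (Fin n))))
      ∂(volume : Measure (EuclideanSpace ℝ (Fin n))).toSphere := by
  have : Nonempty (Fin n) := ⟨0⟩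
  have hint := (hu.integrableOn_compact (μ := volume)
    (isCompact_closedBall _ _)).integrable_indicator measurableSet_closedBall
  rw [← integral_indicator measurableSet_closedBall,
    integral_eq_integral_sphere_integral_Ioi volume hint, finrank_euclideanSpace_fin]
  congr 1 with θ
  rw [intervalIntegral.integral_of_le zero_le_one, ← Set.Ioi_inter_Iic,
    ← setIntegral_indicator measurableSet_Iic]
  refine setIntegral_congr_fun measurableSet_Ioi fun r hr => ?_
  by_cases hr1 : r ≤ 1
  · simp [Set.indicator_of_mem, Set.mem_Iic.mpr hr1,
      (smul_sphere_mem_disc_iff θ (Set.mem_Ioi.mp hr).le).mpr hr1]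
  · rw [Set.indicator_of_notMem (mt (smul_sphere_mem_disc_iff θ (Set.mem_Ioi.mp hr).le).mp hr1),
      Set.indicator_of_notMem (by simpa using hr1), smul_zero]

lemma hasDerivAt_ray (hu : SmoothOnDisc u) (θ : sphere (0 : EuclideanSpace ℝ (Fin n)) 1) {r : ℝ}
    (hr : r ∈ Set.Ioo (0 : ℝ) 1) :
    HasDerivAt (fun s => u (s • (θ : EuclideanSpace ℝ (Fin n))))
      (∑ i, (θ : EuclideanSpace ℝ (Fin n)) i * pd i u (r • (θ : EuclideanSpace ℝ (Fin n)))) r := by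
  have hnhds : disc n ∈ nhds (r • (θ : EuclideanSpace ℝ (Fin n))) :=
    closedBall_mem_nhds_of_mem (by simpa [norm_smul, abs_of_pos hr.1] using hr.2)
  have hd := (hu.differentiableWithinAt (mem_of_mem_nhds hnhds)).hasFDerivWithinAt.hasFDerivAt hnhds
  have h := hd.comp_hasDerivAt r ((hasDerivAt_id r).smul_const (θ : EuclideanSpace ℝ (Fin n)))
  rwa [one_smul, fderivWithin_apply_eq_sum] at h

lemma integral_sphere_eq_integral_euler [NeZero n] (hu : SmoothOnDisc u) :
    ∫ θ : sphere (0 : EuclideanSpace ℝ (Fin n)) 1, u θ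
      ∂(volume : Measure (EuclideanSpace ℝ (Fin n))).toSphere =
    ∫ y in disc n, (n * u y + ∑ i, y i * pd i u y) := by
  have hs : SmoothOnDisc fun y => n * u y + ∑ i, y i * pd i u y :=
    (contDiffOn_const.mul hu).add
      (ContDiffOn.sum fun i _ => (smoothOnDisc_coord i).mul (hu.pd i))
  rw [integral_disc_eq_integral_sphere hs.continuousOn]
  congr 1 with θ
  have hmaps : Set.MapsTo (fun r : ℝ => r • (θ : EuclideanSpace ℝ (Fin n))) (Set.Icc 0 1)
      (disc n) := fun r hr => (smul_sphere_mem_disc_iff θ hr.1).mpr hr.2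
  have hray : Continuous fun r : ℝ => r • (θ : EuclideanSpace ℝ (Fin n)) := by fun_prop
  have hFTC := intervalIntegral.integral_eq_sub_of_hasDerivAt_of_le zero_le_one
    ((continuous_pow n).continuousOn.mul (hu.continuousOn.comp hray.continuousOn hmaps))
    (fun r hr => (hasDerivAt_pow n r).mul (hasDerivAt_ray hu θ hr)) (ContinuousOn.intervalIntegrable
      ?_)
  · refine Eq.trans (by simp [NeZero.ne n]) (hFTC.symm.trans (intervalIntegral.integral_congr ?_))
    intro r _
    obtain ⟨m, rfl⟩ := Nat.exists_eq_add_one_of_ne_zero (NeZero.ne n)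
    simp only [Function.comp_apply, PiLp.smul_apply, smul_eq_mul, mul_add,
      Finset.mul_sum, add_tsub_cancel_right]
    congr 1
    · ring
    · exact Finset.sum_congr rfl fun i _ => by ring
  · rw [Set.uIcc_of_le zero_le_one]
    refine ((continuousOn_const.mul (continuous_pow _).continuousOn).mul
      (hu.continuousOn.comp hray.continuousOn hmaps)).add ((continuous_pow n).continuousOn.mul
      (continuousOn_finsetSum _ fun i _ => continuousOn_const.mul
        ((hu.pd i).continuousOn.comp hray.continuousOn hmaps)))

lemma sum_mul_self_eq_norm_sq (y : EuclideanSpace ℝ (Fin n)) : ∑ k, y k * y k = ‖y‖ ^ 2 := by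
  rw [EuclideanSpace.real_norm_sq_eq]
  simp only [pow_two]

lemma pd_sub_euler_eq (hu : SmoothOnDisc u) (i : Fin n) (hy : y ∈ disc n) :
    pd i u y - (n * (u y * y i) + ∑ j, y j * pd j (fun z => u z * z i) y) =
      pd i (fun z => bdf z * u z) y +
        ∑ k, (y k * pd i (fun z => z k * u z) y - y i * pd k (fun z => z k * u z) y) := by
  have hd := hu.differentiableWithinAt hy
  have hcd (j : Fin n) := (smoothOnDisc_coord j).differentiableWithinAt hy
  have hrot (k : Fin n) : y k * (δ i k * u y + y k * pd i u y) -
      y i * (δ k k * u y + y k * pd k u y) =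
      δ i k * y k * u y + y k * y k * pd i u y - y i * u y - y i * (y k * pd k u y) := by
    rw [Matrix.one_apply_eq]; ring
  have heul (k : Fin n) : y k * (pd k u y * y i + u y * δ k i) =
      y i * (y k * pd k u y) + δ k i * y k * u y := by ring
  rw [pd_mul i (smoothOnDisc_bdf.differentiableWithinAt hy) hd hy, pd_bdf i hy]
  simp only [pd_mul _ (hcd _) hd hy, pd_mul _ hd (hcd _) hy, pd_coord _ _ hy, hrot, heul,
    Finset.sum_add_distrib, Finset.sum_sub_distrib, ← Finset.mul_sum, ← Finset.sum_mul,
    sum_mul_self_eq_norm_sq]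
  simp only [Matrix.one_apply, ite_mul, one_mul, zero_mul, Finset.sum_ite_eq, Finset.sum_ite_eq',
    Finset.mem_univ, if_true, neg_mul, bdf, Finset.sum_const, Finset.card_univ, Fintype.card_fin,
    nsmul_eq_mul]
  ring

theorem integral_pd (hu : SmoothOnDisc u) (i : Fin n) :
    ∫ y in disc n, pd i u y = ∫ y : sphere (0 : EuclideanSpace ℝ (Fin n)) 1,
      u y * (y : EuclideanSpace ℝ (Fin n)) i
      ∂(volume : Measure (EuclideanSpace ℝ (Fin n))).toSphere := by
  have : NeZero n := ⟨(Fin.pos i).ne'⟩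
  have hc (j : Fin n) := smoothOnDisc_coord (n := n) j
  have hui : SmoothOnDisc fun y => u y * y i := hu.mul (hc i)
  have hbu : SmoothOnDisc fun y => bdf y * u y := smoothOnDisc_bdf.mul hu
  have huc (k : Fin n) : SmoothOnDisc fun y => y k * u y := (hc k).mul hu
  have hrot (k : Fin n) : SmoothOnDisc fun y =>
      y k * pd i (fun z => z k * u z) y - y i * pd k (fun z => z k * u z) y :=
    ((hc k).mul ((huc k).pd i)).sub ((hc i).mul ((huc k).pd k))
  have hsum : SmoothOnDisc fun y => ∑ k,
      (y k * pd i (fun z => z k * u z) y - y i * pd k (fun z => z k * u z) y) :=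
    ContDiffOn.sum fun k _ => hrot k
  have hzero : ∫ y in disc n, (pd i (fun y => bdf y * u y) y + ∑ k,
      (y k * pd i (fun z => z k * u z) y - y i * pd k (fun z => z k * u z) y)) = 0 := by
    rw [integral_add (hbu.pd i).integrableOn hsum.integrableOn,
      integral_pd_eq_zero_of_eqOn_sphere hbu (fun y hy => by rw [bdf_eq_zero hy, zero_mul]) i,
      integral_finsetSum _ fun k _ => (hrot k).integrableOn]
    simp [integral_rotation_eq_zero (huc _)]
  have hE : SmoothOnDisc fun y => n * (u y * y i) + ∑ j, y j * pd j (fun z => u z * z i) y :=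
    (contDiffOn_const.mul hui).add (ContDiffOn.sum fun j _ => (hc j).mul (hui.pd j))
  rw [integral_sphere_eq_integral_euler hui, ← sub_eq_zero,
    ← integral_sub (hu.pd i).integrableOn hE.integrableOn, ← hzero]
  exact setIntegral_congr_fun measurableSet_closedBall fun y hy => pd_sub_euler_eq hu i hy

lemma SmoothOnDisc.continuous_sphere (hu : SmoothOnDisc u) :
    Continuous fun y : sphere (0 : EuclideanSpace ℝ (Fin n)) 1 => u y :=
  hu.continuousOn.comp_continuous continuous_subtype_val fun y => sphere_subset_closedBall y.2

lemma SmoothOnDisc.integrable_sphere (hu : SmoothOnDisc u) :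
    Integrable (fun y : sphere (0 : EuclideanSpace ℝ (Fin n)) 1 => u y)
      (volume : Measure (EuclideanSpace ℝ (Fin n))).toSphere :=
  hu.continuous_sphere.integrable_of_hasCompactSupport (HasCompactSupport.of_compactSpace _)

theorem integral_div {Z : Fin n → EuclideanSpace ℝ (Fin n) → ℝ}
    (hZ : ∀ k, SmoothOnDisc (Z k)) :
    ∫ y in disc n, ∑ k, pd k (Z k) y = ∫ y : sphere (0 : EuclideanSpace ℝ (Fin n)) 1,
      ∑ k, Z k y * (y : EuclideanSpace ℝ (Fin n)) k
      ∂(volume : Measure (EuclideanSpace ℝ (Fin n))).toSphere := by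
  rw [integral_finsetSum _ fun k _ => ((hZ k).pd k).integrableOn,
    integral_finsetSum _ fun k _ =>
      SmoothOnDisc.integrable_sphere ((hZ k).mul (smoothOnDisc_coord k))]
  exact Finset.sum_congr rfl fun k _ => integral_pd (hZ k) k

lemma integral_sphere_rotation_eq_zero (hu : SmoothOnDisc u) (k l : Fin n) :
    ∫ y : sphere (0 : EuclideanSpace ℝ (Fin n)) 1,
      (pd k u y * (y : EuclideanSpace ℝ (Fin n)) l - pd l u y * (y : EuclideanSpace ℝ (Fin n)) k)
      ∂(volume : Measure (EuclideanSpace ℝ (Fin n))).toSphere = 0 := by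
  rw [integral_sub (SmoothOnDisc.integrable_sphere ((hu.pd k).mul (smoothOnDisc_coord l)))
    (SmoothOnDisc.integrable_sphere ((hu.pd l).mul (smoothOnDisc_coord k))),
    ← integral_pd (hu.pd k) l, ← integral_pd (hu.pd l) k, sub_eq_zero]
  exact setIntegral_congr_fun measurableSet_closedBall fun y hy => pd_comm l k hu hy

/-- At points of the unit sphere, the intrinsic divergence of the tangential part
`U - (y · U) y` of the vector field `U`. -/
def sphereDiv (U : Fin n → EuclideanSpace ℝ (Fin n) → ℝ) (y : EuclideanSpace ℝ (Fin n)) : ℝ :=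
  ∑ k, pd k (U k) y - ∑ l, ∑ k, y l * y k * pd l (U k) y - (n - 1) * ∑ k, y k * U k y

lemma sphereDiv_mul {U : Fin n → EuclideanSpace ℝ (Fin n) → ℝ}
    (hu : DifferentiableWithinAt ℝ u (disc n) y)
    (hU : ∀ k, DifferentiableWithinAt ℝ (U k) (disc n) y) (hy : y ∈ disc n) :
    sphereDiv (fun k z => u z * U k z) y = u y * sphereDiv U y + ∑ k, pd k u y * U k y -
      (∑ l, y l * pd l u y) * ∑ k, y k * U k y := by
  have radial : ∑ l, ∑ k, y l * y k * (pd l u y * U k y + u y * pd l (U k) y) =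
      (∑ l, y l * pd l u y) * ∑ k, y k * U k y + u y * ∑ l, ∑ k, y l * y k * pd l (U k) y := by
    rw [Finset.sum_mul_sum]
    simp only [Finset.mul_sum, ← Finset.sum_add_distrib]
    congr! 2 with l - k -
    ring
  have tangential : ∑ k, y k * (u y * U k y) = u y * ∑ k, y k * U k y := by
    simp only [Finset.mul_sum, mul_left_comm]
  simp only [sphereDiv, pd_mul _ hu (hU _) hy, radial, tangential, Finset.sum_add_distrib,
    ← Finset.mul_sum]
  ring

lemma sphereDiv_eq_sum_rotation {U : Fin n → EuclideanSpace ℝ (Fin n) → ℝ}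
    (hU : ∀ k, SmoothOnDisc (U k)) (hy : ‖y‖ = 1) :
    sphereDiv U y = ∑ l, ∑ k, (pd k (fun z => z l * U k z) y * y l -
      pd l (fun z => z l * U k z) y * y k) := by
  have hyd : y ∈ disc n := by simp [hy]
  have hsq : ∑ k, y k * y k = 1 := by rw [sum_mul_self_eq_norm_sq, hy, one_pow]
  have hrot (l k : Fin n) : pd k (fun z => z l * U k z) y * y l -
      pd l (fun z => z l * U k z) y * y k =
      δ k l * (y l * U k y) + y l * y l * pd k (U k) y - y k * U k y -
        y l * y k * pd l (U k) y := by
    simp only [pd_mul _ ((smoothOnDisc_coord l).differentiableWithinAt hyd)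
      ((hU k).differentiableWithinAt hyd) hyd, pd_coord _ l hyd, Matrix.one_apply_eq]
    ring
  simp only [hrot, Finset.sum_sub_distrib, Finset.sum_add_distrib, ← Finset.mul_sum,
    ← Finset.sum_mul, hsq, sphereDiv]
  simp only [Matrix.one_apply, ite_mul, one_mul, zero_mul, Finset.sum_ite_eq', Finset.mem_univ,
    ↓reduceIte, Finset.sum_const, Finset.card_univ, Fintype.card_fin, nsmul_eq_mul]
  ring

theorem integral_sphereDiv {U : Fin n → EuclideanSpace ℝ (Fin n) → ℝ}
    (hU : ∀ k, SmoothOnDisc (U k)) :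
    ∫ y : sphere (0 : EuclideanSpace ℝ (Fin n)) 1, sphereDiv U y
      ∂(volume : Measure (EuclideanSpace ℝ (Fin n))).toSphere = 0 := by
  have hs (l k : Fin n) : SmoothOnDisc fun y : EuclideanSpace ℝ (Fin n) => y l * U k y :=
    (smoothOnDisc_coord l).mul (hU k)
  have hint (l k : Fin n) := SmoothOnDisc.integrable_sphere
    ((((hs l k).pd k).mul (smoothOnDisc_coord l)).sub (((hs l k).pd l).mul (smoothOnDisc_coord k)))
  simp only [sphereDiv_eq_sum_rotation hU (norm_eq_of_mem_sphere _)]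
  rw [integral_finsetSum _ fun l _ => integrable_finsetSum _ fun k _ => hint l k]
  refine Finset.sum_eq_zero fun l _ => ?_
  rw [integral_finsetSum _ fun k _ => hint l k]
  exact Finset.sum_eq_zero fun k _ => integral_sphere_rotation_eq_zero (hs l k) k l

end Divergence

section MatrixInverse

variable {E : Type*} [NormedAddCommGroup E] [NormedSpace ℝ E] {s : Set E} {x : E}
  {ι : Type*} [Fintype ι] [DecidableEq ι] {M : E → Matrix ι ι ℝ}

open scoped Matrix.Norms.Operator

lemma contDiffWithinAt_matrix_inv {k : WithTop ℕ∞}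
    (hM : ∀ i j, ContDiffWithinAt ℝ k (fun z => M z i j) s x) (hx : IsUnit (M x)) (i j : ι) :
    ContDiffWithinAt ℝ k (fun z => (M z)⁻¹ i j) s x := by
  have hsum : ContDiffWithinAt ℝ k M s x := by
    rw [show M = fun z => ∑ i, ∑ j, M z i j • Matrix.single i j (1 : ℝ) from
      funext fun z => by simpa using Matrix.matrix_eq_sum_single (M z)]
    exact ContDiffWithinAt.sum fun i _ => ContDiffWithinAt.sum fun j _ =>
      (hM i j).smul contDiffWithinAt_const
  obtain ⟨u, hu⟩ := hx
  have hinv : ContDiffAt ℝ k Ring.inverse (M x) := hu ▸ contDiffAt_ringInverse ℝ u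
  simp only [Matrix.nonsing_inv_eq_ringInverse]
  exact (LinearMap.toContinuousLinearMap (Matrix.entryLinearMap ℝ ℝ i j)).contDiff.contDiffAt
    |>.comp_contDiffWithinAt x (hinv.comp_contDiffWithinAt x hsum)

lemma hasFDerivWithinAt_matrix_inv {M' : Matrix ι ι (E →L[ℝ] ℝ)}
    (hM : ∀ i j, HasFDerivWithinAt (fun z => M z i j) (M' i j) s x) (hx : IsUnit (M x)) (i j : ι) :
    HasFDerivWithinAt (fun z => (M z)⁻¹ i j)
      (-∑ a, ∑ b, ((M x)⁻¹ i a * (M x)⁻¹ b j) • M' a b) s x := by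
  have hsum : HasFDerivWithinAt M
      (∑ a, ∑ b, (M' a b).smulRight (Matrix.single a b (1 : ℝ))) s x := by
    rw [show M = fun z => ∑ i, ∑ j, M z i j • Matrix.single i j (1 : ℝ) from
      funext fun z => by simpa using Matrix.matrix_eq_sum_single (M z)]
    exact HasFDerivWithinAt.fun_sum fun a _ => HasFDerivWithinAt.fun_sum fun b _ =>
      (hM a b).smul_const _
  obtain ⟨u, hu⟩ := hx
  have hinv := hasFDerivAt_ringInverse (𝕜 := ℝ) u
  rw [hu] at hinv
  simp only [Matrix.nonsing_inv_eq_ringInverse]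
  refine ((LinearMap.toContinuousLinearMap (Matrix.entryLinearMap ℝ ℝ i j)).hasFDerivAt
    |>.comp_hasFDerivWithinAt x (hinv.comp_hasFDerivWithinAt x hsum)).congr_fderiv ?_
  ext v
  have hv : (∑ a, ∑ b, (M' a b).smulRight (Matrix.single a b (1 : ℝ))) v =
      Matrix.of fun a b => M' a b v := by
    rw [Matrix.matrix_eq_sum_single (Matrix.of fun a b => M' a b v)]
    simp
  change (-((↑u⁻¹ : Matrix ι ι ℝ) *
    (∑ a, ∑ b, (M' a b).smulRight (Matrix.single a b (1 : ℝ))) v *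
      (↑u⁻¹ : Matrix ι ι ℝ))) i j = _
  rw [hv, ← hu, Ring.inverse_unit, Matrix.neg_apply, Matrix.mul_apply, neg_apply, sum_apply,
    Finset.sum_congr rfl fun b _ => by rw [Matrix.mul_apply, Finset.sum_mul], Finset.sum_comm]
  simp only [sum_apply, smul_apply, Matrix.of_apply, smul_eq_mul, mul_right_comm]

end MatrixInverse

/-- The cylinder on which a one-parameter family of functions on the disc is defined. -/
abbrev slab (n : ℕ) : Set (ℝ × EuclideanSpace ℝ (Fin n)) := Set.univ ×ˢ disc n

/-- Smoothness of a one-parameter family of functions on the disc, jointly in the parameter (near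
`0`) and the point (near `y`). -/
abbrev SmoothFamilyAt (F : ℝ → EuclideanSpace ℝ (Fin n) → ℝ) (y : EuclideanSpace ℝ (Fin n)) :
    Prop :=
  ContDiffWithinAt ℝ ∞ (fun p : ℝ × EuclideanSpace ℝ (Fin n) => F p.1 p.2) (slab n) (0, y)

section SmoothFamily

variable {F : ℝ → EuclideanSpace ℝ (Fin n) → ℝ} {y : EuclideanSpace ℝ (Fin n)}

lemma SmoothOnDisc.smoothFamilyAt {u : EuclideanSpace ℝ (Fin n) → ℝ} (hu : SmoothOnDisc u)
    (hy : y ∈ disc n) : SmoothFamilyAt (fun _ => u) y :=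
  (hu y hy).comp (0, y) contDiffWithinAt_snd fun _ hp => hp.2

lemma mem_slab (t : ℝ) (hy : y ∈ disc n) : (t, y) ∈ slab n := ⟨Set.mem_univ t, hy⟩

lemma uniqueDiffOn_slab : UniqueDiffOn ℝ (slab n) :=
  uniqueDiffOn_univ.prod uniqueDiffOn_disc

lemma tendsto_prodMk_nhdsWithin_slab (hy : y ∈ disc n) :
    Filter.Tendsto (fun t : ℝ => (t, y)) (nhds 0) (nhdsWithin (0, y) (slab n)) :=
  tendsto_nhdsWithin_iff.mpr ⟨(Continuous.prodMk_left y).tendsto 0,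
    Filter.Eventually.of_forall fun t => mem_slab t hy⟩

lemma SmoothFamilyAt.eventually_differentiableWithinAt (hF : SmoothFamilyAt F y)
    (hy : y ∈ disc n) : ∀ᶠ p in nhdsWithin (0, y) (slab n), p.2 ∈ disc n ∧
      DifferentiableWithinAt ℝ (Function.uncurry F) (slab n) p := by
  have h := (hF.of_le (m := 1) (by simp)).eventually (by simp)
  rw [Set.insert_eq_of_mem (mem_slab 0 hy)] at h
  filter_upwards [h, self_mem_nhdsWithin] with p hp hmem
  exact ⟨hmem.2, hp.differentiableWithinAt (by simp)⟩

lemma SmoothFamilyAt.eventually_pd_eq (hF : SmoothFamilyAt F y) (hy : y ∈ disc n) (i : Fin n) :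
    ∀ᶠ p in nhdsWithin (0, y) (slab n), pd i (F p.1) p.2 =
      fderivWithin ℝ (Function.uncurry F) (slab n) p (0, EuclideanSpace.single i 1) := by
  filter_upwards [hF.eventually_differentiableWithinAt hy] with ⟨t, z⟩ ⟨hz, h⟩
  have hslice := h.hasFDerivWithinAt.comp z (hasFDerivAt_prodMk_right t z).hasFDerivWithinAt
    fun w => mem_slab t
  rw [pd, show F t = Function.uncurry F ∘ fun w => (t, w) from rfl,
    hslice.fderivWithin (uniqueDiffOn_disc z hz)]
  simp

lemma SmoothFamilyAt.eventually_hasDerivAt (hF : SmoothFamilyAt F y) (hy : y ∈ disc n) :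
    ∀ᶠ p in nhdsWithin (0, y) (slab n), HasDerivAt (fun t => F t p.2)
      (fderivWithin ℝ (Function.uncurry F) (slab n) p (1, 0)) p.1 := by
  filter_upwards [hF.eventually_differentiableWithinAt hy] with ⟨t, z⟩ ⟨hz, h⟩
  have hslice := h.hasFDerivWithinAt.comp_hasFDerivAt t (hasFDerivAt_prodMk_left t z)
    (Filter.Eventually.of_forall fun s => mem_slab s hz)
  simpa using! hslice.hasDerivAt

lemma SmoothFamilyAt.contDiffWithinAt_fderivWithin (hF : SmoothFamilyAt F y) (hy : y ∈ disc n) :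
    ContDiffWithinAt ℝ ∞ (fderivWithin ℝ (Function.uncurry F) (slab n)) (slab n) (0, y) :=
  ContDiffWithinAt.fderivWithin_right hF uniqueDiffOn_slab (by simp) (mem_slab 0 hy)

lemma smoothFamilyAt_pd (hF : SmoothFamilyAt F y) (hy : y ∈ disc n) (i : Fin n) :
    SmoothFamilyAt (fun t => pd i (F t)) y :=
  ((hF.contDiffWithinAt_fderivWithin hy).clm_apply contDiffWithinAt_const).congr_of_eventuallyEq
    (hF.eventually_pd_eq hy i) ((hF.eventually_pd_eq hy i).self_of_nhdsWithin (mem_slab 0 hy))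

lemma SmoothFamilyAt.hasDerivAt_pd {F' : EuclideanSpace ℝ (Fin n) → ℝ} (hF : SmoothFamilyAt F y)
    (hy : y ∈ disc n)
    (hF' : ∀ᶠ z in nhdsWithin y (disc n), HasDerivAt (fun t => F t z) (F' z) 0) (i : Fin n) :
    HasDerivAt (fun t => pd i (F t) y) (pd i F' y) 0 := by
  set A := fderivWithin ℝ (Function.uncurry F) (slab n)
  set A' := fderivWithin ℝ A (slab n) (0, y)
  have hA : HasFDerivWithinAt A A' (slab n) (0, y) :=
    ((hF.contDiffWithinAt_fderivWithin hy).differentiableWithinAt (by simp)).hasFDerivWithinAt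
  have hsymm : IsSymmSndFDerivWithinAt ℝ (Function.uncurry F) (slab n) (0, y) := by
    refine ContDiffWithinAt.isSymmSndFDerivWithinAt hF ?_ uniqueDiffOn_slab ?_ (mem_slab 0 hy)
    · simpa using! WithTop.coe_le_coe.mpr (OrderTop.le_top (2 : ℕ∞))
    · rw [interior_prod_eq, closure_prod_eq, interior_univ, closure_univ,
        interior_closedBall _ one_ne_zero, closure_ball _ one_ne_zero]
      exact mem_slab 0 hy
  have hparam : HasDerivAt (fun t => A (t, y) (0, EuclideanSpace.single i 1))
      (A' (1, 0) (0, EuclideanSpace.single i 1)) 0 := by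
    have h := hA.comp_hasFDerivAt (0 : ℝ) (hasFDerivAt_prodMk_left 0 y)
      (Filter.Eventually.of_forall fun t => mem_slab t hy)
    refine (h.hasDerivAt.clm_apply
      (hasDerivAt_const (0 : ℝ) ((0 : ℝ), EuclideanSpace.single i 1))).congr_deriv ?_
    simp
  have hspace : pd i F' y = A' (0, EuclideanSpace.single i 1) (1, 0) := by
    have hz : Filter.Tendsto (fun z => ((0 : ℝ), z)) (nhdsWithin y (disc n))
        (nhdsWithin (0, y) (slab n)) :=
      (Continuous.prodMk_right 0).continuousWithinAt.tendsto_nhdsWithin fun z => mem_slab 0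
    have hFA : F' =ᶠ[nhdsWithin y (disc n)] fun z => A (0, z) (1, 0) := by
      filter_upwards [hz.eventually (hF.eventually_hasDerivAt hy), hF'] with z h h'
      exact h'.unique h
    have h := (hA.comp y (hasFDerivAt_prodMk_right 0 y).hasFDerivWithinAt
      fun z => mem_slab 0).clm_apply
      (hasFDerivWithinAt_const ((1 : ℝ), (0 : EuclideanSpace ℝ (Fin n))) y (disc n))
    rw [pd, (h.congr_of_eventuallyEq hFA (hFA.self_of_nhdsWithin hy)).fderivWithin
      (uniqueDiffOn_disc y hy)]
    simp
  rw [hspace, hsymm]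
  exact hparam.congr_of_eventuallyEq
    ((tendsto_prodMk_nhdsWithin_slab hy).eventually (hF.eventually_pd_eq hy i))

end SmoothFamily

/-- Riemannian metrics that are smooth up to the boundary, through their components in the
stereographic chart. -/
structure IsMetric (g : Tensor n) : Prop where
  smooth : ∀ i j, SmoothOnDisc fun y => g y i j
  posDef : ∀ y ∈ disc n, (g y).PosDef

namespace IsMetric

variable {g h : Tensor n} {y : EuclideanSpace ℝ (Fin n)}

lemma isUnit (hg : IsMetric g) (hy : y ∈ disc n) : IsUnit (g y) := (hg.posDef y hy).isUnit

lemma apply_comm (hg : IsMetric g) (hy : y ∈ disc n) (i j : Fin n) : g y i j = g y j i :=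
  ((hg.posDef y hy).isHermitian.apply i j).symm

lemma inv_comm (hg : IsMetric g) (hy : y ∈ disc n) (i j : Fin n) : (g y)⁻¹ i j = (g y)⁻¹ j i :=
  ((hg.posDef y hy).inv.isHermitian.apply i j).symm

lemma sum_inv_mul_sum (hg : IsMetric g) (hy : y ∈ disc n) (v : Fin n → ℝ) (i : Fin n) :
    ∑ a, (g y)⁻¹ i a * ∑ l, g y a l * v l = v i := by
  have hdet := (Matrix.isUnit_iff_isUnit_det _).mp (hg.isUnit hy)
  have h : (g y)⁻¹.mulVec ((g y).mulVec v) = v := by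
    rw [Matrix.mulVec_mulVec, Matrix.nonsing_inv_mul _ hdet, Matrix.one_mulVec]
  exact congrFun h i

lemma sum_mul_sum_inv (hg : IsMetric g) (hy : y ∈ disc n) (v : Fin n → ℝ) (i : Fin n) :
    ∑ a, g y i a * ∑ l, (g y)⁻¹ a l * v l = v i := by
  have hdet := (Matrix.isUnit_iff_isUnit_det _).mp (hg.isUnit hy)
  have h : (g y).mulVec ((g y)⁻¹.mulVec v) = v := by
    rw [Matrix.mulVec_mulVec, Matrix.mul_nonsing_inv _ hdet, Matrix.one_mulVec]
  exact congrFun h i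

lemma smooth_inv (hg : IsMetric g) (i j : Fin n) : SmoothOnDisc fun y => (g y)⁻¹ i j :=
  fun y hy => contDiffWithinAt_matrix_inv (fun i j => hg.smooth i j y hy) (hg.isUnit hy) i j

lemma pd_inv (hg : IsMetric g) (hy : y ∈ disc n) (k i j : Fin n) :
    pd k (fun z => (g z)⁻¹ i j) y =
      -∑ a, ∑ b, (g y)⁻¹ i a * (g y)⁻¹ b j * pd k (fun z => g z a b) y := by
  rw [pd, (hasFDerivWithinAt_matrix_inv (fun a b =>
    ((hg.smooth a b).differentiableWithinAt hy).hasFDerivWithinAt) (hg.isUnit hy) i j).fderivWithin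
    (uniqueDiffOn_disc y hy)]
  simp [pd]

lemma smooth_christoffel (hg : IsMetric g) (k i j : Fin n) : SmoothOnDisc (christoffel g k i j) :=
  contDiffOn_const.mul (ContDiffOn.sum fun l _ => (hg.smooth_inv k l).mul
    ((((hg.smooth l j).pd i).add ((hg.smooth l i).pd j)).sub ((hg.smooth i j).pd l)))

lemma christoffel_comm (hg : IsMetric g) (hy : y ∈ disc n) (k i j : Fin n) :
    christoffel g k i j y = christoffel g k j i y := by
  simp only [christoffel]
  congr! 4 with l
  · exact add_comm _ _
  · exact pd_congr (fun z hz => hg.apply_comm hz i j) l hy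

end IsMetric

/-- Twice the Christoffel symbols of the first kind, `∂_i g_{lj} + ∂_j g_{li} - ∂_l g_{ij}`. -/
def christoffelFirst (g : Tensor n) (l i j : Fin n) (y : EuclideanSpace ℝ (Fin n)) : ℝ :=
  pd i (fun z => g z l j) y + pd j (fun z => g z l i) y - pd l (fun z => g z i j) y

namespace IsMetric

variable {g h : Tensor n} {y : EuclideanSpace ℝ (Fin n)}

lemma sum_mul_christoffel (hg : IsMetric g) (hy : y ∈ disc n) (l i j : Fin n) :
    ∑ k, g y l k * christoffel g k i j y = 1 / 2 * christoffelFirst g l i j y := by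
  rw [← hg.sum_mul_sum_inv hy (fun m => christoffelFirst g m i j y) l, Finset.mul_sum]
  exact Finset.sum_congr rfl fun k _ => mul_left_comm _ _ _

lemma pd_apply_eq (hg : IsMetric g) (hy : y ∈ disc n) (k i j : Fin n) :
    pd k (fun z => g z i j) y =
      ∑ l, g y i l * christoffel g l k j y + ∑ l, g y j l * christoffel g l k i y := by
  rw [hg.sum_mul_christoffel hy, hg.sum_mul_christoffel hy, christoffelFirst, christoffelFirst,
    pd_congr (fun z hz => hg.apply_comm hz k i) j hy,
    pd_congr (fun z hz => hg.apply_comm hz k j) i hy,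
    pd_congr (fun z hz => hg.apply_comm hz j i) k hy]
  ring

lemma pd_inv_eq (hg : IsMetric g) (hy : y ∈ disc n) (k i j : Fin n) :
    pd k (fun z => (g z)⁻¹ i j) y =
      -(∑ l, christoffel g i k l y * (g y)⁻¹ l j + ∑ l, christoffel g j k l y * (g y)⁻¹ l i) := by
  rw [hg.pd_inv hy]
  have first : ∑ a, ∑ b, (g y)⁻¹ i a * (g y)⁻¹ b j * ∑ l, g y a l * christoffel g l k b y =
      ∑ b, christoffel g i k b y * (g y)⁻¹ b j := by
    rw [Finset.sum_comm]
    refine Finset.sum_congr rfl fun b _ => ?_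
    simp only [mul_right_comm _ ((g y)⁻¹ b j), ← Finset.sum_mul, hg.sum_inv_mul_sum hy]
  have second : ∑ a, ∑ b, (g y)⁻¹ i a * (g y)⁻¹ b j * ∑ l, g y b l * christoffel g l k a y =
      ∑ a, christoffel g j k a y * (g y)⁻¹ a i := by
    refine Finset.sum_congr rfl fun a _ => ?_
    simp only [hg.inv_comm hy _ j, mul_assoc, ← Finset.mul_sum, hg.sum_inv_mul_sum hy]
    rw [hg.inv_comm hy i a, mul_comm]
  simp only [hg.pd_apply_eq hy, mul_add, Finset.sum_add_distrib, first, second]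

end IsMetric

/-- The first variation `-g⁻¹ h g⁻¹` of the inverse metric in direction `h`. -/
def invVariation (g h : Tensor n) (i j : Fin n) (y : EuclideanSpace ℝ (Fin n)) : ℝ :=
  -∑ a, ∑ b, (g y)⁻¹ i a * (g y)⁻¹ b j * h y a b

/-- The first variation of the Christoffel symbols in direction `h`; in invariant terms
`½ g^{kl} (∇_i h_{lj} + ∇_j h_{li} - ∇_l h_{ij})`. -/
def christoffelVariation (g h : Tensor n) (k i j : Fin n) (y : EuclideanSpace ℝ (Fin n)) : ℝ :=
  ∑ l, (g y)⁻¹ k l * (1 / 2 * christoffelFirst h l i j y - ∑ m, h y l m * christoffel g m i j y)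

/-- The first variation of the Ricci tensor caused by the variation `C` of the Christoffel
symbols. -/
def ricciVariation (g : Tensor n) (C : Fin n → Fin n → Fin n → EuclideanSpace ℝ (Fin n) → ℝ)
    (i j : Fin n) (y : EuclideanSpace ℝ (Fin n)) : ℝ :=
  ∑ k, (pd k (C k i j) y - pd j (C k i k) y) +
    ∑ k, ∑ l, (C k k l y * christoffel g l i j y + christoffel g k k l y * C l i j y -
      (C k j l y * christoffel g l i k y + christoffel g k j l y * C l i k y))

namespace IsMetric

variable {g h : Tensor n} {y : EuclideanSpace ℝ (Fin n)}

lemma smoothFamilyAt_add_smul (hg : IsMetric g) (hh : ∀ i j, SmoothOnDisc fun y => h y i j)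
    (hy : y ∈ disc n) (i j : Fin n) : SmoothFamilyAt (fun t z => (g + t • h) z i j) y :=
  ((hg.smooth i j).smoothFamilyAt hy).add
    (contDiffWithinAt_fst.mul ((hh i j).smoothFamilyAt hy))

lemma smoothFamilyAt_inv (hg : IsMetric g) (hh : ∀ i j, SmoothOnDisc fun y => h y i j)
    (hy : y ∈ disc n) (i j : Fin n) : SmoothFamilyAt (fun t z => ((g + t • h) z)⁻¹ i j) y :=
  contDiffWithinAt_matrix_inv (M := fun p : ℝ × EuclideanSpace ℝ (Fin n) => (g + p.1 • h) p.2)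
    (hg.smoothFamilyAt_add_smul hh hy) (by simpa using hg.isUnit hy) i j

lemma smoothFamilyAt_christoffel (hg : IsMetric g) (hh : ∀ i j, SmoothOnDisc fun y => h y i j)
    (hy : y ∈ disc n) (k i j : Fin n) :
    SmoothFamilyAt (fun t => christoffel (g + t • h) k i j) y :=
  have hpd (a b c : Fin n) := smoothFamilyAt_pd (hg.smoothFamilyAt_add_smul hh hy a b) hy c
  contDiffWithinAt_const.mul (ContDiffWithinAt.sum fun l _ => (hg.smoothFamilyAt_inv hh hy k l).mul
    (((hpd l j i).add (hpd l i j)).sub (hpd i j l)))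

lemma hasDerivAt_add_smul (g h : Tensor n) (y : EuclideanSpace ℝ (Fin n)) (i j : Fin n) :
    HasDerivAt (fun t : ℝ => (g + t • h) y i j) (h y i j) 0 := by
  simpa using ((hasDerivAt_id (0 : ℝ)).mul_const (h y i j)).const_add (g y i j)

lemma hasDerivAt_inv (hg : IsMetric g) (h : Tensor n) (hy : y ∈ disc n) (i j : Fin n) :
    HasDerivAt (fun t : ℝ => ((g + t • h) y)⁻¹ i j) (invVariation g h i j y) 0 := by
  have h := hasFDerivWithinAt_matrix_inv (M := fun t : ℝ => (g + t • h) y) (s := Set.univ)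
    (fun a b => (hasDerivAt_add_smul g h y a b).hasFDerivAt.hasFDerivWithinAt)
    (by simpa using hg.isUnit hy) i j
  refine (hasFDerivWithinAt_univ.mp h).hasDerivAt.congr_deriv ?_
  simp [invVariation]

lemma hasDerivAt_pd_add_smul (hg : IsMetric g) (hh : ∀ i j, SmoothOnDisc fun y => h y i j)
    (hy : y ∈ disc n) (k i j : Fin n) :
    HasDerivAt (fun t : ℝ => pd k (fun z => (g + t • h) z i j) y) (pd k (fun z => h z i j) y) 0 :=
  (hg.smoothFamilyAt_add_smul hh hy i j).hasDerivAt_pd hy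
    (Filter.Eventually.of_forall fun z => hasDerivAt_add_smul g h z i j) k

lemma sum_invVariation_mul (g h : Tensor n) (y : EuclideanSpace ℝ (Fin n)) (k i j : Fin n) :
    1 / 2 * ∑ l, invVariation g h k l y * christoffelFirst g l i j y =
      -∑ a, (g y)⁻¹ k a * ∑ m, h y a m * christoffel g m i j y := by
  have hΓ (m : Fin n) : christoffel g m i j y =
    1 / 2 * ∑ l, (g y)⁻¹ m l * christoffelFirst g l i j y := rfl
  simp only [hΓ, invVariation, neg_mul, Finset.sum_neg_distrib, mul_neg, Finset.sum_mul,
    Finset.mul_sum]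
  rw [Finset.sum_comm]
  refine congrArg _ (Finset.sum_congr rfl fun a _ => Finset.sum_comm.trans ?_)
  exact Finset.sum_congr rfl fun m _ => Finset.sum_congr rfl fun l _ => by ring

lemma hasDerivAt_christoffel (hg : IsMetric g) (hh : ∀ i j, SmoothOnDisc fun y => h y i j)
    (hy : y ∈ disc n) (k i j : Fin n) :
    HasDerivAt (fun t : ℝ => christoffel (g + t • h) k i j y)
      (christoffelVariation g h k i j y) 0 := by
  have hpd (a b c : Fin n) := hg.hasDerivAt_pd_add_smul hh hy c a b
  have hΓ := (HasDerivAt.fun_sum (u := Finset.univ) fun l _ => (hg.hasDerivAt_inv h hy k l).fun_mul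
    (((hpd l j i).fun_add (hpd l i j)).fun_sub (hpd i j l))).const_mul (1 / 2)
  refine hΓ.congr_deriv ?_
  simp only [zero_smul, add_zero]
  change 1 / 2 * ∑ l, (invVariation g h k l y * christoffelFirst g l i j y +
    (g y)⁻¹ k l * christoffelFirst h l i j y) = _
  rw [Finset.sum_add_distrib, mul_add, sum_invVariation_mul]
  simp only [christoffelVariation, mul_sub, Finset.sum_sub_distrib,
    mul_left_comm _ (1 / 2 : ℝ), ← Finset.mul_sum]
  ring

lemma smooth_christoffelVariation (hg : IsMetric g) (hh : ∀ i j, SmoothOnDisc fun y => h y i j)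
    (k i j : Fin n) : SmoothOnDisc (christoffelVariation g h k i j) :=
  ContDiffOn.sum fun l _ => (hg.smooth_inv k l).mul ((contDiffOn_const.mul
    ((((hh l j).pd i).add ((hh l i).pd j)).sub ((hh i j).pd l))).sub
      (ContDiffOn.sum fun m _ => (hh l m).mul (hg.smooth_christoffel m i j)))

lemma hasDerivAt_ricci (hg : IsMetric g) (hh : ∀ i j, SmoothOnDisc fun y => h y i j)
    (hy : y ∈ disc n) (i j : Fin n) :
    HasDerivAt (fun t : ℝ => ricci (g + t • h) i j y)
      (ricciVariation g (christoffelVariation g h) i j y) 0 := by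
  have hΓ (k i j : Fin n) := hg.hasDerivAt_christoffel hh hy k i j
  have hpd (l k i j : Fin n) := (hg.smoothFamilyAt_christoffel hh hy k i j).hasDerivAt_pd hy
    (eventually_mem_nhdsWithin.mono fun z hz => hg.hasDerivAt_christoffel hh hz k i j) l
  refine ((HasDerivAt.fun_sum (u := Finset.univ) fun k _ => (hpd k k i j).fun_sub
    (hpd j k i k)).fun_add (HasDerivAt.fun_sum (u := Finset.univ) fun k _ =>
      HasDerivAt.fun_sum (u := Finset.univ) fun l _ => ((hΓ k k l).fun_mul (hΓ l i j)).fun_sub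
        ((hΓ k j l).fun_mul (hΓ l i k)))).congr_deriv ?_
  simp only [zero_smul, add_zero, ricciVariation]

theorem linScalar_eq (hg : IsMetric g) (hh : ∀ i j, SmoothOnDisc fun y => h y i j)
    (hy : y ∈ disc n) :
    linScalar g h y = ∑ i, ∑ j, (invVariation g h i j y * ricci g i j y +
      (g y)⁻¹ i j * ricciVariation g (christoffelVariation g h) i j y) := by
  refine HasDerivAt.deriv ((HasDerivAt.fun_sum fun i _ => HasDerivAt.fun_sum fun j _ =>
    (hg.hasDerivAt_inv h hy i j).fun_mul (hg.hasDerivAt_ricci hh hy i j)).congr_deriv ?_)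
  simp only [zero_smul, add_zero]

lemma sum_pd_inv (hg : IsMetric g) (hy : y ∈ disc n) (j : Fin n) :
    ∑ k, pd k (fun z => (g z)⁻¹ k j) y =
      -(∑ l, (∑ k, christoffel g k k l y) * (g y)⁻¹ l j +
        ∑ k, ∑ l, (g y)⁻¹ k l * christoffel g j k l y) := by
  simp only [hg.pd_inv_eq hy, Finset.sum_neg_distrib, Finset.sum_add_distrib, Finset.sum_mul]
  rw [Finset.sum_comm]
  congr! 4 with k - l -
  rw [mul_comm, hg.inv_comm hy]

lemma sum_pd_inv_mul (hg : IsMetric g) (hy : y ∈ disc n) {C : Fin n → Fin n → Fin n → ℝ}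
    (hC : ∀ k i j, C k i j = C k j i) :
    ∑ k, ∑ i, ∑ j, pd k (fun z => (g z)⁻¹ i j) y * C k i j =
      -2 * ∑ i, ∑ j, (g y)⁻¹ i j * ∑ k, ∑ l, C k j l * christoffel g l i k y := by
  have hterm (k : Fin n) : ∑ i, ∑ j, (∑ l, christoffel g i k l y * (g y)⁻¹ l j) * C k i j =
      ∑ i, ∑ j, (g y)⁻¹ i j * ∑ l, C k j l * christoffel g l i k y := by
    simp only [Finset.sum_mul, Finset.mul_sum]
    rw [Finset.sum_comm_cycle]
    refine Finset.sum_congr rfl fun i _ => Finset.sum_comm.trans ?_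
    congr! 2 with j - l -
    rw [hg.christoffel_comm hy, hC]
    ring
  have hswap (k : Fin n) : ∑ i, ∑ j, (∑ l, christoffel g j k l y * (g y)⁻¹ l i) * C k i j =
      ∑ i, ∑ j, (∑ l, christoffel g i k l y * (g y)⁻¹ l j) * C k i j := by
    rw [Finset.sum_comm]
    simp only [hC k]
  calc ∑ k, ∑ i, ∑ j, pd k (fun z => (g z)⁻¹ i j) y * C k i j
      = ∑ k, -2 * ∑ i, ∑ j, (g y)⁻¹ i j * ∑ l, C k j l * christoffel g l i k y := by
        refine Finset.sum_congr rfl fun k _ => ?_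
        simp only [hg.pd_inv_eq hy, neg_mul, add_mul, Finset.sum_neg_distrib,
          Finset.sum_add_distrib, hswap, hterm]
        ring
    _ = _ := by
        rw [← Finset.mul_sum]
        simp only [Finset.mul_sum _ _ ((g y)⁻¹ _ _)]
        exact congrArg _ Finset.sum_comm_cycle.symm

end IsMetric

/-- The divergence `∇_k V^k = ∂_k V^k + Γ^l_{lk} V^k` of a vector field with respect to `g`. -/
def divergence (g : Tensor n) (V : Fin n → EuclideanSpace ℝ (Fin n) → ℝ)
    (y : EuclideanSpace ℝ (Fin n)) : ℝ :=
  ∑ k, pd k (V k) y + ∑ k, (∑ l, christoffel g l l k y) * V k y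

/-- The vector field `g^{ij} C^k_{ij} - g^{kj} C^i_{ij}` of Palatini's identity, for a variation `C`
of the Christoffel symbols. -/
def palatiniField (g : Tensor n) (C : Fin n → Fin n → Fin n → EuclideanSpace ℝ (Fin n) → ℝ)
    (k : Fin n) (y : EuclideanSpace ℝ (Fin n)) : ℝ :=
  ∑ i, ∑ j, (g y)⁻¹ i j * C k i j y - ∑ j, (g y)⁻¹ k j * ∑ i, C i i j y

namespace IsMetric

variable {g : Tensor n} {y : EuclideanSpace ℝ (Fin n)}
  {C : Fin n → Fin n → Fin n → EuclideanSpace ℝ (Fin n) → ℝ}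

lemma sum_pd_palatiniField (hg : IsMetric g) (hC : ∀ k i j, SmoothOnDisc (C k i j))
    (hy : y ∈ disc n) :
    ∑ k, pd k (palatiniField g C k) y =
      ∑ k, ∑ i, ∑ j, pd k (fun z => (g z)⁻¹ i j) y * C k i j y +
        ∑ k, ∑ i, ∑ j, (g y)⁻¹ i j * pd k (C k i j) y -
        (∑ j, (∑ k, pd k (fun z => (g z)⁻¹ k j) y) * ∑ i, C i i j y +
          ∑ k, ∑ j, (g y)⁻¹ k j * ∑ i, pd k (C i i j) y) := by
  have hdC (k i j : Fin n) := (hC k i j).differentiableWithinAt hy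
  have hdg (i j : Fin n) := (hg.smooth_inv i j).differentiableWithinAt hy
  have htr (j : Fin n) : DifferentiableWithinAt ℝ (fun z => ∑ i, C i i j z) (disc n) y :=
    DifferentiableWithinAt.fun_sum fun i _ => hdC i i j
  have hpd (k : Fin n) : pd k (palatiniField g C k) y =
      ∑ i, ∑ j, (pd k (fun z => (g z)⁻¹ i j) y * C k i j y + (g y)⁻¹ i j * pd k (C k i j) y) -
        ∑ j, (pd k (fun z => (g z)⁻¹ k j) y * ∑ i, C i i j y +
          (g y)⁻¹ k j * ∑ i, pd k (C i i j) y) := by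
    have hprod (i j : Fin n) := (hdg i j).fun_mul (hdC k i j)
    have hsum (i : Fin n) := DifferentiableWithinAt.fun_sum (u := Finset.univ) fun j _ => hprod i j
    have htrprod (j : Fin n) := (hdg k j).fun_mul (htr j)
    change pd k (fun z => ∑ i, ∑ j, (g z)⁻¹ i j * C k i j z -
      ∑ j, (g z)⁻¹ k j * ∑ i, C i i j z) y = _
    rw [pd_sub k (.fun_sum fun i _ => hsum i) (.fun_sum fun j _ => htrprod j) hy,
      pd_sum k (fun i _ => hsum i) hy, pd_sum k (fun j _ => htrprod j) hy]
    simp only [pd_sum k (fun j _ => hprod _ j) hy, pd_mul k (hdg _ _) (hdC k _ _) hy,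
      pd_mul k (hdg _ _) (htr _) hy, pd_sum k (fun i _ => hdC i i _) hy]
  simp only [hpd, Finset.sum_sub_distrib, Finset.sum_add_distrib, Finset.sum_mul]
  rw [Finset.sum_comm (f := fun k j => pd k (fun z => (g z)⁻¹ k j) y * _)]

lemma sum_inv_mul_ricciVariation (hg : IsMetric g)
    (hsymm : ∀ k i j, Set.EqOn (C k i j) (C k j i) (disc n)) (hy : y ∈ disc n) :
    ∑ i, ∑ j, (g y)⁻¹ i j * ricciVariation g C i j y =
      ∑ k, ∑ i, ∑ j, (g y)⁻¹ i j * pd k (C k i j) y -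
        ∑ k, ∑ j, (g y)⁻¹ k j * ∑ i, pd k (C i i j) y +
        ∑ l, (∑ k, C k k l y) * ∑ i, ∑ j, (g y)⁻¹ i j * christoffel g l i j y +
        ∑ l, (∑ k, christoffel g k k l y) * ∑ i, ∑ j, (g y)⁻¹ i j * C l i j y -
        2 * ∑ i, ∑ j, (g y)⁻¹ i j * ∑ k, ∑ l, C k j l y * christoffel g l i k y := by
  have hric (i j : Fin n) : ricciVariation g C i j y =
      ∑ k, pd k (C k i j) y - ∑ k, pd j (C k k i) y +
        ∑ l, (∑ k, C k k l y) * christoffel g l i j y +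
        ∑ l, (∑ k, christoffel g k k l y) * C l i j y -
        ∑ k, ∑ l, C k j l y * christoffel g l i k y -
        ∑ k, ∑ l, christoffel g k j l y * C l i k y := by
    simp only [ricciVariation, pd_congr (hsymm _ i _) j hy, Finset.sum_add_distrib,
      Finset.sum_sub_distrib, Finset.sum_mul, Finset.sum_comm (f := fun k l => C k k l y * _),
      Finset.sum_comm (f := fun k l => christoffel g k k l y * _)]
    ring
  have hcomm (a : Fin n → ℝ) (F : Fin n → Fin n → Fin n → ℝ) :
      ∑ i, ∑ j, (g y)⁻¹ i j * ∑ l, a l * F l i j = ∑ l, a l * ∑ i, ∑ j, (g y)⁻¹ i j * F l i j := by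
    simp only [Finset.mul_sum, mul_left_comm (a _)]
    exact Finset.sum_comm_cycle
  have hfirst : ∑ i, ∑ j, (g y)⁻¹ i j * ∑ k, pd k (C k i j) y =
      ∑ k, ∑ i, ∑ j, (g y)⁻¹ i j * pd k (C k i j) y := by
    simp only [Finset.mul_sum]
    exact Finset.sum_comm_cycle
  have htrace : ∑ i, ∑ j, (g y)⁻¹ i j * ∑ k, pd j (C k k i) y =
      ∑ k, ∑ j, (g y)⁻¹ k j * ∑ i, pd k (C i i j) y := by
    rw [Finset.sum_comm]
    simp only [hg.inv_comm hy]
  have hlast : ∑ i, ∑ j, (g y)⁻¹ i j * ∑ k, ∑ l, christoffel g k j l y * C l i k y =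
      ∑ i, ∑ j, (g y)⁻¹ i j * ∑ k, ∑ l, C k j l y * christoffel g l i k y := by
    rw [Finset.sum_comm]
    refine Finset.sum_congr rfl fun i _ => Finset.sum_congr rfl fun j _ => ?_
    rw [hg.inv_comm hy, Finset.sum_comm]
    simp only [mul_comm]
  simp only [hric, mul_sub, mul_add, Finset.sum_sub_distrib, Finset.sum_add_distrib, hcomm, hfirst,
    htrace, hlast]
  ring

theorem sum_inv_mul_ricciVariation_eq_divergence (hg : IsMetric g)
    (hC : ∀ k i j, SmoothOnDisc (C k i j)) (hsymm : ∀ k i j, Set.EqOn (C k i j) (C k j i) (disc n))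
    (hy : y ∈ disc n) :
    ∑ i, ∑ j, (g y)⁻¹ i j * ricciVariation g C i j y = divergence g (palatiniField g C) y := by
  rw [hg.sum_inv_mul_ricciVariation hsymm hy, divergence, hg.sum_pd_palatiniField hC hy,
    hg.sum_pd_inv_mul hy fun k i j => hsymm k i j hy]
  simp only [hg.sum_pd_inv hy, palatiniField, mul_sub, Finset.sum_sub_distrib, neg_mul, add_mul,
    Finset.sum_neg_distrib, Finset.sum_add_distrib]
  have htrace : ∑ k, (∑ l, christoffel g l l k y) * ∑ j, (g y)⁻¹ k j * ∑ i, C i i j y =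
      ∑ j, (∑ l, (∑ k, christoffel g k k l y) * (g y)⁻¹ l j) * ∑ i, C i i j y := by
    simp only [Finset.mul_sum _ _ (∑ l, christoffel g l l _ y), Finset.sum_mul _ _ (∑ i, C i i _ y)]
    rw [Finset.sum_comm]
    simp only [mul_assoc]
  have hcontract : ∑ j, (∑ k, ∑ l, (g y)⁻¹ k l * christoffel g j k l y) * ∑ i, C i i j y =
      ∑ l, (∑ k, C k k l y) * ∑ i, ∑ j, (g y)⁻¹ i j * christoffel g l i j y :=
    Finset.sum_congr rfl fun l _ => mul_comm _ _
  rw [htrace, hcontract]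
  ring

end IsMetric

/-- The squared length `g^{ab} y_a y_b` of the radial conormal `y`. -/
def conormSq (g : Tensor n) (y : EuclideanSpace ℝ (Fin n)) : ℝ :=
  ∑ a, ∑ b, (g y)⁻¹ a b * y a * y b

/-- The first variation of `normal g` in direction `h`. -/
def normalVariation (g h : Tensor n) (k : Fin n) (y : EuclideanSpace ℝ (Fin n)) : ℝ :=
  (∑ l, invVariation g h k l y * y l) / √(conormSq g y) -
    (∑ l, (g y)⁻¹ k l * y l) * (∑ a, ∑ b, invVariation g h a b y * y a * y b) /
      (2 * conormSq g y * √(conormSq g y))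

lemma star_dotProduct_mulVec_eq_sum (A : Matrix (Fin n) (Fin n) ℝ) (v : Fin n → ℝ) :
    star v ⬝ᵥ A.mulVec v = ∑ a, ∑ b, A a b * v a * v b := by
  simp only [dotProduct, Matrix.mulVec, star_trivial, Finset.mul_sum]
  congr! 2 with a - b -
  ring

lemma posDef_of_pos_on_sphere {A : Matrix (Fin n) (Fin n) ℝ} (hA : A.IsSymm)
    (h : ∀ v ∈ sphere (0 : EuclideanSpace ℝ (Fin n)) 1, 0 < ∑ a, ∑ b, A a b * v a * v b) :
    A.PosDef := by
  refine .of_dotProduct_mulVec_pos hA fun v hv => ?_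
  set w : EuclideanSpace ℝ (Fin n) := WithLp.toLp 2 v
  have hw : 0 < ‖w‖ := norm_pos_iff.mpr fun hw => hv (congrArg WithLp.ofLp hw)
  have hunit := h (‖w‖⁻¹ • w) (by simp [norm_smul, hw.ne'])
  have hscale : ∑ a, ∑ b, A a b * (‖w‖⁻¹ • w) a * (‖w‖⁻¹ • w) b =
      (‖w‖⁻¹) ^ 2 * ∑ a, ∑ b, A a b * v a * v b := by
    simp only [Finset.mul_sum, PiLp.smul_apply, smul_eq_mul, w]
    congr! 2 with a - b -
    ring
  rw [hscale] at hunit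
  rw [star_dotProduct_mulVec_eq_sum]
  exact pos_of_mul_pos_right hunit (by positivity)

lemma sum_normal_mul (g : Tensor n) (y : EuclideanSpace ℝ (Fin n)) :
    ∑ k, normal g k y * y k = √(conormSq g y) := by
  have hN : ∑ k, (∑ l, (g y)⁻¹ k l * y l) * y k = conormSq g y := by
    simp only [conormSq, Finset.sum_mul, mul_right_comm]
  have hν (k : Fin n) : normal g k y = (∑ l, (g y)⁻¹ k l * y l) / √(conormSq g y) := rfl
  simp only [hν, div_mul_eq_mul_div, ← Finset.sum_div, hN]
  exact Real.div_sqrt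

namespace IsMetric

variable {g h : Tensor n} {y : EuclideanSpace ℝ (Fin n)}

lemma isSmoothSymm (hg : IsMetric g) : IsSmoothSymm g :=
  ⟨hg.smooth, fun y hy => (hg.posDef y hy).isHermitian⟩

lemma eventually_add_smul (hg : IsMetric g) (hh : IsSmoothSymm h) :
    ∀ᶠ t : ℝ in nhds 0, IsMetric (g + t • h) := by
  let q (t : ℝ) (p : disc n × EuclideanSpace ℝ (Fin n)) : ℝ :=
    ∑ a, ∑ b, (g p.1 a b + t * h p.1 a b) * p.2 a * p.2 b
  have hcont {k : Tensor n} (hk : IsSmoothSymm k) (a b : Fin n) :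
      Continuous fun y : disc n => k y a b := (hk.1 a b).continuousOn.domRestrict
  have hqcont : Continuous fun p : ℝ × disc n × EuclideanSpace ℝ (Fin n) => q p.1 p.2 :=
    continuous_finsetSum _ fun a _ => continuous_finsetSum _ fun b _ =>
      ((((hcont hg.isSmoothSymm a b).comp (continuous_fst.comp continuous_snd)).add
        (continuous_fst.mul ((hcont hh a b).comp (continuous_fst.comp continuous_snd)))).mul
        (by fun_prop)).mul (by fun_prop)
  have : CompactSpace (disc n) := isCompact_iff_compactSpace.mp (isCompact_closedBall _ _)
  have hpos : ∀ᶠ t : ℝ in nhds 0, ∀ p ∈ Set.univ ×ˢ sphere 0 1, 0 < q t p := by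
    refine (isCompact_univ.prod (isCompact_sphere _ _)).eventually_forall_of_forall_eventually
      fun ⟨y, v⟩ ⟨_, hv⟩ => hqcont.tendsto (0, y, v) |>.eventually_const_lt ?_
    have hv0 : v.ofLp ≠ 0 := fun h0 => ne_zero_of_mem_unit_sphere ⟨v, hv⟩ (PiLp.ext (congrFun h0))
    simpa [q, ← star_dotProduct_mulVec_eq_sum] using
      (hg.posDef y y.2).dotProduct_mulVec_pos hv0
  filter_upwards [hpos] with t ht
  refine ⟨fun i j => (hg.smooth i j).add (contDiffOn_const.mul (hh.1 i j)), fun y hy => ?_⟩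
  exact posDef_of_pos_on_sphere ((hg.isSmoothSymm.2 y hy).add ((hh.2 y hy).smul t))
    fun v hv => ht (⟨y, hy⟩, v) ⟨trivial, hv⟩

lemma conormSq_pos (hg : IsMetric g) (hy : y ∈ disc n) (hy0 : y ≠ 0) : 0 < conormSq g y := by
  rw [conormSq, ← star_dotProduct_mulVec_eq_sum]
  exact (hg.posDef y hy).inv.dotProduct_mulVec_pos fun h0 => hy0 (PiLp.ext (congrFun h0))

lemma smoothFamilyAt_normal (hg : IsMetric g) (hh : ∀ i j, SmoothOnDisc fun y => h y i j)
    (hy : y ∈ disc n) (hy0 : y ≠ 0) (k : Fin n) :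
    SmoothFamilyAt (fun t => normal (g + t • h) k) y := by
  have hinv (a b : Fin n) := hg.smoothFamilyAt_inv hh hy a b
  have hcoord (a : Fin n) := (smoothOnDisc_coord a).smoothFamilyAt hy
  have hq : SmoothFamilyAt (fun t => conormSq (g + t • h)) y :=
    ContDiffWithinAt.sum fun a _ => ContDiffWithinAt.sum fun b _ =>
      ((hinv a b).mul (hcoord a)).mul (hcoord b)
  have hq0 : 0 < conormSq (g + (0 : ℝ) • h) y := by simpa using hg.conormSq_pos hy hy0
  exact (ContDiffWithinAt.sum fun l _ => (hinv k l).mul (hcoord l)).div (hq.sqrt hq0.ne')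
    (Real.sqrt_ne_zero'.mpr hq0)

lemma differentiableWithinAt_normal (hg : IsMetric g) (hy : y ∈ disc n) (hy0 : y ≠ 0) (k : Fin n) :
    DifferentiableWithinAt ℝ (normal g k) (disc n) y := by
  have h := (hg.smoothFamilyAt_normal (h := 0) (fun _ _ => contDiffOn_const) hy hy0 k).comp y
    (contDiff_prodMk_right (0 : ℝ)).contDiffWithinAt fun z => mem_slab 0
  simpa using! h.differentiableWithinAt (by simp)

lemma hasDerivAt_normal (hg : IsMetric g) (h : Tensor n) (hy : y ∈ disc n) (hy0 : y ≠ 0)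
    (k : Fin n) :
    HasDerivAt (fun t : ℝ => normal (g + t • h) k y) (normalVariation g h k y) 0 := by
  have hinv (a b : Fin n) := hg.hasDerivAt_inv h hy a b
  have hq0 := hg.conormSq_pos hy hy0
  have hq : HasDerivAt (fun t : ℝ => conormSq (g + t • h) y)
      (∑ a, ∑ b, invVariation g h a b y * y a * y b) 0 :=
    HasDerivAt.fun_sum fun a _ => HasDerivAt.fun_sum fun b _ =>
      ((hinv a b).mul_const (y a)).mul_const (y b)
  have hN := HasDerivAt.fun_sum (u := Finset.univ) fun l _ => (hinv k l).mul_const (y l)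
  have hs : √(conormSq g y) ≠ 0 := Real.sqrt_ne_zero'.mpr hq0
  refine (hN.fun_div (hq.sqrt (by simpa using hq0.ne')) (by simpa using hs)).congr_deriv ?_
  have hsqrt := Real.sq_sqrt hq0.le
  simp only [zero_smul, add_zero, normalVariation, hsqrt]
  rw [sub_div]
  field_simp
  rw [hsqrt]

lemma sum_mul_normal (hg : IsMetric g) (hy : y ∈ disc n) (j : Fin n) :
    ∑ k, g y j k * normal g k y = y j / √(conormSq g y) := by
  simp only [normal, ← mul_div_assoc, ← Finset.sum_div, hg.sum_mul_sum_inv hy y.ofLp]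
  rfl

lemma sum_normal_mul_sum_mul_normal (hg : IsMetric g) (hy : y ∈ disc n) (hy0 : y ≠ 0) :
    ∑ j, normal g j y * ∑ k, g y j k * normal g k y = 1 := by
  simp only [hg.sum_mul_normal hy, ← mul_div_assoc, ← Finset.sum_div, sum_normal_mul]
  exact div_self (Real.sqrt_ne_zero'.mpr (hg.conormSq_pos hy hy0))

lemma sum_normal_mul_secondForm (hg : IsMetric g) (hy : y ∈ disc n) (hy0 : y ≠ 0) (i : Fin n) :
    ∑ j, normal g j y * secondForm g i j y = 0 := by
  have hν (k : Fin n) := hg.differentiableWithinAt_normal hy hy0 k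
  have hgd (j k : Fin n) := (hg.smooth j k).differentiableWithinAt hy
  have hgν (j : Fin n) := DifferentiableWithinAt.fun_sum (u := Finset.univ)
    fun k _ => (hgd j k).fun_mul (hν k)
  have hnorm : pd i (fun z => ∑ j, normal g j z * ∑ k, g z j k * normal g k z) y = 0 := by
    rw [pd_congr_of_eventuallyEq (v := fun _ => 1) ?_ i hy, pd_const]
    filter_upwards [self_mem_nhdsWithin, nhdsWithin_le_nhds (isOpen_ne.mem_nhds hy0)] with z hz hz0
    exact hg.sum_normal_mul_sum_mul_normal hz hz0
  have hderiv : ∑ j, pd i (normal g j) y * ∑ k, g y j k * normal g k y =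
      ∑ j, normal g j y * ∑ k, g y k j * pd i (normal g k) y := by
    simp only [Finset.mul_sum]
    rw [Finset.sum_comm]
    exact Finset.sum_congr rfl fun j _ => Finset.sum_congr rfl fun k _ => by ring
  have hconn : ∑ j, normal g j y * ∑ k, (∑ l, g y j l * christoffel g l i k y) * normal g k y =
      ∑ j, normal g j y * ∑ k, g y k j * ∑ l, christoffel g k i l y * normal g l y := by
    refine Finset.sum_congr rfl fun j _ => congrArg _ ?_
    simp only [Finset.mul_sum, Finset.sum_mul, hg.apply_comm hy j, mul_assoc]
    exact Finset.sum_comm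
  have hconn' : ∑ j, normal g j y * ∑ k, (∑ l, g y k l * christoffel g l i j y) * normal g k y =
      ∑ j, normal g j y * ∑ k, (∑ l, g y j l * christoffel g l i k y) * normal g k y := by
    simp only [Finset.mul_sum _ _ (normal g _ y)]
    rw [Finset.sum_comm]
    exact Finset.sum_congr rfl fun j _ => Finset.sum_congr rfl fun k _ => by ring
  rw [pd_sum i (fun j _ => (hν j).fun_mul (hgν j)) hy] at hnorm
  simp only [pd_mul i (hν _) (hgν _) hy, pd_sum i (fun k _ => (hgd _ k).fun_mul (hν k)) hy,
    pd_mul i (hgd _ _) (hν _) hy, hg.pd_apply_eq hy, add_mul, Finset.sum_add_distrib, mul_add,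
    hderiv, hconn', hconn, hg.apply_comm hy _ _] at hnorm
  simp only [secondForm, mul_add, Finset.sum_add_distrib, hg.apply_comm hy _ _]
  linarith

theorem meanCurvature_eq_divergence (hg : IsMetric g) (hy : y ∈ disc n) (hy0 : y ≠ 0) :
    meanCurvature g y = divergence g (normal g) y := by
  have hnormal : ∑ i, ∑ j, normal g i y * normal g j y * secondForm g i j y = 0 := by
    simp only [mul_assoc, ← Finset.mul_sum, hg.sum_normal_mul_secondForm hy hy0, mul_zero,
      Finset.sum_const_zero]
  have htrace (i : Fin n) : ∑ j, (g y)⁻¹ i j * secondForm g i j y =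
      pd i (normal g i) y + ∑ l, christoffel g i i l y * normal g l y := by
    simp only [secondForm, hg.apply_comm hy _]
    exact hg.sum_inv_mul_sum hy
      (fun k => pd i (normal g k) y + ∑ l, christoffel g k i l y * normal g l y) i
  simp only [meanCurvature, boundaryInv, sub_mul, Finset.sum_sub_distrib, hnormal, htrace,
    divergence, Finset.sum_add_distrib, Finset.sum_mul, sub_zero]
  rw [Finset.sum_comm]

theorem linMean_eq (hg : IsMetric g) (hh : IsSmoothSymm h) (hy : y ∈ disc n) (hy0 : y ≠ 0) :
    linMean g h y = 2 * (divergence g (normalVariation g h) y +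
      ∑ k, (∑ l, christoffelVariation g h l l k y) * normal g k y) := by
  have hpd (k : Fin n) := (hg.smoothFamilyAt_normal hh.1 hy hy0 k).hasDerivAt_pd hy
    (F' := normalVariation g h k) (by
      filter_upwards [self_mem_nhdsWithin, nhdsWithin_le_nhds (isOpen_ne.mem_nhds hy0)]
        with z hz hz0
      exact hg.hasDerivAt_normal h hz hz0 k) k
  have hdiv : HasDerivAt (fun t : ℝ => divergence (g + t • h) (normal (g + t • h)) y)
      (divergence g (normalVariation g h) y +
        ∑ k, (∑ l, christoffelVariation g h l l k y) * normal g k y) 0 := by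
    refine ((HasDerivAt.fun_sum fun k _ => hpd k).fun_add (HasDerivAt.fun_sum fun k _ =>
      (HasDerivAt.fun_sum fun l _ => hg.hasDerivAt_christoffel hh.1 hy l l k).fun_mul
        (hg.hasDerivAt_normal h hy hy0 k))).congr_deriv ?_
    simp only [zero_smul, add_zero, divergence, Finset.sum_add_distrib]
    ring
  refine HasDerivAt.deriv ((hdiv.const_mul 2).congr_of_eventuallyEq ?_)
  filter_upwards [hg.eventually_add_smul hh] with t ht
  rw [ht.meanCurvature_eq_divergence hy hy0]

end IsMetric

/-- The conformal factor `ρ` of the standard metric `ρ² |dy|²` in the stereographic chart. -/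
def conformalFactor (y : EuclideanSpace ℝ (Fin n)) : ℝ := 2 / (1 + ‖y‖ ^ 2)

local notation "ρ" => conformalFactor

/-- The components `∂_i log ρ`. -/
def pdLogFactor (i : Fin n) (y : EuclideanSpace ℝ (Fin n)) : ℝ := -(ρ y * y i)

local notation "σ" => pdLogFactor

section StandardMetric

variable {y : EuclideanSpace ℝ (Fin n)}

lemma sum_mul_delta (f : Fin n → ℝ) (i : Fin n) : ∑ k, f k * δ k i = f i := by
  simp [Matrix.one_apply]

lemma sum_mul_delta' (f : Fin n → ℝ) (i : Fin n) : ∑ k, f k * δ i k = f i := by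
  simp [Matrix.one_apply]

lemma sum_delta_self : ∑ k : Fin n, δ k k = n := by simp

lemma delta_comm (i j : Fin n) : δ i j = δ j i := by simp [Matrix.one_apply, eq_comm]

lemma conformalFactor_pos (y : EuclideanSpace ℝ (Fin n)) : 0 < ρ y := by
  unfold conformalFactor; positivity

lemma conformalFactor_eq_one (hy : ‖y‖ = 1) : ρ y = 1 := by
  rw [conformalFactor, hy]; norm_num

lemma smooth_conformalFactor : SmoothOnDisc (conformalFactor (n := n)) :=
  (contDiff_const.div (contDiff_const.add (contDiff_norm_sq ℝ)) fun _ => by positivity).contDiffOn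

lemma smooth_inv_conformalFactor : SmoothOnDisc fun y : EuclideanSpace ℝ (Fin n) => (ρ y)⁻¹ :=
  smooth_conformalFactor.inv fun y _ => (conformalFactor_pos y).ne'

lemma smooth_pdLogFactor (i : Fin n) : SmoothOnDisc (σ i) :=
  (smooth_conformalFactor.mul (smoothOnDisc_coord i)).neg

lemma pd_conformalFactor (i : Fin n) (hy : y ∈ disc n) : pd i ρ y = ρ y * σ i y := by
  have hpos : (0 : ℝ) < 1 + ‖y‖ ^ 2 := by positivity
  have hφ : HasDerivAt (fun s : ℝ => 2 / (1 + s)) (-2 / (1 + ‖y‖ ^ 2) ^ 2) (‖y‖ ^ 2) :=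
    (((hasDerivAt_id _).const_add 1).fun_inv hpos.ne').const_mul 2 |>.congr_deriv (by ring)
  have h := pd_comp i hφ (contDiff_norm_sq ℝ (n := 1)
    |>.contDiffWithinAt.differentiableWithinAt (by simp)) hy
  rw [pd_norm_sq i hy] at h
  refine h.trans ?_
  rw [pdLogFactor, conformalFactor]
  field_simp

lemma pd_conformalFactor_pow (m : ℕ) (i : Fin n) (hy : y ∈ disc n) :
    pd i (fun z => ρ z ^ m) y = m * ρ y ^ m * σ i y := by
  rw [pd_comp i (hasDerivAt_pow m (ρ y)) (smooth_conformalFactor.differentiableWithinAt hy) hy,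
    pd_conformalFactor i hy]
  cases m with
  | zero => simp
  | succ m => simp only [Nat.add_sub_cancel]; ring

lemma pd_inv_conformalFactor (i : Fin n) (hy : y ∈ disc n) :
    pd i (fun z => (ρ z)⁻¹) y = -((ρ y)⁻¹ * σ i y) := by
  have hρ := (conformalFactor_pos y).ne'
  rw [pd_comp i (hasDerivAt_inv hρ) (smooth_conformalFactor.differentiableWithinAt hy) hy,
    pd_conformalFactor i hy]
  field_simp

lemma pd_inv_conformalFactor_pow (m : ℕ) (i : Fin n) (hy : y ∈ disc n) :
    pd i (fun z => (ρ z)⁻¹ ^ m) y = -(m * (ρ y)⁻¹ ^ m * σ i y) := by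
  have hinv := smooth_inv_conformalFactor.differentiableWithinAt hy
  rw [pd_comp i (hasDerivAt_pow m (ρ y)⁻¹) hinv hy, pd_inv_conformalFactor i hy]
  cases m with
  | zero => simp
  | succ m => simp only [Nat.add_sub_cancel]; ring

lemma pd_pdLogFactor (i j : Fin n) (hy : y ∈ disc n) :
    pd j (σ i) y = σ i y * σ j y - ρ y * δ i j := by
  have hρ := smooth_conformalFactor.differentiableWithinAt hy
  have hc := (smoothOnDisc_coord i).differentiableWithinAt hy
  change pd j (fun z => -(ρ z * z i)) y = _
  simp only [neg_eq_neg_one_mul (_ * _)]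
  rw [pd_const_mul j _ (hρ.fun_mul hc) hy, pd_mul j hρ hc hy, pd_conformalFactor j hy,
    pd_coord j i hy, delta_comm j i]
  simp only [pdLogFactor]
  ring

lemma differentiable_param : Differentiable ℝ (param n) := by
  have hnorm : Differentiable ℝ fun z : EuclideanSpace ℝ (Fin n) => ‖z‖ ^ 2 :=
    (contDiff_norm_sq ℝ (n := 1)).differentiable (by simp)
  have hden (z : EuclideanSpace ℝ (Fin n)) : 1 + ‖z‖ ^ 2 ≠ 0 := by positivity
  have hinv := (hnorm.const_add 1).fun_inv hden
  refine differentiable_euclidean.mpr fun a => ?_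
  refine Fin.lastCases ?_ (fun k => ?_) a
  · simp only [param_last, div_eq_mul_inv]
    exact (hnorm.const_sub 1).fun_mul hinv
  · simp only [param_castSucc, div_eq_mul_inv]
    exact Differentiable.fun_mul (by fun_prop) hinv

lemma fderiv_param_single (i : Fin n) (a : Fin (n + 1)) (hy : y ∈ disc n) :
    fderiv ℝ (param n) y (EuclideanSpace.single i 1) a = pd i (fun z => param n z a) y := by
  exact (pd_eq_of_hasFDerivAt (((EuclideanSpace.proj (𝕜 := ℝ) a).hasFDerivAt
    (x := param n y)).comp y (differentiable_param y).hasFDerivAt) hy i).symm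

lemma pd_param_last (i : Fin n) (hy : y ∈ disc n) :
    pd i (fun z => param n z (Fin.last n)) y = ρ y * σ i y := by
  have hlast (z : EuclideanSpace ℝ (Fin n)) : param n z (Fin.last n) = ρ z - 1 := by
    rw [param_last, conformalFactor]; field_simp; ring
  simp only [hlast]
  rw [pd_sub i (smooth_conformalFactor.differentiableWithinAt hy) (differentiableWithinAt_const 1)
    hy, pd_const, pd_conformalFactor i hy, sub_zero]

lemma pd_param_castSucc (i k : Fin n) (hy : y ∈ disc n) :
    pd i (fun z => param n z k.castSucc) y = ρ y * (σ i y * y k + δ i k) := by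
  have hcoord (z : EuclideanSpace ℝ (Fin n)) : param n z k.castSucc = ρ z * z k := by
    rw [param_castSucc, conformalFactor]; ring
  simp only [hcoord]
  rw [pd_mul i (smooth_conformalFactor.differentiableWithinAt hy)
    ((smoothOnDisc_coord k).differentiableWithinAt hy) hy, pd_conformalFactor i hy,
    pd_coord i k hy]
  ring

lemma standardMetric_apply (i j : Fin n) (hy : y ∈ disc n) :
    standardMetric n y i j = ρ y ^ 2 * δ i j := by
  have hexp (k : Fin n) : ρ y * (σ j y * y k + δ j k) * (ρ y * (σ i y * y k + δ i k)) =
      ρ y ^ 2 * (σ i y * σ j y * (y k * y k) + σ j y * y k * δ i k + σ i y * y k * δ j k +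
        δ j k * δ i k) := by ring
  have hρ : ρ y * (1 + ‖y‖ ^ 2) = 2 := div_mul_cancel₀ _ (by positivity)
  simp only [standardMetric, Matrix.of_apply, PiLp.inner_apply, Fin.sum_univ_castSucc,
    fderiv_param_single _ _ hy, pd_param_last _ hy, pd_param_castSucc _ _ hy, RCLike.inner_apply,
    conj_trivial, hexp, ← Finset.mul_sum, Finset.sum_add_distrib, sum_mul_delta',
    sum_mul_self_eq_norm_sq]
  rw [delta_comm j i, pdLogFactor, pdLogFactor]
  linear_combination ρ y ^ 3 * y i * y j * hρ

lemma standardMetric_eq_smul (hy : y ∈ disc n) : standardMetric n y = ρ y ^ 2 • δ := by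
  ext i j
  rw [standardMetric_apply i j hy, Matrix.smul_apply, smul_eq_mul]

lemma isMetric_standardMetric : IsMetric (standardMetric n) where
  smooth i j := ((smooth_conformalFactor.pow 2).mul contDiffOn_const).congr fun _ hy =>
    standardMetric_apply i j hy
  posDef y hy := by
    rw [standardMetric_eq_smul hy]
    exact Matrix.PosDef.one.smul (pow_pos (conformalFactor_pos y) 2)

lemma conformalFactor_mul_inv (y : EuclideanSpace ℝ (Fin n)) : ρ y * (ρ y)⁻¹ = 1 :=
  mul_inv_cancel₀ (conformalFactor_pos y).ne'

lemma standardMetric_inv_apply (i j : Fin n) (hy : y ∈ disc n) :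
    (standardMetric n y)⁻¹ i j = (ρ y)⁻¹ ^ 2 * δ i j := by
  have hinv : (standardMetric n y)⁻¹ = (ρ y)⁻¹ ^ 2 • δ := by
    refine Matrix.inv_eq_right_inv ?_
    rw [standardMetric_eq_smul hy, Matrix.smul_mul, one_mul, smul_smul, ← mul_pow,
      conformalFactor_mul_inv, one_pow, one_smul]
  rw [hinv, Matrix.smul_apply, smul_eq_mul]

lemma sqrt_det_standardMetric (hy : y ∈ disc n) : √(standardMetric n y).det = ρ y ^ n := by
  rw [standardMetric_eq_smul hy, Matrix.det_smul, Matrix.det_one, mul_one, Fintype.card_fin,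
    pow_right_comm, Real.sqrt_sq (pow_nonneg (conformalFactor_pos y).le n)]

lemma pd_standardMetric (k i j : Fin n) (hy : y ∈ disc n) :
    pd k (fun z => standardMetric n z i j) y = 2 * ρ y ^ 2 * (σ k y * δ i j) := by
  rw [pd_congr (fun z hz => standardMetric_apply i j hz) k hy,
    pd_mul k ((smooth_conformalFactor.differentiableWithinAt hy).fun_pow 2)
      (differentiableWithinAt_const _) hy, pd_conformalFactor_pow 2 k hy, pd_const]
  push_cast
  ring

end StandardMetric

/-- The Christoffel symbols of a metric `ρ² |dy|²`, in terms of `σ = d log ρ`. -/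
def conformalChristoffel (k i j : Fin n) (y : EuclideanSpace ℝ (Fin n)) : ℝ :=
  σ i y * δ k j + σ j y * δ k i - σ k y * δ i j

local notation "Γ" => conformalChristoffel

section Curvature

variable {y : EuclideanSpace ℝ (Fin n)}

lemma conformalChristoffel_comm (k i j : Fin n) : Γ k i j y = Γ k j i y := by
  rw [conformalChristoffel, conformalChristoffel, delta_comm i j]; ring

lemma sum_mul_conformalChristoffel (c : Fin n → ℝ) (i j : Fin n) :
    ∑ l, c l * Γ l i j y = σ i y * c j + σ j y * c i - (∑ l, c l * σ l y) * δ i j := by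
  have hexp (l : Fin n) : c l * Γ l i j y =
      σ i y * (c l * δ l j) + σ j y * (c l * δ l i) - c l * σ l y * δ i j := by
    rw [conformalChristoffel]; ring
  simp only [hexp, Finset.sum_sub_distrib, Finset.sum_add_distrib, ← Finset.mul_sum,
    ← Finset.sum_mul, sum_mul_delta]

lemma sum_conformalChristoffel_self (i : Fin n) : ∑ k, Γ k k i y = n * σ i y := by
  simp only [conformalChristoffel, Finset.sum_sub_distrib, Finset.sum_add_distrib, ← Finset.mul_sum,
    sum_delta_self, sum_mul_delta]
  ring

lemma sum_conformalChristoffel_mul (k i : Fin n) :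
    ∑ l, Γ k i l y * σ l y = (∑ l, σ l y * σ l y) * δ k i := by
  have hexp (l : Fin n) : Γ k i l y * σ l y =
      σ i y * (σ l y * δ k l) + σ l y * σ l y * δ k i - σ k y * (σ l y * δ i l) := by
    rw [conformalChristoffel]; ring
  simp only [hexp, Finset.sum_sub_distrib, Finset.sum_add_distrib, ← Finset.mul_sum,
    ← Finset.sum_mul, sum_mul_delta']
  ring

lemma sum_pdLogFactor_mul_self (y : EuclideanSpace ℝ (Fin n)) :
    ∑ l, σ l y * σ l y = 2 * ρ y - ρ y ^ 2 := by
  have hρ : ρ y * (1 + ‖y‖ ^ 2) = 2 := div_mul_cancel₀ _ (by positivity)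
  have hexp (l : Fin n) : σ l y * σ l y = ρ y ^ 2 * (y l * y l) := by rw [pdLogFactor]; ring
  simp only [hexp, ← Finset.mul_sum, sum_mul_self_eq_norm_sq]
  linear_combination ρ y * hρ

lemma christoffel_standardMetric (k i j : Fin n) (hy : y ∈ disc n) :
    christoffel (standardMetric n) k i j y = Γ k i j y := by
  have hexp (l : Fin n) : (standardMetric n y)⁻¹ k l * (pd i (fun z => standardMetric n z l j) y +
      pd j (fun z => standardMetric n z l i) y - pd l (fun z => standardMetric n z i j) y) =
      2 * (ρ y * (ρ y)⁻¹) ^ 2 * (Γ l i j y * δ k l) := by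
    rw [standardMetric_inv_apply k l hy, pd_standardMetric i l j hy, pd_standardMetric j l i hy,
      pd_standardMetric l i j hy, conformalChristoffel]
    ring
  rw [christoffel]
  simp only [hexp, conformalFactor_mul_inv, ← Finset.mul_sum, sum_mul_delta']
  ring

lemma pd_conformalChristoffel (a k i j : Fin n) (hy : y ∈ disc n) :
    pd a (Γ k i j) y =
      pd a (σ i) y * δ k j + pd a (σ j) y * δ k i - pd a (σ k) y * δ i j := by
  have hd (b : Fin n) := (smooth_pdLogFactor b).differentiableWithinAt hy
  have hdm (b : Fin n) (c : ℝ) : DifferentiableWithinAt ℝ (fun z => σ b z * c) (disc n) y :=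
    (hd b).mul_const c
  have hpd (b : Fin n) (c : ℝ) : pd a (fun z => σ b z * c) y = pd a (σ b) y * c := by
    rw [pd_mul a (hd b) (differentiableWithinAt_const c) hy, pd_const, mul_zero, add_zero]
  change pd a (fun z => σ i z * δ k j + σ j z * δ k i - σ k z * δ i j) y = _
  rw [pd_sub a ((hdm _ _).fun_add (hdm _ _)) (hdm _ _) hy, pd_add a (hdm _ _) (hdm _ _) hy,
    hpd, hpd, hpd]

lemma sum_pd_conformalChristoffel_self (a i : Fin n) (hy : y ∈ disc n) :
    ∑ k, pd a (Γ k i k) y = n * pd a (σ i) y := by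
  simp only [pd_conformalChristoffel _ _ _ _ hy, Finset.sum_sub_distrib, Finset.sum_add_distrib,
    ← Finset.mul_sum, sum_delta_self, sum_mul_delta, sum_mul_delta']
  ring

lemma sum_pd_conformalChristoffel (i j : Fin n) (hy : y ∈ disc n) :
    ∑ k, pd k (Γ k i j) y =
      2 * σ i y * σ j y - 2 * ρ y * δ i j - (∑ k, σ k y * σ k y - n * ρ y) * δ i j := by
  have hdiv : ∑ k, pd k (σ k) y = ∑ k, σ k y * σ k y - n * ρ y := by
    simp only [pd_pdLogFactor _ _ hy, Finset.sum_sub_distrib, ← Finset.mul_sum, sum_delta_self]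
    ring
  simp only [pd_conformalChristoffel _ _ _ _ hy, Finset.sum_sub_distrib, Finset.sum_add_distrib,
    ← Finset.sum_mul, sum_mul_delta, hdiv, pd_pdLogFactor i j hy, pd_pdLogFactor j i hy,
    delta_comm j i]
  ring

lemma ricci_standardMetric (i j : Fin n) (hy : y ∈ disc n) :
    ricci (standardMetric n) i j y = (n - 1) * ρ y ^ 2 * δ i j := by
  have hpd (a k i j : Fin n) : pd a (christoffel (standardMetric n) k i j) y = pd a (Γ k i j) y :=
    pd_congr (fun z hz => christoffel_standardMetric k i j hz) a hy
  have htrace : ∑ k, ∑ l, Γ k k l y * Γ l i j y =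
      n * (2 * (σ i y * σ j y) - (∑ l, σ l y * σ l y) * δ i j) := by
    rw [Finset.sum_comm]
    simp only [← Finset.sum_mul, sum_conformalChristoffel_self, mul_assoc, ← Finset.mul_sum,
      sum_mul_conformalChristoffel]
    ring
  have hsquare : ∑ k, ∑ l, Γ k j l y * Γ l i k y =
      (n + 2) * (σ i y * σ j y) - 2 * (∑ l, σ l y * σ l y) * δ i j := by
    have hself : ∑ k, Γ k j k y = n * σ j y := by
      simp only [conformalChristoffel_comm _ j, sum_conformalChristoffel_self]
    have hcross : ∑ k, Γ k j i y * σ k y = 2 * (σ i y * σ j y) - (∑ l, σ l y * σ l y) * δ i j := by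
      simp only [mul_comm (Γ _ j i y), sum_mul_conformalChristoffel, delta_comm j i]
      ring
    simp only [sum_mul_conformalChristoffel (fun l => Γ _ j l y), Finset.sum_sub_distrib,
      Finset.sum_add_distrib, ← Finset.mul_sum, hself, mul_comm (σ _ y) (Γ _ j i y), hcross,
      sum_conformalChristoffel_mul, mul_assoc, sum_mul_delta', delta_comm i j]
    ring
  rw [ricci]
  simp only [hpd, christoffel_standardMetric _ _ _ hy, Finset.sum_sub_distrib, htrace, hsquare,
    sum_pd_conformalChristoffel _ _ hy, sum_pd_conformalChristoffel_self _ _ hy,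
    pd_pdLogFactor _ _ hy, sum_pdLogFactor_mul_self]
  ring

end Curvature

section ScalarVariation

variable {g h : Tensor n} {y : EuclideanSpace ℝ (Fin n)}

lemma IsSmoothSymm.apply_comm (hh : IsSmoothSymm h) (hy : y ∈ disc n) (i j : Fin n) :
    h y i j = h y j i :=
  (hh.2 y hy).apply j i

lemma IsSmoothSymm.smooth (hh : IsSmoothSymm h) (i j : Fin n) : SmoothOnDisc fun y => h y i j :=
  hh.1 i j

lemma IsSmoothSymm.smooth_trace (hh : IsSmoothSymm h) : SmoothOnDisc fun y => (h y).trace :=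
  ContDiffOn.sum fun i _ => hh.smooth i i

lemma IsSmoothSymm.pd_trace (hh : IsSmoothSymm h) (k : Fin n) (hy : y ∈ disc n) :
    pd k (fun z => (h z).trace) y = ∑ i, pd k (fun z => h z i i) y :=
  pd_sum k (fun i _ => (hh.smooth i i).differentiableWithinAt hy) hy

lemma IsMetric.christoffelVariation_comm (hg : IsMetric g) (hh : IsSmoothSymm h) (hy : y ∈ disc n)
    (k i j : Fin n) : christoffelVariation g h k i j y = christoffelVariation g h k j i y := by
  simp only [christoffelVariation, christoffelFirst, hg.christoffel_comm hy _ i j,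
    pd_congr (fun _ hz => hh.apply_comm hz i j) _ hy, add_comm (pd i _ y)]

lemma divergence_standardMetric (V : Fin n → EuclideanSpace ℝ (Fin n) → ℝ) (hy : y ∈ disc n) :
    divergence (standardMetric n) V y = ∑ k, pd k (V k) y + n * ∑ k, σ k y * V k y := by
  simp only [divergence, christoffel_standardMetric _ _ _ hy, sum_conformalChristoffel_self,
    mul_assoc, ← Finset.mul_sum]

lemma invVariation_standardMetric (h : Tensor n) (i j : Fin n) (hy : y ∈ disc n) :
    invVariation (standardMetric n) h i j y = -((ρ y)⁻¹ ^ 4 * h y i j) := by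
  have hexp (a b : Fin n) : (ρ y)⁻¹ ^ 2 * δ i a * ((ρ y)⁻¹ ^ 2 * δ b j) * h y a b =
      (ρ y)⁻¹ ^ 4 * (h y a b * δ b j * δ i a) := by ring
  simp only [invVariation, standardMetric_inv_apply _ _ hy, hexp, ← Finset.mul_sum,
    ← Finset.sum_mul, sum_mul_delta, sum_mul_delta']

lemma christoffelVariation_standardMetric (h : Tensor n) (k i j : Fin n) (hy : y ∈ disc n) :
    christoffelVariation (standardMetric n) h k i j y = (ρ y)⁻¹ ^ 2 *
      (1 / 2 * christoffelFirst h k i j y -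
        (σ i y * h y k j + σ j y * h y k i - (∑ m, h y k m * σ m y) * δ i j)) := by
  simp only [christoffelVariation, standardMetric_inv_apply _ _ hy,
    christoffel_standardMetric _ _ _ hy, sum_mul_conformalChristoffel, mul_assoc, ← Finset.mul_sum,
    mul_comm (δ k _), sum_mul_delta']

lemma sum_christoffelVariation_contract (hh : IsSmoothSymm h) (k : Fin n) (hy : y ∈ disc n) :
    ∑ i, christoffelVariation (standardMetric n) h i i k y =
      (ρ y)⁻¹ ^ 2 * (1 / 2 * pd k (fun z => (h z).trace) y - σ k y * (h y).trace) := by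
  have hfirst : ∑ i, christoffelFirst h i i k y = pd k (fun z => (h z).trace) y := by
    rw [hh.pd_trace k hy]
    exact Finset.sum_congr rfl fun i _ => by rw [christoffelFirst]; ring
  simp only [christoffelVariation_standardMetric _ _ _ _ hy, ← Finset.mul_sum,
    Finset.sum_sub_distrib, Finset.sum_add_distrib, hfirst, sum_mul_delta, hh.apply_comm hy k,
    mul_comm (h y _ k), Matrix.trace, Matrix.diag_apply]
  ring

lemma sum_christoffelVariation_trace (hh : IsSmoothSymm h) (k : Fin n) (hy : y ∈ disc n) :
    ∑ i, christoffelVariation (standardMetric n) h k i i y = (ρ y)⁻¹ ^ 2 *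
      (∑ i, pd i (fun z => h z k i) y - 1 / 2 * pd k (fun z => (h z).trace) y +
        (n - 2) * ∑ m, h y k m * σ m y) := by
  simp only [christoffelVariation_standardMetric _ _ _ _ hy, ← Finset.mul_sum, christoffelFirst,
    Finset.sum_sub_distrib, Finset.sum_add_distrib, hh.pd_trace k hy, sum_delta_self,
    mul_comm (σ _ y)]
  ring

/-- The vector field whose divergence is the second-order part of the first variation of the scalar
curvature at the standard metric. -/
def scalarVariationField (h : Tensor n) (k : Fin n) (y : EuclideanSpace ℝ (Fin n)) : ℝ :=
  (ρ y)⁻¹ ^ 4 * (∑ i, pd i (fun z => h z k i) y - pd k (fun z => (h z).trace) y +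
    (n - 2) * ∑ m, h y k m * σ m y + σ k y * (h y).trace)

lemma smooth_scalarVariationField (hh : IsSmoothSymm h) (k : Fin n) :
    SmoothOnDisc (scalarVariationField h k) :=
  have hcontraction : SmoothOnDisc fun y => ∑ m, h y k m * σ m y :=
    ContDiffOn.sum fun m _ => (hh.smooth k m).mul (smooth_pdLogFactor m)
  (smooth_inv_conformalFactor.pow 4).mul
    ((((ContDiffOn.sum fun i _ => (hh.smooth k i).pd i).sub (hh.smooth_trace.pd k)).add
      (contDiffOn_const.mul hcontraction)).add ((smooth_pdLogFactor k).mul hh.smooth_trace))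

lemma palatiniField_standardMetric (hh : IsSmoothSymm h) (k : Fin n) (hy : y ∈ disc n) :
    palatiniField (standardMetric n) (christoffelVariation (standardMetric n) h) k y =
      scalarVariationField h k y := by
  simp only [palatiniField, standardMetric_inv_apply _ _ hy, mul_assoc, ← Finset.mul_sum,
    mul_comm (δ _ _), sum_mul_delta', sum_christoffelVariation_contract hh _ hy,
    sum_christoffelVariation_trace hh _ hy, scalarVariationField]
  ring

theorem linScalar_standardMetric (hh : IsSmoothSymm h) (hy : y ∈ disc n) :
    linScalar (standardMetric n) h y = ∑ k, pd k (scalarVariationField h k) y +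
      n * ∑ k, σ k y * scalarVariationField h k y - (n - 1) * (ρ y)⁻¹ ^ 2 * (h y).trace := by
  have hg := isMetric_standardMetric (n := n)
  have hpalatini : ∑ i, ∑ j, (standardMetric n y)⁻¹ i j *
      ricciVariation (standardMetric n) (christoffelVariation (standardMetric n) h) i j y =
      ∑ k, pd k (scalarVariationField h k) y + n * ∑ k, σ k y * scalarVariationField h k y := by
    rw [hg.sum_inv_mul_ricciVariation_eq_divergence (hg.smooth_christoffelVariation hh.smooth)
      (fun k i j z hz => hg.christoffelVariation_comm hh hz k i j) hy,
      divergence_standardMetric _ hy]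
    simp only [pd_congr (fun _ hz => palatiniField_standardMetric hh _ hz) _ hy,
      palatiniField_standardMetric hh _ hy]
  have hricci : ∑ i, ∑ j, invVariation (standardMetric n) h i j y * ricci (standardMetric n) i j y =
      -((n - 1) * (ρ y)⁻¹ ^ 2 * (h y).trace) := by
    have hexp (i j : Fin n) : -((ρ y)⁻¹ ^ 4 * h y i j) * ((n - 1) * ρ y ^ 2 * δ i j) =
        -((n - 1) * (ρ y)⁻¹ ^ 2 * (ρ y * (ρ y)⁻¹) ^ 2) * (h y i j * δ i j) := by ring
    simp only [invVariation_standardMetric _ _ _ hy, ricci_standardMetric _ _ hy, hexp,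
      ← Finset.mul_sum, sum_mul_delta', conformalFactor_mul_inv, Matrix.trace, Matrix.diag_apply]
    ring
  rw [hg.linScalar_eq hh.smooth hy]
  simp only [Finset.sum_add_distrib, hpalatini, hricci]
  ring

end ScalarVariation

section MeanVariation

variable {h : Tensor n} {u : EuclideanSpace ℝ (Fin n) → ℝ} {y : EuclideanSpace ℝ (Fin n)}

/-- The radial derivative `y^l ∂_l u`; on the unit sphere, the derivative along the outward unit
normal of the standard metric. -/
def radialDeriv (u : EuclideanSpace ℝ (Fin n) → ℝ) (y : EuclideanSpace ℝ (Fin n)) : ℝ :=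
  ∑ l, y l * pd l u y

/-- The contraction `h_{kl} y^l` of `h` with the radial field. -/
def radialPart (h : Tensor n) (k : Fin n) (y : EuclideanSpace ℝ (Fin n)) : ℝ :=
  ∑ l, h y k l * y l

/-- The component `h_{kl} y^k y^l` of `h` along the radial field. -/
def radialComponent (h : Tensor n) (y : EuclideanSpace ℝ (Fin n)) : ℝ :=
  ∑ k, y k * radialPart h k y

lemma IsSmoothSymm.smooth_radialPart (hh : IsSmoothSymm h) (k : Fin n) :
    SmoothOnDisc (radialPart h k) :=
  ContDiffOn.sum fun l _ => (hh.smooth k l).mul (smoothOnDisc_coord l)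

lemma IsSmoothSymm.smooth_radialComponent (hh : IsSmoothSymm h) :
    SmoothOnDisc (radialComponent h) :=
  ContDiffOn.sum fun k _ => (smoothOnDisc_coord k).mul (hh.smooth_radialPart k)

lemma conormSq_standardMetric (hy : y ∈ disc n) :
    conormSq (standardMetric n) y = ((ρ y)⁻¹ * ‖y‖) ^ 2 := by
  simp only [conormSq, standardMetric_inv_apply _ _ hy, mul_assoc, ← Finset.mul_sum,
    mul_comm (δ _ _), sum_mul_delta', sum_mul_self_eq_norm_sq, mul_pow]

lemma sqrt_conormSq_standardMetric (hy : y ∈ disc n) :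
    √(conormSq (standardMetric n) y) = (ρ y)⁻¹ * ‖y‖ := by
  have hρ : 0 ≤ (ρ y)⁻¹ := (inv_pos.mpr (conformalFactor_pos y)).le
  rw [conormSq_standardMetric hy, Real.sqrt_sq (mul_nonneg hρ (norm_nonneg y))]

lemma sum_standardMetric_inv_mul (k : Fin n) (v : Fin n → ℝ) (hy : y ∈ disc n) :
    ∑ l, (standardMetric n y)⁻¹ k l * v l = (ρ y)⁻¹ ^ 2 * v k := by
  simp only [standardMetric_inv_apply _ _ hy, mul_assoc, ← Finset.mul_sum, mul_comm (δ k _),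
    sum_mul_delta']

lemma normal_standardMetric (k : Fin n) (hy : y ∈ disc n) :
    normal (standardMetric n) k y = (ρ y)⁻¹ * (y k * ‖y‖⁻¹) := by
  change _ / √(conormSq (standardMetric n) y) = _
  rw [sqrt_conormSq_standardMetric hy, sum_standardMetric_inv_mul k _ hy]
  have hρ := (conformalFactor_pos y).ne'
  field_simp

lemma normalVariation_standardMetric (h : Tensor n) (k : Fin n) (hy : y ∈ disc n) :
    normalVariation (standardMetric n) h k y =
      1 / 2 * ((ρ y)⁻¹ ^ 3 * ‖y‖⁻¹ ^ 3 * (y k * radialComponent h y)) -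
        (ρ y)⁻¹ ^ 3 * ‖y‖⁻¹ ^ 1 * radialPart h k y := by
  have hpart : ∑ l, invVariation (standardMetric n) h k l y * y l =
      -((ρ y)⁻¹ ^ 4 * radialPart h k y) := by
    simp only [invVariation_standardMetric h _ _ hy, neg_mul, Finset.sum_neg_distrib, mul_assoc,
      ← Finset.mul_sum, radialPart]
  have hcomp : ∑ a, ∑ b, invVariation (standardMetric n) h a b y * y a * y b =
      -((ρ y)⁻¹ ^ 4 * radialComponent h y) := by
    simp only [invVariation_standardMetric h _ _ hy, neg_mul, Finset.sum_neg_distrib, mul_assoc,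
      ← Finset.mul_sum, radialComponent, radialPart, mul_left_comm (h y _ _)]
  rw [normalVariation, sqrt_conormSq_standardMetric hy, conormSq_standardMetric hy, hpart, hcomp,
    sum_standardMetric_inv_mul k _ hy]
  have hρ := (conformalFactor_pos y).ne'
  rcases eq_or_ne ‖y‖ 0 with h0 | h0
  · simp only [h0, mul_zero, div_zero, inv_zero, ne_eq, OfNat.ofNat_ne_zero, one_ne_zero,
      not_false_eq_true, zero_pow, zero_mul, sub_zero]
  · field_simp
    ring

lemma pd_inv_norm (i : Fin n) (hy : ‖y‖ = 1) : pd i (fun z => ‖z‖⁻¹) y = -y i := by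
  have hyd : y ∈ disc n := by simp [hy]
  have hφ : HasDerivAt (fun s : ℝ => (√s)⁻¹) (-(1 / 2)) (‖y‖ ^ 2) := by
    have hsqrt := (Real.hasDerivAt_sqrt (x := ‖y‖ ^ 2) (by simp [hy])).fun_inv (by simp [hy])
    exact hsqrt.congr_deriv (by simp [hy])
  have hnorm : DifferentiableWithinAt ℝ (fun z => ‖z‖ ^ 2) (disc n) y :=
    (contDiff_norm_sq ℝ (n := 1)).contDiffWithinAt.differentiableWithinAt (by simp)
  have h := pd_comp i hφ hnorm hyd
  simp only [Real.sqrt_sq (norm_nonneg _), pd_norm_sq i hyd] at h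
  linarith

lemma differentiableWithinAt_inv_norm (hy : ‖y‖ = 1) :
    DifferentiableWithinAt ℝ (fun z => ‖z‖⁻¹) (disc n) y := by
  have hy0 : y ≠ 0 := norm_ne_zero_iff.mp (by simp [hy])
  exact (((contDiffAt_norm ℝ (n := 1) hy0).differentiableAt (by simp)).fun_inv
    (by simp [hy])).differentiableWithinAt

lemma differentiableWithinAt_normalWeight (m : ℕ) (hy : ‖y‖ = 1) :
    DifferentiableWithinAt ℝ (fun z => (ρ z)⁻¹ ^ 3 * ‖z‖⁻¹ ^ m) (disc n) y :=
  have hyd : y ∈ disc n := by simp [hy]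
  ((smooth_inv_conformalFactor.differentiableWithinAt hyd).fun_pow 3).fun_mul
    ((differentiableWithinAt_inv_norm hy).fun_pow m)

lemma pd_normalWeight (m : ℕ) (i : Fin n) (hy : ‖y‖ = 1) :
    pd i (fun z => (ρ z)⁻¹ ^ 3 * ‖z‖⁻¹ ^ m) y = (3 - m) * y i := by
  have hyd : y ∈ disc n := by simp [hy]
  have hN := differentiableWithinAt_inv_norm hy
  rw [pd_mul i ((smooth_inv_conformalFactor.differentiableWithinAt hyd).fun_pow 3) (hN.fun_pow m)
    hyd, pd_inv_conformalFactor_pow 3 i hyd, pd_comp i (hasDerivAt_pow m ‖y‖⁻¹) hN hyd,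
    pd_inv_norm i hy, pdLogFactor, conformalFactor_eq_one hy, hy]
  simp only [inv_one, one_pow, Nat.cast_ofNat, one_mul, mul_one]
  ring

lemma sum_pd_normalVariation (hh : IsSmoothSymm h) (hy : ‖y‖ = 1) :
    ∑ k, pd k (normalVariation (standardMetric n) h k) y =
      1 / 2 * (n * radialComponent h y + radialDeriv (radialComponent h) y) -
        2 * radialComponent h y - ∑ k, pd k (radialPart h k) y := by
  have hyd : y ∈ disc n := by simp [hy]
  have hc (k : Fin n) := (smoothOnDisc_coord k).differentiableWithinAt hyd
  have hcomp := hh.smooth_radialComponent.differentiableWithinAt hyd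
  have hpart (k : Fin n) := (hh.smooth_radialPart k).differentiableWithinAt hyd
  have hw (m : ℕ) := differentiableWithinAt_normalWeight m hy
  have hpd (k : Fin n) : pd k (normalVariation (standardMetric n) h k) y =
      1 / 2 * (δ k k * radialComponent h y + y k * pd k (radialComponent h) y) -
        (2 * (y k * radialPart h k y) + pd k (radialPart h k) y) := by
    rw [pd_congr (fun z hz => normalVariation_standardMetric h k hz) k hyd,
      pd_sub k (((hw 3).fun_mul ((hc k).fun_mul hcomp)).const_mul _) ((hw 1).fun_mul (hpart k)) hyd,
      pd_const_mul k _ ((hw 3).fun_mul ((hc k).fun_mul hcomp)) hyd,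
      pd_mul k (hw 3) ((hc k).fun_mul hcomp) hyd, pd_mul k (hc k) hcomp hyd,
      pd_mul k (hw 1) (hpart k) hyd, pd_normalWeight 3 k hy, pd_normalWeight 1 k hy,
      pd_coord k k hyd, conformalFactor_eq_one hy, hy]
    norm_num
    ring
  simp only [hpd, Finset.sum_sub_distrib, Finset.sum_add_distrib, ← Finset.mul_sum,
    ← Finset.sum_mul, sum_delta_self, ← radialComponent.eq_1, ← radialDeriv.eq_1]
  ring

theorem linMean_standardMetric (hh : IsSmoothSymm h) (hy : ‖y‖ = 1) :
    linMean (standardMetric n) h y = radialDeriv (radialComponent h) y +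
      radialDeriv (fun z => (h z).trace) y + 2 * (h y).trace + (2 * n - 4) * radialComponent h y -
        2 * ∑ k, pd k (radialPart h k) y := by
  have hyd : y ∈ disc n := by simp [hy]
  have hy0 : y ≠ 0 := norm_ne_zero_iff.mp (by simp [hy])
  have hsq : ∑ k, y k * y k = 1 := by rw [sum_mul_self_eq_norm_sq, hy, one_pow]
  have hdrift : ∑ k, σ k y * normalVariation (standardMetric n) h k y =
      1 / 2 * radialComponent h y := by
    have hexp (k : Fin n) : σ k y * normalVariation (standardMetric n) h k y =
        y k * radialPart h k y - 1 / 2 * (y k * y k) * radialComponent h y := by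
      rw [normalVariation_standardMetric h k hyd, pdLogFactor, conformalFactor_eq_one hy, hy]
      ring
    simp only [hexp, Finset.sum_sub_distrib, ← Finset.sum_mul, ← Finset.mul_sum, hsq,
      ← radialComponent.eq_1]
    ring
  have hcontract : ∑ k, (∑ l, christoffelVariation (standardMetric n) h l l k y) *
      normal (standardMetric n) k y =
      1 / 2 * radialDeriv (fun z => (h z).trace) y + (h y).trace := by
    have hexp (k : Fin n) : (∑ l, christoffelVariation (standardMetric n) h l l k y) *
        normal (standardMetric n) k y =
        1 / 2 * (y k * pd k (fun z => (h z).trace) y) + y k * y k * (h y).trace := by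
      rw [sum_christoffelVariation_contract hh k hyd, normal_standardMetric k hyd, pdLogFactor,
        conformalFactor_eq_one hy, hy]
      ring
    simp only [hexp, Finset.sum_add_distrib, ← Finset.sum_mul, ← Finset.mul_sum, hsq,
      ← radialDeriv.eq_1]
    ring
  rw [isMetric_standardMetric.linMean_eq hh hyd hy0, divergence_standardMetric _ hyd,
    sum_pd_normalVariation hh hy, hdrift, hcontract]
  ring

lemma sum_mul_scalarVariationField (hh : IsSmoothSymm h) (hy : ‖y‖ = 1) :
    ∑ k, y k * scalarVariationField h k y = ∑ k, pd k (radialPart h k) y - 2 * (h y).trace -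
      radialDeriv (fun z => (h z).trace) y - (n - 2) * radialComponent h y := by
  have hyd : y ∈ disc n := by simp [hy]
  have hsq : ∑ k, y k * y k = 1 := by rw [sum_mul_self_eq_norm_sq, hy, one_pow]
  have hc (k : Fin n) := (smoothOnDisc_coord k).differentiableWithinAt hyd
  have hd (k l : Fin n) := (hh.smooth k l).differentiableWithinAt hyd
  have hdiv : ∑ k, pd k (radialPart h k) y =
      ∑ k, y k * ∑ i, pd i (fun z => h z k i) y + (h y).trace := by
    have hpd (k : Fin n) : pd k (radialPart h k) y =
        ∑ l, y l * pd k (fun z => h z l k) y + h y k k := by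
      change pd k (fun z => ∑ l, h z k l * z l) y = _
      rw [pd_sum k (fun l _ => (hd k l).fun_mul (hc l)) hyd]
      simp only [pd_mul k (hd k _) (hc _) hyd, pd_coord k _ hyd, Finset.sum_add_distrib,
        sum_mul_delta', pd_congr (fun _ hz => hh.apply_comm hz k _) k hyd, mul_comm (y _)]
    simp only [hpd, Finset.sum_add_distrib, Finset.mul_sum]
    rw [Finset.sum_comm]
    rfl
  have hexp (k : Fin n) : y k * scalarVariationField h k y =
      y k * ∑ i, pd i (fun z => h z k i) y - y k * pd k (fun z => (h z).trace) y -
        (n - 2) * (y k * radialPart h k y) - y k * y k * (h y).trace := by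
    simp only [scalarVariationField, pdLogFactor, conformalFactor_eq_one hy, radialPart, mul_neg,
      Finset.sum_neg_distrib, one_mul]
    ring
  simp only [hexp, hdiv, Finset.sum_sub_distrib, ← Finset.mul_sum, ← Finset.sum_mul, hsq,
    ← radialDeriv.eq_1, ← radialComponent.eq_1]
  ring

lemma sphereDiv_radialPart (hh : IsSmoothSymm h) (hy : ‖y‖ = 1) :
    sphereDiv (radialPart h) y = ∑ k, pd k (radialPart h k) y -
      radialDeriv (radialComponent h) y - (n - 2) * radialComponent h y := by
  have hyd : y ∈ disc n := by simp [hy]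
  have hc (k : Fin n) := (smoothOnDisc_coord k).differentiableWithinAt hyd
  have hd (k : Fin n) := (hh.smooth_radialPart k).differentiableWithinAt hyd
  have hderiv : radialDeriv (radialComponent h) y =
      radialComponent h y + ∑ l, ∑ k, y l * y k * pd l (radialPart h k) y := by
    have hpd (l : Fin n) : pd l (radialComponent h) y =
        radialPart h l y + ∑ k, y k * pd l (radialPart h k) y := by
      change pd l (fun z => ∑ k, z k * radialPart h k z) y = _
      rw [pd_sum l (fun k _ => (hc k).fun_mul (hd k)) hyd]
      simp only [pd_mul l (hc _) (hd _) hyd, pd_coord l _ hyd, Finset.sum_add_distrib,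
        mul_comm (δ l _), sum_mul_delta']
    simp only [radialDeriv, hpd, mul_add, Finset.sum_add_distrib, Finset.mul_sum, mul_assoc,
      radialComponent]
  rw [hderiv, sphereDiv, ← radialComponent.eq_1]
  ring

-- The left-hand side collects the boundary terms left by the divergence theorem; the right-hand
-- side integrates by parts on the sphere, so no normal derivative of `h` survives.
theorem linMean_add_sum_mul_scalarVariationField (hh : IsSmoothSymm h) (hy : ‖y‖ = 1) :
    linMean (standardMetric n) h y + ∑ k, y k * scalarVariationField h k y =
      -sphereDiv (radialPart h) y := by
  rw [linMean_standardMetric hh hy, sum_mul_scalarVariationField hh hy, sphereDiv_radialPart hh hy]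
  ring

end MeanVariation

section AdjointTensor

variable {F : EuclideanSpace ℝ (Fin n) → ℝ} {h : Tensor n} {y : EuclideanSpace ℝ (Fin n)}

/-- The Hessian `∇_i ∇_j F = ∂_i ∂_j F - Γ^l_{ij} ∂_l F`. -/
def hessian (g : Tensor n) (F : EuclideanSpace ℝ (Fin n) → ℝ) : Tensor n := fun y =>
  Matrix.of fun i j => pd j (pd i F) y - ∑ l, christoffel g l i j y * pd l F y

/-- The Laplacian `Δ F = g^{ij} ∇_i ∇_j F`. -/
def laplacian (g : Tensor n) (F : EuclideanSpace ℝ (Fin n) → ℝ) (y : EuclideanSpace ℝ (Fin n)) :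
    ℝ :=
  ∑ i, ∑ j, (g y)⁻¹ i j * hessian g F y i j

/-- The interior part `∇²F - (Δ F) g - F Ric` of the formal adjoint `S_g^*(F)`. -/
def adjointTensor (g : Tensor n) (F : EuclideanSpace ℝ (Fin n) → ℝ) : Tensor n := fun y =>
  hessian g F y - laplacian g F y • g y - F y • Matrix.of fun i j => ricci g i j y

lemma hessian_standardMetric (F : EuclideanSpace ℝ (Fin n) → ℝ) (i j : Fin n) (hy : y ∈ disc n) :
    hessian (standardMetric n) F y i j = pd j (pd i F) y -
      (σ i y * pd j F y + σ j y * pd i F y - (∑ l, σ l y * pd l F y) * δ i j) := by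
  simp only [hessian, Matrix.of_apply, christoffel_standardMetric _ _ _ hy, mul_comm (Γ _ _ _ _),
    sum_mul_conformalChristoffel, mul_comm (σ _ y) (pd _ F y)]

lemma laplacian_standardMetric (F : EuclideanSpace ℝ (Fin n) → ℝ) (hy : y ∈ disc n) :
    laplacian (standardMetric n) F y =
      (ρ y)⁻¹ ^ 2 * ∑ i, hessian (standardMetric n) F y i i := by
  simp only [laplacian, standardMetric_inv_apply _ _ hy, mul_assoc, ← Finset.mul_sum,
    mul_comm (δ _ _), sum_mul_delta']

lemma adjointTensor_standardMetric_apply (F : EuclideanSpace ℝ (Fin n) → ℝ) (i j : Fin n)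
    (hy : y ∈ disc n) :
    adjointTensor (standardMetric n) F y i j = hessian (standardMetric n) F y i j -
      (∑ l, hessian (standardMetric n) F y l l + (n - 1) * ρ y ^ 2 * F y) * δ i j := by
  simp only [adjointTensor, Matrix.sub_apply, Matrix.smul_apply, smul_eq_mul, Matrix.of_apply,
    ricci_standardMetric _ _ hy, standardMetric_eq_smul hy, laplacian_standardMetric F hy]
  linear_combination -(∑ l, hessian (standardMetric n) F y l l) * δ i j *
    (ρ y * (ρ y)⁻¹ + 1) * conformalFactor_mul_inv y

lemma smooth_hessian_standardMetric (hF : SmoothOnDisc F) (i j : Fin n) :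
    SmoothOnDisc fun y => hessian (standardMetric n) F y i j := by
  refine ((hF.pd i).pd j).sub (ContDiffOn.sum fun l _ => ?_)
  exact (isMetric_standardMetric.smooth_christoffel l i j).mul (hF.pd l)

lemma isSmoothSymm_adjointTensor (hF : SmoothOnDisc F) :
    IsSmoothSymm (adjointTensor (standardMetric n) F) := by
  refine ⟨fun i j => ?_, fun y hy => Matrix.IsSymm.ext fun i j => ?_⟩
  · refine ContDiffOn.congr ?_ fun y hy => adjointTensor_standardMetric_apply F i j hy
    exact (smooth_hessian_standardMetric hF i j).sub (((ContDiffOn.sum fun l _ =>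
      smooth_hessian_standardMetric hF l l).add
        ((contDiffOn_const.mul (smooth_conformalFactor.pow 2)).mul hF)).mul contDiffOn_const)
  · simp only [adjointTensor_standardMetric_apply F _ _ hy, hessian_standardMetric F _ _ hy,
      pd_comm i j hF hy, delta_comm i j]
    ring

lemma innerM_standardMetric (h A : Tensor n) (hy : y ∈ disc n) :
    innerM (standardMetric n) h A y = (ρ y)⁻¹ ^ 4 * ∑ i, ∑ j, h y i j * A y i j := by
  have hexp (i j k l : Fin n) :
      (ρ y)⁻¹ ^ 2 * δ i k * ((ρ y)⁻¹ ^ 2 * δ j l) * h y i j * A y k l =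
        (ρ y)⁻¹ ^ 4 * (h y i j * (A y k l * δ j l * δ i k)) := by ring
  simp only [innerM, standardMetric_inv_apply _ _ hy, hexp, ← Finset.mul_sum, ← Finset.sum_mul,
    sum_mul_delta']

end AdjointTensor

section InteriorPairing

variable {F : EuclideanSpace ℝ (Fin n) → ℝ} {h : Tensor n} {y : EuclideanSpace ℝ (Fin n)}

/-- The vector field `tr_g h ∇F - h(∇F, ·)`, the flux left over when the remaining derivatives of
`h` in the linearized scalar curvature are moved onto `F`. -/
def gradientField (h : Tensor n) (F : EuclideanSpace ℝ (Fin n) → ℝ) (k : Fin n)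
    (y : EuclideanSpace ℝ (Fin n)) : ℝ :=
  (ρ y)⁻¹ ^ 4 * ((h y).trace * pd k F y - ∑ i, h y k i * pd i F y)

lemma smooth_gradientField (hh : IsSmoothSymm h) (hF : SmoothOnDisc F) (k : Fin n) :
    SmoothOnDisc (gradientField h F k) :=
  (smooth_inv_conformalFactor.pow 4).mul ((hh.smooth_trace.mul (hF.pd k)).sub
    (ContDiffOn.sum fun i _ => (hh.smooth k i).mul (hF.pd i)))

lemma sum_sum_mul_adjointTensor (F : EuclideanSpace ℝ (Fin n) → ℝ) (hh : IsSmoothSymm h)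
    (hy : y ∈ disc n) :
    ∑ i, ∑ j, h y i j * adjointTensor (standardMetric n) F y i j =
      ∑ i, ∑ j, h y i j * pd j (pd i F) y - 2 * ∑ i, ∑ j, h y i j * σ j y * pd i F y -
        (∑ i, pd i (pd i F) y + (n - 3) * ∑ l, σ l y * pd l F y + (n - 1) * ρ y ^ 2 * F y) *
          (h y).trace := by
  have hlap : ∑ i, hessian (standardMetric n) F y i i =
      ∑ i, pd i (pd i F) y + (n - 2) * ∑ l, σ l y * pd l F y := by
    simp only [hessian_standardMetric F _ _ hy, Finset.sum_sub_distrib, Finset.sum_add_distrib,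
      ← Finset.mul_sum, sum_delta_self]
    ring
  have hexp (i j : Fin n) : h y i j * adjointTensor (standardMetric n) F y i j =
      h y i j * pd j (pd i F) y - h y i j * σ j y * pd i F y - h y j i * σ i y * pd j F y -
        (∑ i, pd i (pd i F) y + (n - 3) * ∑ l, σ l y * pd l F y + (n - 1) * ρ y ^ 2 * F y) *
          (h y i j * δ i j) := by
    rw [adjointTensor_standardMetric_apply F i j hy, hessian_standardMetric F i j hy, hlap,
      hh.apply_comm hy j i]
    ring
  simp only [hexp, Finset.sum_sub_distrib, ← Finset.mul_sum, sum_mul_delta', Matrix.trace,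
    Matrix.diag_apply]
  rw [Finset.sum_comm (f := fun i j => h y j i * σ i y * pd j F y)]
  ring

lemma divergence_gradientField (hh : IsSmoothSymm h) (hF : SmoothOnDisc F) (hy : y ∈ disc n) :
    divergence (standardMetric n) (gradientField h F) y = (ρ y)⁻¹ ^ 4 *
      (∑ k, pd k (fun z => (h z).trace) y * pd k F y + (h y).trace * ∑ k, pd k (pd k F) y -
        ∑ k, ∑ i, (pd k (fun z => h z k i) y * pd i F y + h y k i * pd k (pd i F) y) +
        (n - 4) * ((h y).trace * ∑ k, σ k y * pd k F y -
          ∑ k, ∑ i, σ k y * (h y k i * pd i F y))) := by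
  have ht := hh.smooth_trace.differentiableWithinAt hy
  have hd (k i : Fin n) := (hh.smooth k i).differentiableWithinAt hy
  have hp (k : Fin n) := (hF.pd k).differentiableWithinAt hy
  have hs (k : Fin n) := DifferentiableWithinAt.fun_sum (u := Finset.univ)
    fun i _ => (hd k i).fun_mul (hp i)
  have hpd (k : Fin n) : pd k (gradientField h F k) y = (ρ y)⁻¹ ^ 4 *
      (pd k (fun z => (h z).trace) y * pd k F y + (h y).trace * pd k (pd k F) y -
        ∑ i, (pd k (fun z => h z k i) y * pd i F y + h y k i * pd k (pd i F) y) -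
        4 * (σ k y * ((h y).trace * pd k F y - ∑ i, h y k i * pd i F y))) := by
    change pd k (fun z => (ρ z)⁻¹ ^ 4 * ((h z).trace * pd k F z - ∑ i, h z k i * pd i F z)) y = _
    rw [pd_mul k ((smooth_inv_conformalFactor.differentiableWithinAt hy).fun_pow 4)
      ((ht.fun_mul (hp k)).fun_sub (hs k)) hy, pd_inv_conformalFactor_pow 4 k hy,
      pd_sub k (ht.fun_mul (hp k)) (hs k) hy, pd_mul k ht (hp k) hy,
      pd_sum k (fun i _ => (hd k i).fun_mul (hp i)) hy]
    simp only [pd_mul k (hd k _) (hp _) hy, Nat.cast_ofNat]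
    ring
  have hdrift (k : Fin n) : σ k y * gradientField h F k y = (ρ y)⁻¹ ^ 4 *
      ((h y).trace * (σ k y * pd k F y) - ∑ i, σ k y * (h y k i * pd i F y)) := by
    rw [gradientField, ← Finset.mul_sum]
    ring
  simp only [divergence_standardMetric _ hy, hpd, hdrift, ← Finset.mul_sum, Finset.sum_sub_distrib,
    mul_sub, mul_left_comm (σ _ y) (h y).trace]
  simp only [Finset.sum_add_distrib, ← Finset.mul_sum]
  ring

lemma sum_pd_mul_scalarVariationField (F : EuclideanSpace ℝ (Fin n) → ℝ) (hh : IsSmoothSymm h)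
    (hy : y ∈ disc n) :
    ∑ k, pd k F y * scalarVariationField h k y = (ρ y)⁻¹ ^ 4 *
      (∑ k, ∑ i, pd k (fun z => h z k i) y * pd i F y -
        ∑ k, pd k (fun z => (h z).trace) y * pd k F y +
        (n - 2) * ∑ k, ∑ i, h y k i * σ i y * pd k F y +
        (h y).trace * ∑ k, σ k y * pd k F y) := by
  have hexp (k : Fin n) : pd k F y * scalarVariationField h k y = (ρ y)⁻¹ ^ 4 *
      (∑ i, pd i (fun z => h z i k) y * pd k F y - pd k (fun z => (h z).trace) y * pd k F y +
        (n - 2) * ∑ i, h y k i * σ i y * pd k F y + (h y).trace * (σ k y * pd k F y)) := by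
    simp only [scalarVariationField, ← Finset.sum_mul,
      pd_congr (fun _ hz => hh.apply_comm hz k _) _ hy]
    ring
  simp only [hexp, ← Finset.mul_sum, Finset.sum_add_distrib, Finset.sum_sub_distrib]
  rw [Finset.sum_comm]

theorem linScalar_mul_eq_divergence_add_innerM (hh : IsSmoothSymm h) (hF : SmoothOnDisc F)
    (hy : y ∈ disc n) :
    linScalar (standardMetric n) h y * F y = divergence (standardMetric n)
      (fun k z => F z * scalarVariationField h k z + gradientField h F k z) y +
      innerM (standardMetric n) h (adjointTensor (standardMetric n) F) y := by
  have hV (k : Fin n) := (smooth_scalarVariationField hh k).differentiableWithinAt hy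
  have hFd := hF.differentiableWithinAt hy
  have hsplit : divergence (standardMetric n)
      (fun k z => F z * scalarVariationField h k z + gradientField h F k z) y =
      F y * divergence (standardMetric n) (scalarVariationField h) y +
        ∑ k, pd k F y * scalarVariationField h k y +
        divergence (standardMetric n) (gradientField h F) y := by
    simp only [divergence_standardMetric _ hy, pd_add _ (hFd.fun_mul (hV _))
      ((smooth_gradientField hh hF _).differentiableWithinAt hy) hy, pd_mul _ hFd (hV _) hy,
      mul_add, Finset.sum_add_distrib, mul_left_comm (σ _ y) (F y), ← Finset.mul_sum]
    ring
  have hgrad := sum_pd_mul_scalarVariationField F hh hy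
  have hsymm : ∑ k, ∑ i, σ k y * (h y k i * pd i F y) =
      ∑ k, ∑ i, h y k i * σ i y * pd k F y := by
    rw [Finset.sum_comm]
    exact Finset.sum_congr rfl fun i _ => Finset.sum_congr rfl fun k _ => by
      rw [hh.apply_comm hy k i]; ring
  have hhess : ∑ k, ∑ i, h y k i * pd k (pd i F) y = ∑ k, ∑ i, h y k i * pd i (pd k F) y := by
    simp only [pd_comm _ _ hF hy]
  rw [hsplit, hgrad, divergence_gradientField hh hF hy, innerM_standardMetric _ _ hy,
    sum_sum_mul_adjointTensor F hh hy, linScalar_standardMetric hh hy,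
    divergence_standardMetric _ hy]
  simp only [Finset.sum_add_distrib, hsymm, hhess]
  linear_combination (n - 1) * (ρ y)⁻¹ ^ 2 * (h y).trace * F y *
    (ρ y * (ρ y)⁻¹ + 1) * conformalFactor_mul_inv y

end InteriorPairing

section BoundaryPairing

variable {F φ : EuclideanSpace ℝ (Fin n) → ℝ} {h : Tensor n} {y : EuclideanSpace ℝ (Fin n)}

lemma integralM_standardMetric (u : EuclideanSpace ℝ (Fin n) → ℝ) :
    integralM (standardMetric n) u = ∫ y in disc n, u y * ρ y ^ n :=
  setIntegral_congr_fun measurableSet_closedBall fun _ hy => by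
    simp only [sqrt_det_standardMetric hy]

lemma integralM_standardMetric_add {u v : EuclideanSpace ℝ (Fin n) → ℝ} (hu : SmoothOnDisc u)
    (hv : SmoothOnDisc v) : integralM (standardMetric n) (fun y => u y + v y) =
      integralM (standardMetric n) u + integralM (standardMetric n) v := by
  simp only [integralM_standardMetric, add_mul]
  exact integral_add (SmoothOnDisc.integrableOn (hu.mul (smooth_conformalFactor.pow n)))
    (SmoothOnDisc.integrableOn (hv.mul (smooth_conformalFactor.pow n)))

lemma smooth_divergence_standardMetric {U : Fin n → EuclideanSpace ℝ (Fin n) → ℝ}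
    (hU : ∀ k, SmoothOnDisc (U k)) : SmoothOnDisc (divergence (standardMetric n) U) := by
  refine ContDiffOn.congr ?_ fun y hy => divergence_standardMetric U hy
  exact (ContDiffOn.sum fun k _ => (hU k).pd k).add
    (contDiffOn_const.mul (ContDiffOn.sum fun k _ => (smooth_pdLogFactor k).mul (hU k)))

lemma smooth_innerM_standardMetric {A : Tensor n} (hh : IsSmoothSymm h) (hA : IsSmoothSymm A) :
    SmoothOnDisc (innerM (standardMetric n) h A) := by
  refine ContDiffOn.congr ?_ fun y hy => innerM_standardMetric h A hy
  exact (smooth_inv_conformalFactor.pow 4).mul (ContDiffOn.sum fun i _ => ContDiffOn.sum fun j _ =>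
    (hh.smooth i j).mul (hA.smooth i j))

lemma smooth_radialDeriv (hF : SmoothOnDisc F) : SmoothOnDisc (radialDeriv F) :=
  ContDiffOn.sum fun l _ => (smoothOnDisc_coord l).mul (hF.pd l)

theorem integralM_divergence {U : Fin n → EuclideanSpace ℝ (Fin n) → ℝ}
    (hU : ∀ k, SmoothOnDisc (U k)) :
    integralM (standardMetric n) (divergence (standardMetric n) U) =
      ∫ y : sphere (0 : EuclideanSpace ℝ (Fin n)) 1, ∑ k, (y : EuclideanSpace ℝ (Fin n)) k * U k y
        ∂(volume : Measure (EuclideanSpace ℝ (Fin n))).toSphere := by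
  have hweight (y : EuclideanSpace ℝ (Fin n)) (hy : y ∈ disc n) :
      divergence (standardMetric n) U y * ρ y ^ n =
        ∑ k, pd k (fun z => ρ z ^ n * U k z) y := by
    simp only [pd_mul _ ((smooth_conformalFactor.differentiableWithinAt hy).fun_pow n)
      ((hU _).differentiableWithinAt hy) hy, pd_conformalFactor_pow n _ hy,
      divergence_standardMetric U hy, Finset.sum_add_distrib,
      ← Finset.mul_sum, mul_assoc]
    ring
  rw [integralM_standardMetric, setIntegral_congr_fun measurableSet_closedBall hweight,
    integral_div fun k => (smooth_conformalFactor.pow n).mul (hU k)]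
  simp only [conformalFactor_eq_one (norm_eq_of_mem_sphere _), one_pow, one_mul, mul_comm (U _ _)]

lemma normal_standardMetric_of_norm_eq_one (k : Fin n) (hy : ‖y‖ = 1) :
    normal (standardMetric n) k y = y k := by
  rw [normal_standardMetric k (by simp [hy]), conformalFactor_eq_one hy, hy, inv_one,
    mul_one, one_mul]

lemma integralBoundary_standardMetric (u : EuclideanSpace ℝ (Fin n) → ℝ) :
    integralBoundary (standardMetric n) u =
      ∫ y : sphere (0 : EuclideanSpace ℝ (Fin n)) 1, u y
        ∂(volume : Measure (EuclideanSpace ℝ (Fin n))).toSphere := by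
  refine integral_congr_ae (.of_forall fun y => ?_)
  have hy : ‖(y : EuclideanSpace ℝ (Fin n))‖ = 1 := norm_eq_of_mem_sphere y
  simp only [sqrt_det_standardMetric (sphere_subset_closedBall y.2), conformalFactor_eq_one hy,
    normal_standardMetric_of_norm_eq_one _ hy, sum_mul_self_eq_norm_sq, hy, one_pow, mul_one]

lemma innerBoundary_smul_standardMetric (φ : EuclideanSpace ℝ (Fin n) → ℝ) (h : Tensor n)
    (hy : ‖y‖ = 1) :
    innerBoundary (standardMetric n) h (fun z => φ z • standardMetric n z) y =
      φ y * ((h y).trace - radialComponent h y) := by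
  have hyd : y ∈ disc n := by simp [hy]
  have hsq : ∑ k, y k * y k = 1 := by rw [sum_mul_self_eq_norm_sq, hy, one_pow]
  have hproj (i j : Fin n) : boundaryInv (standardMetric n) i j y = δ i j - y i * y j := by
    rw [boundaryInv, standardMetric_inv_apply i j hyd, normal_standardMetric_of_norm_eq_one i hy,
      normal_standardMetric_of_norm_eq_one j hy, conformalFactor_eq_one hy, inv_one, one_pow,
      one_mul]
  have hidem (i j : Fin n) :
      ∑ k, (δ i k - y i * y k) * (δ j k - y j * y k) = δ i j - y i * y j := by
    have hexp (k : Fin n) : (δ i k - y i * y k) * (δ j k - y j * y k) =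
        δ j k * δ i k - y j * (y k * δ i k) - y i * (y k * δ j k) + y i * y j * (y k * y k) := by
      ring
    simp only [hexp, Finset.sum_add_distrib, Finset.sum_sub_distrib, ← Finset.mul_sum, hsq,
      sum_mul_delta', delta_comm j i]
    ring
  have hcontract (i j : Fin n) : ∑ k, ∑ l, boundaryInv (standardMetric n) i k y *
      boundaryInv (standardMetric n) j l y * h y i j * (φ y • standardMetric n y) k l =
      φ y * (h y i j * δ i j - y i * (h y i j * y j)) := by
    have hexp (k l : Fin n) : boundaryInv (standardMetric n) i k y *
        boundaryInv (standardMetric n) j l y * h y i j * (φ y • standardMetric n y) k l =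
        φ y * h y i j * ((δ i k - y i * y k) * (δ j l - y j * y l) * δ k l) := by
      rw [Matrix.smul_apply, standardMetric_apply k l hyd, conformalFactor_eq_one hy, hproj, hproj,
        smul_eq_mul]
      ring
    simp only [hexp, ← Finset.mul_sum, sum_mul_delta', hidem]
    ring
  simp only [innerBoundary, hcontract, ← Finset.mul_sum, Finset.sum_sub_distrib, sum_mul_delta',
    radialComponent, radialPart, Matrix.trace, Matrix.diag_apply]

lemma linMean_mul_add_sum_mul (hh : IsSmoothSymm h) (hF : SmoothOnDisc F) (hy : ‖y‖ = 1) :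
    linMean (standardMetric n) h y * F y +
      ∑ k, y k * (F y * scalarVariationField h k y + gradientField h F k y) =
      innerBoundary (standardMetric n) h (fun z => radialDeriv F z • standardMetric n z) y -
        sphereDiv (fun k z => F z * radialPart h k z) y := by
  have hyd : y ∈ disc n := by simp [hy]
  have hgrad : ∑ k, y k * gradientField h F k y =
      (h y).trace * radialDeriv F y - ∑ k, pd k F y * radialPart h k y := by
    have hexp (k : Fin n) : y k * gradientField h F k y =
        (h y).trace * (y k * pd k F y) - ∑ i, pd i F y * (h y i k * y k) := by
      rw [gradientField, conformalFactor_eq_one hy, inv_one, one_pow, one_mul, mul_sub,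
        Finset.mul_sum, mul_left_comm]
      exact congrArg _ (Finset.sum_congr rfl fun i _ => by rw [hh.apply_comm hyd k i]; ring)
    simp only [hexp, Finset.sum_sub_distrib, ← Finset.mul_sum, radialDeriv, radialPart]
    rw [Finset.sum_comm]
    simp only [← Finset.mul_sum]
  rw [innerBoundary_smul_standardMetric _ h hy, sphereDiv_mul (hF.differentiableWithinAt hyd)
    (fun k => (hh.smooth_radialPart k).differentiableWithinAt hyd) hyd]
  simp only [mul_add, Finset.sum_add_distrib, mul_left_comm (y _) (F y), ← Finset.mul_sum, hgrad,
    ← radialComponent.eq_1, ← radialDeriv.eq_1]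
  linear_combination F y * linMean_add_sum_mul_scalarVariationField hh hy

lemma smooth_sphereDiv {U : Fin n → EuclideanSpace ℝ (Fin n) → ℝ}
    (hU : ∀ k, SmoothOnDisc (U k)) : SmoothOnDisc (sphereDiv U) :=
  ((ContDiffOn.sum fun k _ => (hU k).pd k).sub (ContDiffOn.sum fun l _ => ContDiffOn.sum fun k _ =>
    ((smoothOnDisc_coord l).mul (smoothOnDisc_coord k)).mul ((hU k).pd l))).sub
      (contDiffOn_const.mul (ContDiffOn.sum fun k _ => (smoothOnDisc_coord k).mul (hU k)))

lemma integrable_innerBoundary (hh : IsSmoothSymm h) (hφ : SmoothOnDisc φ) :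
    Integrable (fun y : sphere (0 : EuclideanSpace ℝ (Fin n)) 1 =>
        innerBoundary (standardMetric n) h (fun z => φ z • standardMetric n z) y)
      (volume : Measure (EuclideanSpace ℝ (Fin n))).toSphere := by
  simp only [innerBoundary_smul_standardMetric φ h (norm_eq_of_mem_sphere _)]
  exact SmoothOnDisc.integrable_sphere (hφ.mul (hh.smooth_trace.sub hh.smooth_radialComponent))

lemma isSmoothSymm_smul_standardMetric (hφ : SmoothOnDisc φ) :
    IsSmoothSymm fun y => φ y • standardMetric n y :=
  ⟨fun i j => hφ.mul (isMetric_standardMetric.smooth i j), fun y hy => by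
    simp only [standardMetric_eq_smul hy]
    exact (Matrix.isSymm_one.smul _).smul _⟩

theorem integral_linScalar_add_integral_linMean (hh : IsSmoothSymm h) (hF : SmoothOnDisc F) :
    integralM (standardMetric n) (fun y => linScalar (standardMetric n) h y * F y) +
        integralBoundary (standardMetric n) (fun y => linMean (standardMetric n) h y * F y) =
      integralM (standardMetric n)
          (innerM (standardMetric n) h (adjointTensor (standardMetric n) F)) +
        integralBoundary (standardMetric n) (innerBoundary (standardMetric n) h
          fun y => radialDeriv F y • standardMetric n y) := by
  set U : Fin n → EuclideanSpace ℝ (Fin n) → ℝ :=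
    fun k z => F z * scalarVariationField h k z + gradientField h F k z
  have hU (k : Fin n) : SmoothOnDisc (U k) :=
    (hF.mul (smooth_scalarVariationField hh k)).add (smooth_gradientField hh hF k)
  have hFp (k : Fin n) : SmoothOnDisc fun z => F z * radialPart h k z :=
    hF.mul (hh.smooth_radialPart k)
  have hinterior : integralM (standardMetric n) (fun y => linScalar (standardMetric n) h y * F y) =
      integralM (standardMetric n) (divergence (standardMetric n) U) + integralM (standardMetric n)
        (innerM (standardMetric n) h (adjointTensor (standardMetric n) F)) := by
    rw [← integralM_standardMetric_add (smooth_divergence_standardMetric hU)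
      (smooth_innerM_standardMetric hh (isSmoothSymm_adjointTensor hF))]
    exact setIntegral_congr_fun measurableSet_closedBall fun y hy => by
      simp only [linScalar_mul_eq_divergence_add_innerM hh hF hy, U]
  have hboundary (y : sphere (0 : EuclideanSpace ℝ (Fin n)) 1) :
      linMean (standardMetric n) h y * F y =
        innerBoundary (standardMetric n) h (fun z => radialDeriv F z • standardMetric n z) y -
          sphereDiv (fun k z => F z * radialPart h k z) y -
          ∑ k, (y : EuclideanSpace ℝ (Fin n)) k * U k y :=
    eq_sub_of_add_eq (linMean_mul_add_sum_mul hh hF (norm_eq_of_mem_sphere y))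
  have hinner := integrable_innerBoundary hh (smooth_radialDeriv hF)
  have hdiv := (smooth_sphereDiv hFp).integrable_sphere
  have hflux : SmoothOnDisc fun y => ∑ k, y k * U k y :=
    ContDiffOn.sum fun k _ => (smoothOnDisc_coord k).mul (hU k)
  rw [hinterior, integralM_divergence hU]
  simp only [integralBoundary_standardMetric, hboundary]
  rw [integral_sub (hinner.sub' hdiv) hflux.integrable_sphere, integral_sub hinner hdiv,
    integral_sphereDiv hFp]
  ring

theorem adjointEq_standardMetric {f : upper n → ℝ} (hf : IsSmooth f) :
    AdjointEq (standardMetric n) f f (adjointTensor (standardMetric n) (inChart f))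
      fun y => radialDeriv (inChart f) y • standardMetric n y :=
  ⟨isSmoothSymm_adjointTensor hf, isSmoothSymm_smul_standardMetric (smooth_radialDeriv hf),
    fun _ hh => integral_linScalar_add_integral_linMean hh hf⟩

end BoundaryPairing

section Uniqueness

variable {u φ : EuclideanSpace ℝ (Fin n) → ℝ} {A : Tensor n} {y : EuclideanSpace ℝ (Fin n)}

lemma eqOn_ball_zero_of_integral_eq_zero (hu : ContinuousOn u (disc n))
    (hnonneg : ∀ y ∈ disc n, 0 ≤ u y) (h0 : ∫ y in disc n, u y = 0) :
    Set.EqOn u 0 (ball 0 1) := by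
  have hae : u =ᵐ[volume.restrict (disc n)] 0 :=
    (setIntegral_eq_zero_iff_of_nonneg_ae ((ae_restrict_mem measurableSet_closedBall).mono hnonneg)
      (hu.integrableOn_compact (isCompact_closedBall _ _))).mp h0
  exact Measure.eqOn_open_of_ae_eq
    (ae_restrict_of_ae_restrict_of_subset ball_subset_closedBall hae) isOpen_ball
    (hu.mono ball_subset_closedBall) continuousOn_const

lemma eq_zero_of_integral_sphere_sq_eq_zero (hφ : SmoothOnDisc φ)
    (h0 : ∫ y : sphere (0 : EuclideanSpace ℝ (Fin n)) 1, φ y ^ 2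
      ∂(volume : Measure (EuclideanSpace ℝ (Fin n))).toSphere = 0) (hy : ‖y‖ = 1) : φ y = 0 := by
  have hsq : SmoothOnDisc fun y => φ y ^ 2 := hφ.pow 2
  have hae := (integral_eq_zero_iff_of_nonneg (fun _ => sq_nonneg _) hsq.integrable_sphere).mp h0
  have heq := (hsq.continuous_sphere.ae_eq_iff_eq _ continuous_const).mp hae
  exact pow_eq_zero_iff two_ne_zero |>.mp (congrFun heq ⟨y, by simp [hy]⟩)

lemma bdf_nonneg (hy : y ∈ disc n) : 0 ≤ bdf y :=
  sub_nonneg.mpr (pow_le_one₀ (norm_nonneg y) (by simpa using hy))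

lemma bdf_pos (hy : y ∈ ball 0 1) : 0 < bdf y :=
  sub_pos.mpr (pow_lt_one₀ (norm_nonneg y) (by simpa using hy) two_ne_zero)

lemma eq_zero_of_integralM_innerM_bdf_smul (hA : IsSmoothSymm A)
    (h0 : integralM (standardMetric n)
      (innerM (standardMetric n) (fun y => bdf y • A y) A) = 0) (hy : y ∈ disc n) : A y = 0 := by
  have hu : SmoothOnDisc fun y => bdf y * ((ρ y)⁻¹ ^ 4 * ρ y ^ n * ∑ i, ∑ j, A y i j ^ 2) :=
    smoothOnDisc_bdf.mul
      (((smooth_inv_conformalFactor.pow 4).mul (smooth_conformalFactor.pow n)).mul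
        (ContDiffOn.sum fun i _ => ContDiffOn.sum fun j _ => (hA.smooth i j).pow 2))
  have hweight (z : EuclideanSpace ℝ (Fin n)) : 0 < (ρ z)⁻¹ ^ 4 * ρ z ^ n :=
    mul_pos (pow_pos (inv_pos.mpr (conformalFactor_pos z)) 4) (pow_pos (conformalFactor_pos z) n)
  have hsum (z : EuclideanSpace ℝ (Fin n)) : 0 ≤ ∑ i, ∑ j, A z i j ^ 2 :=
    Finset.sum_nonneg fun i _ => Finset.sum_nonneg fun j _ => sq_nonneg _
  have hball := eqOn_ball_zero_of_integral_eq_zero hu.continuousOn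
    (fun z hz => mul_nonneg (bdf_nonneg hz) (mul_nonneg (hweight z).le (hsum z))) (by
      rw [← h0, integralM_standardMetric]
      refine setIntegral_congr_fun measurableSet_closedBall fun z hz => ?_
      simp only [innerM_standardMetric _ _ hz, Matrix.smul_apply, smul_eq_mul, mul_assoc,
        ← Finset.mul_sum, pow_two (A z _ _)]
      ring)
  have hA0 (i j : Fin n) : Set.EqOn (fun z => A z i j) 0 (ball 0 1) := fun z hz => by
    have hsq := (mul_eq_zero.mp ((mul_eq_zero.mp (hball hz)).resolve_left
      (bdf_pos hz).ne')).resolve_left (hweight z).ne'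
    have hrow := (Finset.sum_eq_zero_iff_of_nonneg fun i _ => Finset.sum_nonneg fun j _ =>
      sq_nonneg (A z i j)).mp hsq i (Finset.mem_univ i)
    have hentry := (Finset.sum_eq_zero_iff_of_nonneg fun j _ =>
      sq_nonneg (A z i j)).mp hrow j (Finset.mem_univ j)
    exact pow_eq_zero_iff two_ne_zero |>.mp hentry
  ext i j
  exact (hA0 i j).of_subset_closure (hA.smooth i j).continuousOn continuousOn_const
    ball_subset_closedBall (closure_ball (0 : EuclideanSpace ℝ (Fin n)) one_ne_zero).ge hy

lemma innerBoundary_smul_standardMetric_self (φ : EuclideanSpace ℝ (Fin n) → ℝ) (hy : ‖y‖ = 1) :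
    innerBoundary (standardMetric n) (fun z => φ z • standardMetric n z)
      (fun z => φ z • standardMetric n z) y = (n - 1) * φ y ^ 2 := by
  have hyd : y ∈ disc n := by simp [hy]
  have htrace : (φ y • standardMetric n y).trace = n * φ y := by
    simp only [Matrix.trace, Matrix.diag_apply, Matrix.smul_apply, standardMetric_apply _ _ hyd,
      conformalFactor_eq_one hy, smul_eq_mul, ← Finset.mul_sum, sum_delta_self]
    ring
  have hradial : radialComponent (fun z => φ z • standardMetric n z) y = φ y := by
    have hpart (k : Fin n) : radialPart (fun z => φ z • standardMetric n z) k y = φ y * y k := by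
      have hexp (l : Fin n) : (φ y • standardMetric n y) k l * y l = φ y * (y l * δ k l) := by
        rw [Matrix.smul_apply, standardMetric_apply k l hyd, conformalFactor_eq_one hy, smul_eq_mul]
        ring
      simp only [radialPart, hexp, ← Finset.mul_sum, sum_mul_delta']
    simp only [radialComponent, hpart, mul_left_comm (y _), ← Finset.mul_sum,
      sum_mul_self_eq_norm_sq, hy, one_pow, mul_one]
  rw [innerBoundary_smul_standardMetric φ _ hy, htrace, hradial]
  ring

theorem eq_zero_of_forall_integralM_add_integralBoundary_eq_zero (hn : 2 ≤ n) (hA : IsSmoothSymm A)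
    (hφ : SmoothOnDisc φ) (h0 : ∀ h : Tensor n, IsSmoothSymm h →
      integralM (standardMetric n) (innerM (standardMetric n) h A) +
        integralBoundary (standardMetric n) (innerBoundary (standardMetric n) h
          fun y => φ y • standardMetric n y) = 0) :
    (∀ y ∈ disc n, A y = 0) ∧ ∀ y, ‖y‖ = 1 → φ y = 0 := by
  have hA0 (y : EuclideanSpace ℝ (Fin n)) (hy : y ∈ disc n) : A y = 0 := by
    refine eq_zero_of_integralM_innerM_bdf_smul hA ?_ hy
    have htest := h0 (fun y => bdf y • A y) ⟨fun i j => smoothOnDisc_bdf.mul (hA.smooth i j),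
      fun y hy => (hA.2 y hy).smul _⟩
    simpa only [integralBoundary, innerBoundary, bdf_eq_zero (Subtype.prop _), zero_smul,
      Matrix.zero_apply, mul_zero, zero_mul, Finset.sum_const_zero, integral_zero, add_zero]
      using htest
  refine ⟨hA0, fun y hy => eq_zero_of_integral_sphere_sq_eq_zero hφ ?_ hy⟩
  have htest := h0 _ (isSmoothSymm_smul_standardMetric hφ)
  have hinterior : integralM (standardMetric n)
      (innerM (standardMetric n) (fun y => φ y • standardMetric n y) A) = 0 :=
    setIntegral_eq_zero_of_forall_eq_zero fun y hy => by
      simp only [innerM, hA0 y hy, Matrix.zero_apply, mul_zero, zero_mul, Finset.sum_const_zero]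
  simp only [hinterior, zero_add, integralBoundary_standardMetric,
    innerBoundary_smul_standardMetric_self φ (norm_eq_of_mem_sphere _), integral_const_mul] at htest
  have hn1 : (n : ℝ) - 1 ≠ 0 := sub_ne_zero.mpr (by exact_mod_cast (by omega : n ≠ 1))
  exact (mul_eq_zero.mp htest).resolve_left hn1

theorem mem_kerAdjoint_standardMetric_iff (hn : 2 ≤ n) {f : upper n → ℝ} :
    f ∈ kerAdjoint (standardMetric n) ↔ IsSmooth f ∧
      (∀ y ∈ disc n, adjointTensor (standardMetric n) (inChart f) y = 0) ∧
      ∀ y, ‖y‖ = 1 → radialDeriv (inChart f) y = 0 := by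
  have hzero : IsSmoothSymm (0 : Tensor n) :=
    ⟨fun _ _ => contDiffOn_const, fun _ _ => Matrix.isSymm_zero⟩
  have hinnerZero (h : Tensor n) : integralM (standardMetric n) (innerM (standardMetric n) h 0) +
      integralBoundary (standardMetric n) (innerBoundary (standardMetric n) h 0) = 0 := by
    simp [integralM, integralBoundary, innerM, innerBoundary]
  constructor
  · rintro ⟨hf, -, -, hker⟩
    obtain ⟨hA, -, hadj⟩ := adjointEq_standardMetric hf
    exact ⟨hf, eq_zero_of_forall_integralM_add_integralBoundary_eq_zero hn hA
      (smooth_radialDeriv hf) fun h hh => by rw [← hadj h hh, hker h hh, hinnerZero]⟩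
  · rintro ⟨hf, hA, hφ⟩
    refine ⟨hf, hzero, hzero, fun h hh => ?_⟩
    have hinterior : integralM (standardMetric n)
        (innerM (standardMetric n) h (adjointTensor (standardMetric n) (inChart f))) = 0 :=
      setIntegral_eq_zero_of_forall_eq_zero fun y hy => by
        simp only [innerM, hA y hy, Matrix.zero_apply, mul_zero, zero_mul, Finset.sum_const_zero]
    have hboundary : integralBoundary (standardMetric n) (innerBoundary (standardMetric n) h
        fun y => radialDeriv (inChart f) y • standardMetric n y) = 0 := by
      simp only [integralBoundary, innerBoundary, hφ _ (norm_eq_of_mem_sphere _), zero_smul,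
        Matrix.zero_apply, mul_zero, zero_mul, Finset.sum_const_zero, integral_zero]
    rw [(adjointEq_standardMetric hf).2.2 h hh, hinterior, hboundary, hinnerZero, add_zero]

end Uniqueness

section Obata

variable {F : EuclideanSpace ℝ (Fin n) → ℝ} {y : EuclideanSpace ℝ (Fin n)}

lemma adjointTensor_standardMetric_eq_zero_iff (hn : 2 ≤ n) (F : EuclideanSpace ℝ (Fin n) → ℝ)
    (hy : y ∈ disc n) : adjointTensor (standardMetric n) F y = 0 ↔
      ∀ i j, hessian (standardMetric n) F y i j = -F y * ρ y ^ 2 * δ i j := by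
  have hn1 : (n : ℝ) - 1 ≠ 0 := sub_ne_zero.mpr (by exact_mod_cast (by omega : n ≠ 1))
  rw [← Matrix.ext_iff]
  simp only [adjointTensor_standardMetric_apply F _ _ hy, Matrix.zero_apply]
  constructor
  · intro h i j
    have hsum := Finset.sum_eq_zero fun i (_ : i ∈ Finset.univ) => h i i
    rw [Finset.sum_sub_distrib, ← Finset.mul_sum, sum_delta_self] at hsum
    have htrace : ∑ l, hessian (standardMetric n) F y l l = -(n * ρ y ^ 2 * F y) :=
      mul_left_cancel₀ hn1 (by linear_combination -hsum)
    linear_combination h i j + htrace * δ i j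
  · intro h i j
    simp only [h, ← Finset.mul_sum, sum_delta_self]
    ring

lemma pd_inv_conformalFactor_mul (i : Fin n) (hF : DifferentiableWithinAt ℝ F (disc n) y)
    (hy : y ∈ disc n) :
    pd i (fun z => (ρ z)⁻¹ * F z) y = (ρ y)⁻¹ * (pd i F y - σ i y * F y) := by
  rw [pd_mul i (smooth_inv_conformalFactor.differentiableWithinAt hy) hF hy,
    pd_inv_conformalFactor i hy]
  ring

lemma pd_pd_inv_conformalFactor_mul (i j : Fin n) (hF : SmoothOnDisc F) (hy : y ∈ disc n) :
    pd j (pd i fun z => (ρ z)⁻¹ * F z) y = (ρ y)⁻¹ * (hessian (standardMetric n) F y i j +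
      (ρ y * F y - ∑ l, σ l y * pd l F y) * δ i j) := by
  have hFi := (hF.pd i).differentiableWithinAt hy
  have hσ := (smooth_pdLogFactor i).differentiableWithinAt hy
  have hFd := hF.differentiableWithinAt hy
  rw [pd_congr (fun z hz => pd_inv_conformalFactor_mul i (hF.differentiableWithinAt hz) hz) j hy,
    pd_inv_conformalFactor_mul j (hFi.fun_sub (hσ.fun_mul hFd)) hy,
    pd_sub j hFi (hσ.fun_mul hFd) hy, pd_mul j hσ hFd hy, pd_pdLogFactor i j hy,
    hessian_standardMetric F i j hy]
  ring

/-- The linear function `∑ b_j x_j + d x_{n+1}` in the stereographic chart, where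
`x_j = ρ y_j` for `j ≤ n` and `x_{n+1} = ρ - 1`. -/
def linearInChart (b : Fin n → ℝ) (d : ℝ) (y : EuclideanSpace ℝ (Fin n)) : ℝ :=
  ρ y * (∑ j, b j * y j + d) - d

lemma exists_linearInChart_of_hessian_eq (hn : 2 ≤ n) (hF : SmoothOnDisc F)
    (h : ∀ y ∈ disc n, ∀ i j,
      hessian (standardMetric n) F y i j = -F y * ρ y ^ 2 * δ i j) :
    ∃ b d, Set.EqOn F (linearInChart b d) (disc n) := by
  set P : EuclideanSpace ℝ (Fin n) → ℝ := fun z => (ρ z)⁻¹ * F z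
  have hP : SmoothOnDisc P := smooth_inv_conformalFactor.mul hF
  set v : EuclideanSpace ℝ (Fin n) → ℝ :=
    fun z => (ρ z)⁻¹ * (ρ z * F z - ∑ l, σ l z * pd l F z - F z * ρ z ^ 2)
  have hv : SmoothOnDisc v := smooth_inv_conformalFactor.mul (((smooth_conformalFactor.mul hF).sub
    (ContDiffOn.sum fun l _ => (smooth_pdLogFactor l).mul (hF.pd l))).sub
      (hF.mul (smooth_conformalFactor.pow 2)))
  have hhess (z : EuclideanSpace ℝ (Fin n)) (hz : z ∈ disc n) (i j : Fin n) :
      pd j (pd i P) z = δ i j * v z := by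
    rw [pd_pd_inv_conformalFactor_mul i j hF hz, h z hz i j]
    ring
  have hρ0 : ρ (0 : EuclideanSpace ℝ (Fin n)) = 2 := by simp [conformalFactor]
  refine ⟨fun i => pd i P 0, F 0, fun y hy => ?_⟩
  have hquad := eq_quadratic_of_hessian_eq_trace hn hP (hv.differentiableOn (by simp)) hhess hy
  have hv0 : v 0 = -F 0 := by
    simp only [v, hρ0, pdLogFactor, PiLp.zero_apply, mul_zero, neg_zero, zero_mul,
      Finset.sum_const_zero]
    ring
  have hP0 : P 0 = F 0 / 2 := by simp only [P, hρ0]; ring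
  have hnorm : ρ y * (1 + ‖y‖ ^ 2) = 2 := div_mul_cancel₀ 2 (by positivity)
  rw [hv0, hP0] at hquad
  rw [linearInChart]
  linear_combination ρ y * hquad - F y * conformalFactor_mul_inv y - F 0 / 2 * hnorm

end Obata

section LinearFunctions

variable {y : EuclideanSpace ℝ (Fin n)} (b : Fin n → ℝ) (d : ℝ)

lemma smooth_linearInChart : SmoothOnDisc (linearInChart b d) :=
  (smooth_conformalFactor.mul ((ContDiffOn.sum fun j _ =>
    contDiffOn_const.mul (smoothOnDisc_coord j)).add contDiffOn_const)).sub contDiffOn_const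

lemma pd_linearInChart (i : Fin n) (hy : y ∈ disc n) :
    pd i (linearInChart b d) y = σ i y * (linearInChart b d y + d) + ρ y * b i := by
  have hlin : SmoothOnDisc fun z : EuclideanSpace ℝ (Fin n) => ∑ j, b j * z j :=
    ContDiffOn.sum fun j _ => contDiffOn_const.mul (smoothOnDisc_coord j)
  have hlind := hlin.differentiableWithinAt hy
  have hconst : DifferentiableWithinAt ℝ (fun _ => d) (disc n) y := differentiableWithinAt_const d
  have hρ := smooth_conformalFactor.differentiableWithinAt hy
  change pd i (fun z => ρ z * (∑ j, b j * z j + d) - d) y = _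
  rw [pd_sub i (hρ.fun_mul (hlind.fun_add hconst)) hconst hy,
    pd_mul i hρ (hlind.fun_add hconst) hy, pd_add i hlind hconst hy, pd_const,
    pd_sum_const_mul_coord b i hy, pd_conformalFactor i hy, linearInChart]
  ring

lemma sum_pdLogFactor_mul_pd_linearInChart (hy : y ∈ disc n) :
    ∑ l, σ l y * pd l (linearInChart b d) y =
      (ρ y - ρ y ^ 2) * (linearInChart b d y + d) + ρ y ^ 2 * d := by
  have hexp (l : Fin n) : σ l y * pd l (linearInChart b d) y =
      σ l y * σ l y * (linearInChart b d y + d) - ρ y ^ 2 * (b l * y l) := by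
    rw [pd_linearInChart b d l hy, pdLogFactor]
    ring
  simp only [hexp, Finset.sum_sub_distrib, ← Finset.sum_mul, ← Finset.mul_sum,
    sum_pdLogFactor_mul_self, linearInChart]
  ring

lemma pd_pd_linearInChart (i j : Fin n) (hy : y ∈ disc n) :
    pd j (pd i (linearInChart b d)) y =
      (2 * σ i y * σ j y - ρ y * δ i j) * (linearInChart b d y + d) +
        ρ y * (σ i y * b j + σ j y * b i) := by
  have hσ := (smooth_pdLogFactor i).differentiableWithinAt hy
  have hρ := smooth_conformalFactor.differentiableWithinAt hy
  have hℓ := (smooth_linearInChart b d).differentiableWithinAt hy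
  have hconst (c : ℝ) : DifferentiableWithinAt ℝ (fun _ => c) (disc n) y :=
    differentiableWithinAt_const c
  rw [pd_congr (fun z hz => pd_linearInChart b d i hz) j hy,
    pd_add j (hσ.fun_mul (hℓ.fun_add (hconst d))) (hρ.fun_mul (hconst _)) hy,
    pd_mul j hσ (hℓ.fun_add (hconst d)) hy, pd_add j hℓ (hconst d) hy, pd_mul j hρ (hconst _) hy,
    pd_pdLogFactor i j hy, pd_linearInChart b d j hy, pd_conformalFactor j hy, pd_const, pd_const]
  ring

lemma hessian_linearInChart (hy : y ∈ disc n) (i j : Fin n) :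
    hessian (standardMetric n) (linearInChart b d) y i j =
      -linearInChart b d y * ρ y ^ 2 * δ i j := by
  rw [hessian_standardMetric _ i j hy, pd_pd_linearInChart b d i j hy,
    sum_pdLogFactor_mul_pd_linearInChart b d hy, pd_linearInChart b d i hy,
    pd_linearInChart b d j hy]
  ring

lemma radialDeriv_linearInChart (hy : ‖y‖ = 1) : radialDeriv (linearInChart b d) y = -d := by
  have hexp (l : Fin n) : y l * pd l (linearInChart b d) y =
      b l * y l - y l * y l * (linearInChart b d y + d) := by
    rw [pd_linearInChart b d l (by simp [hy]), pdLogFactor, conformalFactor_eq_one hy]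
    ring
  simp only [radialDeriv, hexp, Finset.sum_sub_distrib, ← Finset.sum_mul, sum_mul_self_eq_norm_sq,
    hy, linearInChart, conformalFactor_eq_one hy]
  ring

end LinearFunctions

section Kernel

variable {F G : EuclideanSpace ℝ (Fin n) → ℝ} {f g : upper n → ℝ}
  {y : EuclideanSpace ℝ (Fin n)}

lemma hessian_congr (g : Tensor n) (h : Set.EqOn F G (disc n)) (hy : y ∈ disc n) :
    hessian g F y = hessian g G y := by
  ext i j
  simp only [hessian, Matrix.of_apply, pd_congr (fun _ hz => pd_congr h i hz) j hy,
    pd_congr h _ hy]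

lemma radialDeriv_congr (h : Set.EqOn F G (disc n)) (hy : y ∈ disc n) :
    radialDeriv F y = radialDeriv G y := by
  simp only [radialDeriv, pd_congr h _ hy]

lemma inChart_of_mem (f : upper n → ℝ) (hy : y ∈ disc n) :
    inChart f y = f ⟨param n y, param_mem hy⟩ := by
  rw [inChart]
  exact dif_pos hy

lemma inChart_sum_smul_coord (b : Fin n → ℝ) :
    Set.EqOn (inChart (∑ i, b i • coord i)) (linearInChart b 0) (disc n) := fun y hy => by
  rw [inChart_of_mem _ hy, Finset.sum_apply, linearInChart, add_zero, sub_zero, Finset.mul_sum]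
  refine Finset.sum_congr rfl fun i _ => ?_
  simp only [Pi.smul_apply, coord, param_castSucc, smul_eq_mul, conformalFactor]
  ring

lemma eq_of_eqOn_inChart (h : Set.EqOn (inChart f) (inChart g) (disc n)) : f = g := by
  ext ⟨x, hx⟩
  obtain ⟨y, hy, rfl⟩ := (param_bijOn n).surjOn hx
  simpa only [inChart_of_mem _ hy] using h hy

lemma coord_ne_zero (i : Fin n) : coord i ≠ 0 := by
  intro h
  have hy : EuclideanSpace.single i 1 ∈ disc n := by simp
  have h0 := congrFun h ⟨param n (EuclideanSpace.single i 1), param_mem hy⟩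
  simp only [coord, param_castSucc, Pi.zero_apply] at h0
  norm_num at h0

lemma mem_kerAdjoint_of_eqOn_linearInChart (hn : 2 ≤ n) {b : Fin n → ℝ}
    (hf : Set.EqOn (inChart f) (linearInChart b 0) (disc n)) :
    f ∈ kerAdjoint (standardMetric n) := by
  refine (mem_kerAdjoint_standardMetric_iff hn).mpr
    ⟨(smooth_linearInChart b 0).congr hf, fun y hy => ?_, fun y hy => ?_⟩
  · rw [adjointTensor_standardMetric_eq_zero_iff hn _ hy, hessian_congr _ hf hy, hf hy]
    exact hessian_linearInChart b 0 hy
  · rw [radialDeriv_congr hf (by simp [hy]), radialDeriv_linearInChart b 0 hy, neg_zero]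

lemma exists_linearInChart_of_mem_kerAdjoint (hn : 2 ≤ n)
    (hf : f ∈ kerAdjoint (standardMetric n)) :
    ∃ b, Set.EqOn (inChart f) (linearInChart b 0) (disc n) := by
  obtain ⟨hsmooth, hadj, hradial⟩ := (mem_kerAdjoint_standardMetric_iff hn).mp hf
  obtain ⟨b, d, hbd⟩ := exists_linearInChart_of_hessian_eq hn hsmooth fun y hy =>
    (adjointTensor_standardMetric_eq_zero_iff hn _ hy).mp (hadj y hy)
  have hnorm : ‖(EuclideanSpace.single ⟨0, by omega⟩ 1 : EuclideanSpace ℝ (Fin n))‖ = 1 := by simp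
  have hd : -d = 0 := by
    rw [← radialDeriv_linearInChart b d hnorm, ← radialDeriv_congr hbd (by simp), hradial _ hnorm]
  exact ⟨b, neg_eq_zero.mp hd ▸ hbd⟩

theorem kerAdjoint_standardMetric (hn : 2 ≤ n) : kerAdjoint (standardMetric n) =
    (Submodule.span ℝ (Set.range (coord (n := n))) : Set (upper n → ℝ)) := by
  ext f
  rw [SetLike.mem_coe, Submodule.mem_span_range_iff_exists_fun]
  constructor
  · intro hf
    obtain ⟨b, hb⟩ := exists_linearInChart_of_mem_kerAdjoint hn hf
    exact ⟨b, eq_of_eqOn_inChart ((inChart_sum_smul_coord b).trans hb.symm)⟩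
  · rintro ⟨b, rfl⟩
    exact mem_kerAdjoint_of_eqOn_linearInChart hn (inChart_sum_smul_coord b)

end Kernel

end Hemisphere

end

theorem proposition4p1_general (n : ℕ) (hn : 2 ≤ n) :
    Hemisphere.IsSingular (Hemisphere.standardMetric n) ∧
      Hemisphere.kerAdjoint (Hemisphere.standardMetric n) =
        (Submodule.span ℝ (Set.range (Hemisphere.coord (n := n))) :
          Set (Hemisphere.upper n → ℝ)) := by
  have hker := Hemisphere.kerAdjoint_standardMetric hn
  refine ⟨⟨Hemisphere.coord ⟨0, by omega⟩, ?_, Hemisphere.coord_ne_zero _⟩, hker⟩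
  rw [hker]
  exact Submodule.subset_span ⟨_, rfl⟩

theorem proposition4p1 (n : ℕ) (hn : 3 ≤ n) :
    Hemisphere.IsSingular (Hemisphere.standardMetric n) ∧
      Hemisphere.kerAdjoint (Hemisphere.standardMetric n) =
        (Submodule.span ℝ (Set.range (Hemisphere.coord (n := n))) :
          Set (Hemisphere.upper n → ℝ)) :=
  proposition4p1_general n (by omega)
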